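/- Let $\mathbb K$ be an algebraically closed field of characteristic zero, and let $\mathbf{Art}_{\mathbb K}$ be the category of local Artinian $\mathbb K$-algebras $(A,\mathfrak m_A)$ with residue field $\mathbb K$. **Conventions.** For a differential graded Lie algebra (DGLA) $L$ and $A\in\mathbf{Art}_{\mathbb K}$, let $\operatorname{MC}_L(A)=\{x\in L^1\otimes\mathfrak m_A \mid dx+\frac12[x,x]=0\}$, let $a\bullet b=\log(e^ae^b)$ be the Baker–Campbell–Hausdorff product on $L^0\otimes\mathfrak m_A$, let $$e^a*x=x+\sum_{n\ge 0}\frac{(\operatorname{ad} a)^n}{(n+1)!}\,([a,x]-da)$$ be the gauge action, and let $\operatorname{Def}_L(A)=\operatorname{MC}_L(A)/\text{gauge}$. A functor $F:\mathbf{Art}_{\mathbb K}\to\mathbf{Set}$ is a *deformation functor* if $F(\mathbb K)$ is a point and, for all $B\to A\leftarrow C$ in $\mathbf{Art}_{\mathbb K}$, the map $F(B\times_AC)\to F(B)\times_{F(A)}F(C)$ is surjective if $B\to A$ is surjective, and bijective if $A=\mathbb K$. Let $\mathfrak g^\Delta$ be a semicosimplicial DGLA: DGLAs $\mathfrak g_n$,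 $n\ge 0$, with DGLA morphisms $\partial_{k,n}:\mathfrak g_{n-1}\to\mathfrak g_n$, $0\le k\le n$, such that $\partial_{k+1,n+1}\partial_{l,n}=\partial_{l,n+1}\partial_{k,n}$ for $k\ge l$. Let $\Omega_n=\mathbb K[t_0,\dots,t_n,dt_0,\dots,dt_n]/(\sum t_i-1,\sum dt_i)$, with face maps $\delta^{k,n}:\Omega_n\to\Omega_{n-1}$ (restriction to $t_k=0$). The Thom–Whitney DGLA $\operatorname{Tot}_{TW}(\mathfrak g^\Delta)$ consists in degree $i$ of the sequences $(x_n)_n$, $x_n\in(\Omega_n\otimes\mathfrak g_n)^i$, with $\delta^{k,n}x_n=\partial_{k,n}x_{n-1}$ for all $0\le k\le n$, $n\ge 1$. Let $Z^1_{\rm sc}(\exp\mathfrak g^\Delta)(A)$ be the set of pairs $(l,m)\in(\mathfrak g_0^1\oplus\mathfrak g_1^0)\otimes\mathfrak m_A$ such that $dl+\frac12[l,l]=0$, $\partial_{1,1}l=e^m*\partial_{0,1}l$, and $\partial_{0,2}m\bullet(-\partial_{1,2}m)\bullet\partial_{2,2}m=dn+[\partial_{2,2}\partial_{0,1}l,n]$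 for some $n\in\mathfrak g_2^{-1}\otimes\mathfrak m_A$. Let $H^1_{\rm sc}(\exp\mathfrak g^\Delta)(A)$ be its quotient by the relation: $(l_0,m_0)\sim(l_1,m_1)$ if and only if there are $a\in\mathfrak g_0^0\otimes\mathfrak m_A$ and $b\in\mathfrak g_1^{-1}\otimes\mathfrak m_A$ with $e^a*l_0=l_1$ and $(-m_0)\bullet(-\partial_{1,1}a)\bullet m_1\bullet\partial_{0,1}a=db+[\partial_{0,1}l_0,b]$. Finally, $\mathfrak g^{\Delta_{[0,1]}}$ is the semicosimplicial DGLA obtained from $\mathfrak g^\Delta$ by replacing $\mathfrak g_n$ by $0$ for all $n\ge 2$. **Statement.** For every $A\in\mathbf{Art}_{\mathbb K}$, each element of $\operatorname{MC}_{\operatorname{Tot}_{TW}(\mathfrak g^{\Delta_{[0,1]}})}(A)$ can be written in a unique way as $(x,\,e^{p(t)}*\partial_{0,1}x)$ with $x\in\operatorname{MC}_{\mathfrak g_0}(A)$ and $p(t)\in(\mathfrak g_1^0[t]\cdot t)\otimes\mathfrak m_A$, where $t=t_0$ is the coordinate on the $1$-simplex that is $0$ on the face of index $0$ and $1$ on the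 face of index $1$. The map $$\Phi_{[0,1]}:(x,\,e^{p(t)}*\partial_{0,1}x)\mapsto(x,p(1))$$ takes values in $Z^1_{\rm sc}(\exp\mathfrak g^{\Delta_{[0,1]}})(A)$ and induces an isomorphism of functors $\mathbf{Art}_{\mathbb K}\to\mathbf{Set}$ $$\operatorname{Def}_{\operatorname{Tot}_{TW}(\mathfrak g^{\Delta_{[0,1]}})}\;\xrightarrow{\ \sim\ }\;H^1_{\rm sc}(\exp\mathfrak g^{\Delta_{[0,1]}}).$$ In particular, $H^1_{\rm sc}(\exp\mathfrak g^{\Delta_{[0,1]}})$ is a deformation functor. -/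

import Mathlib

universe u v w

open CategoryTheory TensorProduct

noncomputable section

namespace ThomWhitney

section Graded

variable {K : Type u} [Field K] {V : Type v} [AddCommGroup V] [Module K V]

/-- The isomorphism of a graded vector space with the direct sum of its components. -/
def decomp (gr : ℤ → Submodule K V) (h : DirectSum.IsInternal gr) :
    V ≃ₗ[K] DirectSum ℤ fun i => gr i :=
  (LinearEquiv.ofBijective (DirectSum.coeLinearMap gr)
    (show Function.Bijective (DirectSum.coeLinearMap gr) from h)).symm

/-- The projection of a graded vector space onto the sum of its components of odd degree. -/
def oddPart (gr : ℤ → Submodule K V) (h : DirectSum.IsInternal gr) : V →ₗ[K] V :=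
  (DirectSum.toModule K ℤ V fun i => if Odd i then (gr i).subtype else 0) ∘ₗ
    (decomp gr h).toLinearMap

/-- The map sending `x` of degree `i` to `x` placed at the index `i`. -/
def weight (gr : ℤ → Submodule K V) (h : DirectSum.IsInternal gr) : V →ₗ[K] (ℤ →₀ V) :=
  (DirectSum.toModule K ℤ (ℤ →₀ V) fun i => Finsupp.lsingle i ∘ₗ (gr i).subtype) ∘ₗ
    (decomp gr h).toLinearMap

theorem decomp_of_mem {gr : ℤ → Submodule K V} (h : DirectSum.IsInternal gr) {i : ℤ} {x : V}
    (hx : x ∈ gr i) : decomp gr h x =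
      DirectSum.lof K ℤ (fun i => gr i) i ⟨x, hx⟩ := by
  rw [decomp, LinearEquiv.symm_apply_eq, LinearEquiv.ofBijective_apply,
    DirectSum.coeLinearMap_lof]

theorem oddPart_odd {gr : ℤ → Submodule K V} (h : DirectSum.IsInternal gr) {i : ℤ} {x : V}
    (hx : x ∈ gr i) (hi : Odd i) : oddPart gr h x = x := by
  simp [oddPart, decomp_of_mem h hx, DirectSum.toModule_lof, hi]

theorem oddPart_even {gr : ℤ → Submodule K V} (h : DirectSum.IsInternal gr) {i : ℤ} {x : V}
    (hx : x ∈ gr i) (hi : Even i) : oddPart gr h x = 0 := by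
  have : ¬ Odd i := by simpa using hi
  simp [oddPart, decomp_of_mem h hx, DirectSum.toModule_lof, this]

theorem weight_of_mem {gr : ℤ → Submodule K V} (h : DirectSum.IsInternal gr) {i : ℤ} {x : V}
    (hx : x ∈ gr i) : weight gr h x = Finsupp.single i x := by
  simp [weight, decomp_of_mem h hx, DirectSum.toModule_lof]

/-- A spanning family of subspaces is a grading as soon as some family of linear maps separates
the degrees. -/
theorem isInternal_of_weight {ι : Type*} {W : ι → Type*} [∀ n, AddCommGroup (W n)]
    [∀ n, Module K (W n)] (gr : ℤ → Submodule K V) (p : ∀ n, V →ₗ[K] W n)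
    (hp : ∀ x, (∀ n, p n x = 0) → x = 0) (ρ : ∀ n, W n →ₗ[K] (ℤ →₀ W n))
    (hρ : ∀ n i, ∀ x ∈ gr i, ρ n (p n x) = Finsupp.single i (p n x))
    (htop : ⨆ i, gr i = ⊤) : DirectSum.IsInternal gr := by
  constructor
  · change Function.Injective (DirectSum.coeLinearMap gr)
    rw [injective_iff_map_eq_zero]
    intro f hf
    have key : ∀ n (f : DirectSum ℤ fun i => gr i) (j : ℤ),
        (ρ n (p n (DirectSum.coeLinearMap gr f))) j = p n (f j : V) := by
      intro n f j
      induction f using DirectSum.induction_on with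
      | zero => simp
      | of i x =>
        have h1 : DirectSum.coeLinearMap gr (DirectSum.of (fun i => gr i) i x) = (x : V) :=
          DirectSum.coeLinearMap_of gr i x
        rw [h1, hρ n i x x.2]
        by_cases hij : i = j
        · subst hij; simp
        · rw [Finsupp.single_eq_of_ne (Ne.symm hij), DirectSum.of_eq_of_ne _ _ _ (Ne.symm hij)]
          simp
      | add f g hf hg => simp [hf, hg]
    ext j
    have : (f j : V) = 0 := hp _ fun n => by rw [← key n f j, hf]; simp
    simpa using this
  · change Function.Surjective (DirectSum.coeLinearMap gr)
    rw [← LinearMap.range_eq_top, DirectSum.range_coeLinearMap, htop]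

end Graded

/-- A differential graded Lie algebra over `K`, graded by `ℤ`, with differential of degree `1`. -/
structure DGLA (K : Type u) [Field K] where
  /-- the underlying vector space, the direct sum of all degrees -/
  carrier : Type v
  [addCommGroup : AddCommGroup carrier]
  [module : Module K carrier]
  /-- the component of degree `i` -/
  gr : ℤ → Submodule K carrier
  isInternal : DirectSum.IsInternal gr
  /-- the differential -/
  d : carrier →ₗ[K] carrier
  /-- the bracket -/
  bracket : carrier →ₗ[K] carrier →ₗ[K] carrier
  d_mem : ∀ i, ∀ x ∈ gr i, d x ∈ gr (i + 1)
  bracket_mem : ∀ i j, ∀ x ∈ gr i, ∀ y ∈ gr j, bracket x y ∈ gr (i + j)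
  d_d : ∀ x, d (d x) = 0
  skew : ∀ i j, ∀ x ∈ gr i, ∀ y ∈ gr j, bracket x y = -((-1 : K) ^ (i * j) • bracket y x)
  jacobi : ∀ i j, ∀ x ∈ gr i, ∀ y ∈ gr j, ∀ z,
    bracket x (bracket y z) = bracket (bracket x y) z + (-1 : K) ^ (i * j) • bracket y (bracket x z)
  leibniz : ∀ i, ∀ x ∈ gr i, ∀ y,
    d (bracket x y) = bracket (d x) y + (-1 : K) ^ i • bracket x (d y)

attribute [instance] DGLA.addCommGroup DGLA.module

/-- A morphism of differential graded Lie algebras. -/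
structure DGLA.Hom {K : Type u} [Field K] (L : DGLA.{u, v} K) (M : DGLA.{u, w} K) where
  /-- the underlying linear map -/
  toLin : L.carrier →ₗ[K] M.carrier
  map_mem : ∀ i, ∀ x ∈ L.gr i, toLin x ∈ M.gr i
  map_d : ∀ x, toLin (L.d x) = M.d (toLin x)
  map_bracket : ∀ x y, toLin (L.bracket x y) = M.bracket (toLin x) (toLin y)

/-- A differential graded commutative algebra over `K`. -/
structure CDGA (K : Type u) [Field K] where
  /-- the underlying vector space, the direct sum of all degrees -/
  carrier : Type v
  [ring : Ring carrier]
  [algebra : Algebra K carrier]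
  /-- the component of degree `i` -/
  gr : ℤ → Submodule K carrier
  isInternal : DirectSum.IsInternal gr
  /-- the differential -/
  d : carrier →ₗ[K] carrier
  one_mem : 1 ∈ gr 0
  mul_mem : ∀ i j, ∀ a ∈ gr i, ∀ b ∈ gr j, a * b ∈ gr (i + j)
  d_mem : ∀ i, ∀ a ∈ gr i, d a ∈ gr (i + 1)
  d_d : ∀ a, d (d a) = 0
  comm : ∀ i j, ∀ a ∈ gr i, ∀ b ∈ gr j, a * b = (-1 : K) ^ (i * j) • (b * a)
  leibniz : ∀ i, ∀ a ∈ gr i, ∀ b, d (a * b) = d a * b + (-1 : K) ^ i • (a * d b)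

attribute [instance] CDGA.ring CDGA.algebra

/-- A morphism of differential graded commutative algebras. -/
structure CDGA.Hom {K : Type u} [Field K] (Ω : CDGA.{u, v} K) (Ω' : CDGA.{u, w} K) where
  /-- the underlying algebra homomorphism -/
  toAlg : Ω.carrier →ₐ[K] Ω'.carrier
  map_mem : ∀ i, ∀ a ∈ Ω.gr i, toAlg a ∈ Ω'.gr i
  map_d : ∀ a, toAlg (Ω.d a) = Ω'.d (toAlg a)

theorem neg_one_zpow_add {K : Type u} [Field K] (i j : ℤ) :
    (-1 : K) ^ (i + j) = (-1) ^ i * (-1) ^ j := zpow_add₀ (by simp) i j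

theorem neg_one_zpow_mul_self {K : Type u} [Field K] (i : ℤ) :
    (-1 : K) ^ i * (-1) ^ i = 1 := by
  rcases Int.even_or_odd i with h | h <;> simp [h.neg_one_zpow]

section Tensor

variable {K : Type u} [Field K] (Ω : CDGA.{u, v} K) (L : DGLA.{u, w} K)

/-- The component of degree `k` of `Ω ⊗ L`: the sum of the `Ω^i ⊗ L^j` with `i + j = k`. -/
def tensorGr (k : ℤ) : Submodule K (Ω.carrier ⊗[K] L.carrier) :=
  Submodule.span K {z | ∃ i j, i + j = k ∧ ∃ a ∈ Ω.gr i, ∃ x ∈ L.gr j, z = a ⊗ₜ[K] x}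

/-- `d (a ⊗ x) = d a ⊗ x + (-1) ^ |a| a ⊗ d x`. -/
def tensorD : Ω.carrier ⊗[K] L.carrier →ₗ[K] Ω.carrier ⊗[K] L.carrier :=
  TensorProduct.map Ω.d LinearMap.id +
    TensorProduct.map (LinearMap.id - (2 : K) • oddPart Ω.gr Ω.isInternal) L.d

/-- `[a ⊗ x, b ⊗ y] = (-1) ^ (|x| |b|) a b ⊗ [x, y]`: the sign is `-1` on the odd parts of
`x` and `b`, and `1` otherwise. -/
def tensorBracket : Ω.carrier ⊗[K] L.carrier →ₗ[K]
    Ω.carrier ⊗[K] L.carrier →ₗ[K] Ω.carrier ⊗[K] L.carrier :=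
  TensorProduct.map₂ (LinearMap.mul K Ω.carrier) L.bracket +
    (-2 : K) • TensorProduct.map₂ ((LinearMap.mul K Ω.carrier).compl₂ (oddPart Ω.gr Ω.isInternal))
      (L.bracket ∘ₗ oddPart L.gr L.isInternal)

variable {Ω L}

theorem tensorD_tmul {i : ℤ} {a : Ω.carrier} (ha : a ∈ Ω.gr i) (x : L.carrier) :
    tensorD Ω L (a ⊗ₜ x) = Ω.d a ⊗ₜ x + (-1 : K) ^ i • a ⊗ₜ[K] L.d x := by
  rcases Int.even_or_odd i with h | h
  · simp [tensorD, oddPart_even Ω.isInternal ha h, h.neg_one_zpow]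
  · simp only [tensorD, LinearMap.add_apply, TensorProduct.map_tmul, LinearMap.id_apply,
      LinearMap.sub_apply, LinearMap.smul_apply, oddPart_odd Ω.isInternal ha h, h.neg_one_zpow]
    rw [sub_tmul, ← smul_tmul']
    module

theorem tensorBracket_tmul {i j : ℤ} {b : Ω.carrier} {x : L.carrier} (hb : b ∈ Ω.gr i)
    (hx : x ∈ L.gr j) (a : Ω.carrier) (y : L.carrier) :
    tensorBracket Ω L (a ⊗ₜ x) (b ⊗ₜ y) = (-1 : K) ^ (j * i) • (a * b) ⊗ₜ[K] L.bracket x y := by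
  rcases Int.even_or_odd i with h | h
  · simp [tensorBracket, oddPart_even Ω.isInternal hb h, (h.mul_left j).neg_one_zpow]
  · rcases Int.even_or_odd j with h' | h'
    · simp [tensorBracket, oddPart_even L.isInternal hx h', (h'.mul_right i).neg_one_zpow]
    · simp [tensorBracket, oddPart_odd Ω.isInternal hb h, oddPart_odd L.isInternal hx h',
        (h'.mul h).neg_one_zpow]
      module

theorem tmul_mem {i j : ℤ} {a : Ω.carrier} {x : L.carrier} (ha : a ∈ Ω.gr i) (hx : x ∈ L.gr j) :
    a ⊗ₜ[K] x ∈ tensorGr Ω L (i + j) :=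
  Submodule.subset_span ⟨i, j, rfl, a, ha, x, hx, rfl⟩

theorem exists_sum_gr {V : Type v} [AddCommGroup V] [Module K V] {gr : ℤ → Submodule K V}
    (h : DirectSum.IsInternal gr) {P : V → Prop} (h0 : P 0) (hadd : ∀ x y, P x → P y → P (x + y))
    (hP : ∀ i, ∀ x ∈ gr i, P x) (x : V) : P x := by
  have hx : x ∈ ⨆ i, gr i := by rw [h.submodule_iSup_eq_top]; trivial
  exact Submodule.iSup_induction gr (motive := P) hx hP h0 hadd

/-- Induction over sums of tensors of homogeneous elements. -/
theorem tensor_ind {P : Ω.carrier ⊗[K] L.carrier → Prop} (h0 : P 0)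
    (hadd : ∀ x y, P x → P y → P (x + y))
    (h : ∀ i j, ∀ a ∈ Ω.gr i, ∀ x ∈ L.gr j, P (a ⊗ₜ x)) (z) : P z := by
  induction z using TensorProduct.induction_on with
  | zero => exact h0
  | add x y hx hy => exact hadd x y hx hy
  | tmul a x =>
    refine exists_sum_gr Ω.isInternal (P := fun a => P (a ⊗ₜ x)) (by simpa using h0)
      (fun a b ha hb => by rw [add_tmul]; exact hadd _ _ ha hb) (fun i a ha => ?_) a
    exact exists_sum_gr L.isInternal (P := fun x => P (a ⊗ₜ x)) (by simpa using h0)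
      (fun a b ha hb => by rw [tmul_add]; exact hadd _ _ ha hb) (fun j x hx => h i j a ha x hx) x

theorem tensorGr_ind {k : ℤ} {P : Ω.carrier ⊗[K] L.carrier → Prop} (h0 : P 0)
    (hadd : ∀ x y, P x → P y → P (x + y))
    (h : ∀ i j, i + j = k → ∀ a ∈ Ω.gr i, ∀ x ∈ L.gr j, P (a ⊗ₜ x)) {z}
    (hz : z ∈ tensorGr Ω L k) : P z := by
  refine Submodule.closure_induction (p := fun z _ => P z) h0 (fun x y _ _ => hadd x y) ?_ hz
  rintro r _ ⟨i, j, hij, a, ha, x, hx, rfl⟩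
  rw [smul_tmul']
  exact h i j hij _ ((Ω.gr i).smul_mem r ha) x hx

variable (Ω L)

/-- The map sending a tensor of degrees `i` and `j` to itself placed at the index `i + j`. -/
def tensorWeight : Ω.carrier ⊗[K] L.carrier →ₗ[K] (ℤ →₀ Ω.carrier ⊗[K] L.carrier) :=
  TensorProduct.lift
    ((Finsupp.lsum K (M := Ω.carrier) (N := (ℤ →₀ L.carrier) →ₗ[K] (ℤ →₀ Ω.carrier ⊗[K] L.carrier))
      (fun i : ℤ => (LinearMap.flip (Finsupp.lsum K (M := L.carrier) (N := Ω.carrier →ₗ[K] (ℤ →₀ Ω.carrier ⊗[K] L.carrier))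
        (fun j : ℤ => ((TensorProduct.mk K Ω.carrier L.carrier).compr₂ (Finsupp.lsingle (i + j))).flip))))).compl₁₂
      (weight Ω.gr Ω.isInternal) (weight L.gr L.isInternal))

theorem tensorWeight_tmul {i j : ℤ} {a : Ω.carrier} {x : L.carrier} (ha : a ∈ Ω.gr i)
    (hx : x ∈ L.gr j) : tensorWeight Ω L (a ⊗ₜ x) = Finsupp.single (i + j) (a ⊗ₜ x) := by
  simp [tensorWeight, weight_of_mem Ω.isInternal ha, weight_of_mem L.isInternal hx]

theorem tensorWeight_of_mem {k : ℤ} {z} (hz : z ∈ tensorGr Ω L k) :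
    tensorWeight Ω L z = Finsupp.single k z := by
  refine tensorGr_ind (P := fun z => tensorWeight Ω L z = Finsupp.single k z) (by simp)
    (fun x y hx hy => by rw [map_add, hx, hy, Finsupp.single_add]) ?_ hz
  rintro i j rfl a ha x hx
  exact tensorWeight_tmul Ω L ha hx

theorem tensorGr_isInternal : DirectSum.IsInternal (tensorGr Ω L) := by
  refine isInternal_of_weight (ι := Unit) (tensorGr Ω L) (fun _ => LinearMap.id) (fun x h => h ())
    (fun _ => tensorWeight Ω L) (fun _ i x hx => tensorWeight_of_mem Ω L hx) ?_
  rw [eq_top_iff]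
  rintro z -
  refine tensor_ind (P := fun z => z ∈ ⨆ i, tensorGr Ω L i) (Submodule.zero_mem _)
    (fun x y => Submodule.add_mem _) (fun i j a ha x hx => ?_) z
  exact Submodule.mem_iSup_of_mem (i + j) (tmul_mem ha hx)

/-- The tensor product `Ω ⊗ L` of a differential graded commutative algebra and a differential
graded Lie algebra. -/
def tensor : DGLA.{u, max v w} K where
  carrier := Ω.carrier ⊗[K] L.carrier
  gr := tensorGr Ω L
  isInternal := tensorGr_isInternal Ω L
  d := tensorD Ω L
  bracket := tensorBracket Ω L
  d_mem k z hz := by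
    refine tensorGr_ind (P := fun z => tensorD Ω L z ∈ tensorGr Ω L (k + 1)) (by simp)
      (fun x y hx hy => by rw [map_add]; exact Submodule.add_mem _ hx hy) ?_ hz
    rintro i j rfl a ha x hx
    rw [tensorD_tmul ha]
    refine Submodule.add_mem _ ?_ (Submodule.smul_mem _ _ ?_)
    · have := tmul_mem (Ω.d_mem i a ha) hx
      rwa [show i + 1 + j = i + j + 1 by ring] at this
    · have := tmul_mem ha (L.d_mem j x hx)
      rwa [← add_assoc] at this
  bracket_mem k l z hz w hw := by
    refine tensorGr_ind (P := fun z => tensorBracket Ω L z w ∈ tensorGr Ω L (k + l)) (by simp)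
      (fun x y hx hy => by rw [map_add]; exact Submodule.add_mem _ hx hy) ?_ hz
    rintro i j rfl a ha x hx
    refine tensorGr_ind (P := fun w => tensorBracket Ω L (a ⊗ₜ x) w ∈ tensorGr Ω L (i + j + l))
      (by simp) (fun x y hx hy => by rw [map_add]; exact Submodule.add_mem _ hx hy) ?_ hw
    rintro i' j' rfl b hb y hy
    rw [tensorBracket_tmul hb hx]
    refine Submodule.smul_mem _ _ ?_
    have := tmul_mem (Ω.mul_mem i i' a ha b hb) (L.bracket_mem j j' x hx y hy)
    rwa [show i + i' + (j + j') = i + j + (i' + j') by ring] at this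
  d_d z := by
    refine tensor_ind (P := fun z => tensorD Ω L (tensorD Ω L z) = 0) (by simp)
      (fun x y hx hy => by rw [map_add, map_add, hx, hy, add_zero]) (fun i j a ha x hx => ?_) z
    rw [tensorD_tmul ha, map_add, map_smul, tensorD_tmul (Ω.d_mem i a ha), tensorD_tmul ha,
      Ω.d_d, L.d_d, neg_one_zpow_add]
    simp only [zero_tmul, tmul_zero, smul_zero, add_zero, zero_add, zpow_one]
    module
  skew k l z hz w hw := by
    refine tensorGr_ind (P := fun z => tensorBracket Ω L z w =
      -((-1 : K) ^ (k * l) • tensorBracket Ω L w z)) (by simp)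
      (fun x y hx hy => by
        simp only [map_add, LinearMap.add_apply]; rw [hx, hy]; module) ?_ hz
    rintro i j rfl a ha x hx
    refine tensorGr_ind (P := fun w => tensorBracket Ω L (a ⊗ₜ x) w =
      -((-1 : K) ^ ((i + j) * l) • tensorBracket Ω L w (a ⊗ₜ x)))
      (by simp) (fun x y hx hy => by
        simp only [map_add, LinearMap.add_apply]; rw [hx, hy]; module) ?_ hw
    rintro i' j' rfl b hb y hy
    rw [tensorBracket_tmul hb hx, tensorBracket_tmul ha hy, Ω.comm i i' a ha b hb,
      L.skew j j' x hx y hy, tmul_neg, ← smul_tmul', tmul_smul, smul_neg, smul_smul, smul_smul,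
      smul_smul, ← neg_one_zpow_add, ← neg_one_zpow_add, ← neg_one_zpow_add,
      show (i + j) * (i' + j') + j' * i = j * i' + i * i' + j * j' + (j' * i + j' * i) by ring,
      neg_one_zpow_add _ (j' * i + j' * i), neg_one_zpow_add (j' * i), neg_one_zpow_mul_self,
      mul_one]
  jacobi k l z hz w hw v := by
    refine tensorGr_ind (P := fun z => tensorBracket Ω L z (tensorBracket Ω L w v) =
      tensorBracket Ω L (tensorBracket Ω L z w) v +
        (-1 : K) ^ (k * l) • tensorBracket Ω L w (tensorBracket Ω L z v)) (by simp)
      (fun x y hx hy => by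
        simp only [map_add, LinearMap.add_apply]; rw [hx, hy]; module) ?_ hz
    rintro i j rfl a ha x hx
    refine tensorGr_ind (P := fun w => tensorBracket Ω L (a ⊗ₜ x) (tensorBracket Ω L w v) =
      tensorBracket Ω L (tensorBracket Ω L (a ⊗ₜ x) w) v +
        (-1 : K) ^ ((i + j) * l) • tensorBracket Ω L w (tensorBracket Ω L (a ⊗ₜ x) v))
      (by simp) (fun x y hx hy => by
        simp only [map_add, LinearMap.add_apply]; rw [hx, hy]; module) ?_ hw
    rintro i' j' rfl b hb y hy
    refine tensor_ind (P := fun v => tensorBracket Ω L (a ⊗ₜ x) (tensorBracket Ω L (b ⊗ₜ y) v) =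
      tensorBracket Ω L (tensorBracket Ω L (a ⊗ₜ x) (b ⊗ₜ y)) v +
        (-1 : K) ^ ((i + j) * (i' + j')) •
          tensorBracket Ω L (b ⊗ₜ y) (tensorBracket Ω L (a ⊗ₜ x) v)) (by simp)
      (fun x y hx hy => by
        simp only [map_add]; rw [hx, hy]; module) (fun i'' j'' c hc t ht => ?_) v
    rw [tensorBracket_tmul hc hy, map_smul, tensorBracket_tmul (Ω.mul_mem _ _ b hb c hc) hx,
      tensorBracket_tmul hb hx, map_smul, LinearMap.smul_apply,
      tensorBracket_tmul hc (L.bracket_mem _ _ x hx y hy),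
      tensorBracket_tmul hc hx, map_smul, tensorBracket_tmul (Ω.mul_mem _ _ a ha c hc) hy,
      L.jacobi j j' x hx y hy, ← mul_assoc, ← mul_assoc, Ω.comm i i' a ha b hb]
    simp only [tmul_add, tmul_smul, ← smul_tmul', smul_mul_assoc, smul_add, smul_smul]
    simp only [← neg_one_zpow_add]
    refine congrArg₂ (· + ·) ?_ ?_
    · congr 2
      ring
    · congr 1
      rw [show (i + j) * (i' + j') + (j * i'' + j' * (i + i'')) =
        j' * i'' + j * (i' + i'') + i * i' + j * j' + (i * j' + i * j') by ring,
        neg_one_zpow_add _ (i * j' + i * j'), neg_one_zpow_add (i * j'), neg_one_zpow_mul_self,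
        mul_one]
      congr 1
      ring
  leibniz k z hz w := by
    refine tensorGr_ind (P := fun z => tensorD Ω L (tensorBracket Ω L z w) =
      tensorBracket Ω L (tensorD Ω L z) w +
        (-1 : K) ^ k • tensorBracket Ω L z (tensorD Ω L w)) (by simp)
      (fun x y hx hy => by
        simp only [map_add, LinearMap.add_apply]; rw [hx, hy]; module) ?_ hz
    rintro i j rfl a ha x hx
    refine tensor_ind (P := fun w => tensorD Ω L (tensorBracket Ω L (a ⊗ₜ x) w) =
      tensorBracket Ω L (tensorD Ω L (a ⊗ₜ x)) w +
        (-1 : K) ^ (i + j) • tensorBracket Ω L (a ⊗ₜ x) (tensorD Ω L w)) (by simp)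
      (fun x y hx hy => by
        simp only [map_add]; rw [hx, hy]; module) (fun i' j' b hb y hy => ?_) w
    rw [tensorBracket_tmul hb hx, map_smul, tensorD_tmul (Ω.mul_mem _ _ a ha b hb),
      tensorD_tmul ha, tensorD_tmul hb, map_add, LinearMap.add_apply, map_smul,
      LinearMap.smul_apply, tensorBracket_tmul hb hx, tensorBracket_tmul hb (L.d_mem _ x hx),
      map_add, map_smul, tensorBracket_tmul (Ω.d_mem _ b hb) hx, tensorBracket_tmul hb hx,
      L.leibniz j x hx, Ω.leibniz i a ha]
    simp only [tmul_add, add_tmul, tmul_smul, ← smul_tmul', smul_add, smul_smul, mul_add,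
      add_mul, mul_one, one_mul, neg_one_zpow_add]
    have hj := neg_one_zpow_mul_self (K := K) j
    match_scalars
    · ring
    · linear_combination (-(-1 : K) ^ (j * i') * (-1) ^ i) * hj
    · ring
    · ring

/-- The morphism `f ⊗ φ`. -/
def tensorMap {Ω : CDGA.{u, v} K} {Ω' : CDGA.{u, v} K} {L : DGLA.{u, w} K} {M : DGLA.{u, w} K}
    (f : Ω.Hom Ω') (φ : L.Hom M) : (tensor Ω L).Hom (tensor Ω' M) where
  toLin := TensorProduct.map f.toAlg.toLinearMap φ.toLin
  map_mem k z hz := by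
    refine tensorGr_ind (P := fun z => TensorProduct.map f.toAlg.toLinearMap φ.toLin z ∈
      tensorGr Ω' M k) (by simp)
      (fun x y hx hy => by rw [map_add]; exact Submodule.add_mem _ hx hy) ?_ hz
    rintro i j rfl a ha x hx
    exact tmul_mem (f.map_mem i a ha) (φ.map_mem j x hx)
  map_d z := by
    refine tensor_ind (P := fun z => TensorProduct.map f.toAlg.toLinearMap φ.toLin
      (tensorD Ω L z) = tensorD Ω' M (TensorProduct.map f.toAlg.toLinearMap φ.toLin z)) (by simp)
      (fun x y hx hy => by simp only [map_add]; rw [hx, hy]) (fun i j a ha x hx => ?_) z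
    rw [tensorD_tmul ha, map_tmul, tensorD_tmul (i := i) (by exact f.map_mem i a ha)]
    simp [f.map_d, φ.map_d]
  map_bracket := by
    intro (z : Ω.carrier ⊗[K] L.carrier) (w : Ω.carrier ⊗[K] L.carrier)
    refine tensor_ind (P := fun z => TensorProduct.map f.toAlg.toLinearMap φ.toLin
      (tensorBracket Ω L z w) = tensorBracket Ω' M (TensorProduct.map f.toAlg.toLinearMap φ.toLin z)
        (TensorProduct.map f.toAlg.toLinearMap φ.toLin w)) (by simp)
      (fun x y hx hy => by simp only [map_add, LinearMap.add_apply]; rw [hx, hy])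
      (fun i j a ha x hx => ?_) z
    refine tensor_ind (P := fun w => TensorProduct.map f.toAlg.toLinearMap φ.toLin
      (tensorBracket Ω L (a ⊗ₜ x) w) = tensorBracket Ω' M
        (TensorProduct.map f.toAlg.toLinearMap φ.toLin (a ⊗ₜ x))
        (TensorProduct.map f.toAlg.toLinearMap φ.toLin w)) (by simp)
      (fun x y hx hy => by simp only [map_add]; rw [hx, hy])
      (fun i' j' b hb y hy => ?_) w
    rw [tensorBracket_tmul hb hx, map_tmul, map_tmul,
      tensorBracket_tmul (i := i') (j := j) (by exact f.map_mem i' b hb)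
        (by exact φ.map_mem j x hx)]
    simp [φ.map_bracket]

end Tensor

section Forms

variable (K : Type u) [Field K]

/-- The relations among the generators `t_i = inl i` and `dt_i = inr i` of the algebra of
polynomial differential forms on the standard `n`-simplex. -/
inductive FormRel (n : ℕ) : FreeAlgebra K (Fin (n + 1) ⊕ Fin (n + 1)) →
    FreeAlgebra K (Fin (n + 1) ⊕ Fin (n + 1)) → Prop
  | t_t (i j) : FormRel n (FreeAlgebra.ι K (.inl i) * FreeAlgebra.ι K (.inl j))
      (FreeAlgebra.ι K (.inl j) * FreeAlgebra.ι K (.inl i))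
  | t_dt (i j) : FormRel n (FreeAlgebra.ι K (.inl i) * FreeAlgebra.ι K (.inr j))
      (FreeAlgebra.ι K (.inr j) * FreeAlgebra.ι K (.inl i))
  | dt_dt (i j) : FormRel n (FreeAlgebra.ι K (.inr i) * FreeAlgebra.ι K (.inr j))
      (-(FreeAlgebra.ι K (.inr j) * FreeAlgebra.ι K (.inr i)))
  | sum_t : FormRel n (∑ i, FreeAlgebra.ι K (.inl i)) 1
  | sum_dt : FormRel n (∑ i, FreeAlgebra.ι K (.inr i)) 0

/-- `K[t_0, …, t_n, dt_0, …, dt_n] / (∑ t_i - 1, ∑ dt_i)`. -/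
def Form (n : ℕ) : Type u := RingQuot (FormRel K n)

instance (n : ℕ) : Ring (Form K n) := inferInstanceAs (Ring (RingQuot (FormRel K n)))

instance (n : ℕ) : Algebra K (Form K n) := inferInstanceAs (Algebra K (RingQuot (FormRel K n)))

/-- The quotient map from the free algebra. -/
def Form.mk (n : ℕ) : FreeAlgebra K (Fin (n + 1) ⊕ Fin (n + 1)) →ₐ[K] Form K n :=
  RingQuot.mkAlgHom K (FormRel K n)

variable {K} {n : ℕ}

theorem Form.mk_rel {x y : FreeAlgebra K (Fin (n + 1) ⊕ Fin (n + 1))} (h : FormRel K n x y) :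
    Form.mk K n x = Form.mk K n y := RingQuot.mkAlgHom_rel K h

/-- The barycentric coordinate `t_i`. -/
def tVar (i : Fin (n + 1)) : Form K n := Form.mk K n (FreeAlgebra.ι K (.inl i))

/-- The form `dt_i`. -/
def dtVar (i : Fin (n + 1)) : Form K n := Form.mk K n (FreeAlgebra.ι K (.inr i))

theorem tVar_mul_tVar (i j : Fin (n + 1)) : (tVar i * tVar j : Form K n) = tVar j * tVar i := by
  simpa [tVar] using Form.mk_rel (FormRel.t_t (K := K) i j)

theorem tVar_mul_dtVar (i j : Fin (n + 1)) : (tVar i * dtVar j : Form K n) = dtVar j * tVar i := by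
  simpa [tVar, dtVar] using Form.mk_rel (FormRel.t_dt (K := K) i j)

theorem dtVar_mul_dtVar (i j : Fin (n + 1)) :
    (dtVar i * dtVar j : Form K n) = -(dtVar j * dtVar i) := by
  simpa [dtVar] using Form.mk_rel (FormRel.dt_dt (K := K) i j)

theorem sum_tVar : ∑ i, (tVar i : Form K n) = 1 := by
  simpa [tVar] using Form.mk_rel (FormRel.sum_t (K := K) (n := n))

theorem sum_dtVar : ∑ i, (dtVar i : Form K n) = 0 := by
  simpa [dtVar] using Form.mk_rel (FormRel.sum_dt (K := K) (n := n))

/-- The universal property of the algebra of forms. -/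
def Form.lift {B : Type*} [Ring B] [Algebra K B] (t dt : Fin (n + 1) → B)
    (h₁ : ∀ i j, t i * t j = t j * t i) (h₂ : ∀ i j, t i * dt j = dt j * t i)
    (h₃ : ∀ i j, dt i * dt j = -(dt j * dt i)) (h₄ : ∑ i, t i = 1) (h₅ : ∑ i, dt i = 0) :
    Form K n →ₐ[K] B :=
  RingQuot.liftAlgHom K (s := FormRel K n) ⟨FreeAlgebra.lift K (Sum.elim t dt), by
    rintro x y (⟨i, j⟩ | ⟨i, j⟩ | ⟨i, j⟩ | _ | _)
    · simpa using h₁ i j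
    · simpa using h₂ i j
    · simpa using h₃ i j
    · simpa using h₄
    · simpa using h₅⟩

theorem Form.lift_t {B : Type*} [Ring B] [Algebra K B] (t dt : Fin (n + 1) → B) (h₁ h₂ h₃ h₄ h₅)
    (i : Fin (n + 1)) : Form.lift (K := K) t dt h₁ h₂ h₃ h₄ h₅ (tVar i) = t i := by
  exact (RingQuot.liftAlgHom_mkAlgHom_apply K _ _ _).trans (by simp)

theorem Form.lift_dt {B : Type*} [Ring B] [Algebra K B] (t dt : Fin (n + 1) → B) (h₁ h₂ h₃ h₄ h₅)
    (i : Fin (n + 1)) : Form.lift (K := K) t dt h₁ h₂ h₃ h₄ h₅ (dtVar i) = dt i := by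
  exact (RingQuot.liftAlgHom_mkAlgHom_apply K _ _ _).trans (by simp)

/-- Monomials in the `t_k` and `dt_k`, with their degree: the number of factors `dt_k`. -/
inductive IsMonomial : ℤ → Form K n → Prop
  | one : IsMonomial 0 1
  | t_mul (k : Fin (n + 1)) {i : ℤ} {a : Form K n} : IsMonomial i a → IsMonomial i (tVar k * a)
  | dt_mul (k : Fin (n + 1)) {i : ℤ} {a : Form K n} :
      IsMonomial i a → IsMonomial (i + 1) (dtVar k * a)

variable (K n)

/-- The forms of degree `i`. -/
def formGr (i : ℤ) : Submodule K (Form K n) := Submodule.span K {a | IsMonomial i a}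

variable {K n}

theorem formGr_ind {i : ℤ} {P : Form K n → Prop} (h0 : P 0) (hadd : ∀ x y, P x → P y → P (x + y))
    (hsmul : ∀ (c : K) x, P x → P (c • x)) (h : ∀ a, IsMonomial i a → P a) {a : Form K n}
    (ha : a ∈ formGr K n i) : P a :=
  Submodule.span_induction (p := fun a _ => P a) (fun a ha => h a ha) h0
    (fun x y _ _ => hadd x y) (fun c x _ => hsmul c x) ha

theorem tVar_mul_mem (k : Fin (n + 1)) {i : ℤ} {a : Form K n} (ha : a ∈ formGr K n i) :
    tVar k * a ∈ formGr K n i :=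
  formGr_ind (P := fun a => tVar k * a ∈ formGr K n i) (by simp)
    (fun x y hx hy => by rw [mul_add]; exact Submodule.add_mem _ hx hy)
    (fun c x hx => by rw [mul_smul_comm]; exact Submodule.smul_mem _ c hx)
    (fun a ha => Submodule.subset_span (ha.t_mul k)) ha

theorem dtVar_mul_mem (k : Fin (n + 1)) {i : ℤ} {a : Form K n} (ha : a ∈ formGr K n i) :
    dtVar k * a ∈ formGr K n (i + 1) :=
  formGr_ind (P := fun a => dtVar k * a ∈ formGr K n (i + 1)) (by simp)
    (fun x y hx hy => by rw [mul_add]; exact Submodule.add_mem _ hx hy)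
    (fun c x hx => by rw [mul_smul_comm]; exact Submodule.smul_mem _ c hx)
    (fun a ha => Submodule.subset_span (ha.dt_mul k)) ha

theorem iSup_formGr : ⨆ i, formGr K n i = ⊤ := by
  have key : ∀ x : Form K n, ∀ y ∈ ⨆ i, formGr K n i, x * y ∈ ⨆ i, formGr K n i := by
    intro x
    obtain ⟨x, rfl⟩ : ∃ y, Form.mk K n y = x := RingQuot.mkAlgHom_surjective K (FormRel K n) x
    induction x using FreeAlgebra.induction with
    | grade0 r =>
      intro y hy
      rw [AlgHom.commutes, ← Algebra.smul_def]
      exact Submodule.smul_mem _ r hy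
    | grade1 k =>
      intro y hy
      refine Submodule.iSup_induction _ (motive := fun y => _ * y ∈ ⨆ i, formGr K n i) hy ?_
        (by simp) (fun x y hx hy => by rw [mul_add]; exact Submodule.add_mem _ hx hy)
      intro i y hy
      rcases k with k | k
      · exact Submodule.mem_iSup_of_mem i (tVar_mul_mem k hy)
      · exact Submodule.mem_iSup_of_mem (i + 1) (dtVar_mul_mem k hy)
    | mul a b ha hb => intro y hy; rw [map_mul, mul_assoc]; exact ha _ (hb _ hy)
    | add a b ha hb =>
      intro y hy; rw [map_add, add_mul]; exact Submodule.add_mem _ (ha _ hy) (hb _ hy)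
  rw [eq_top_iff]
  rintro x -
  rw [← mul_one x]
  exact key x 1 (Submodule.mem_iSup_of_mem 0 (Submodule.subset_span IsMonomial.one))

/-- Induction over sums of multiples of monomials. -/
theorem form_ind {P : Form K n → Prop} (h0 : P 0) (hadd : ∀ x y, P x → P y → P (x + y))
    (hsmul : ∀ (c : K) x, P x → P (c • x)) (h : ∀ i a, IsMonomial i a → P a) (a : Form K n) :
    P a := by
  have ha : a ∈ ⨆ i, formGr K n i := by rw [iSup_formGr]; trivial
  exact Submodule.iSup_induction _ (motive := P) ha
    (fun i x hx => formGr_ind h0 hadd hsmul (h i) hx) h0 hadd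

variable (K n)

/-- The algebra homomorphism with `t_k ↦ t_k` and `dt_k ↦ T dt_k`, where the exponent of `T`
records the degree. -/
def formWeight : Form K n →ₐ[K] AddMonoidAlgebra (Form K n) ℤ :=
  Form.lift (fun k => AddMonoidAlgebra.single 0 (tVar k)) (fun k => AddMonoidAlgebra.single 1 (dtVar k))
    (fun i j => by
      simp only [AddMonoidAlgebra.single_mul_single]; rw [tVar_mul_tVar])
    (fun i j => by
      simp only [AddMonoidAlgebra.single_mul_single]; rw [tVar_mul_dtVar, add_comm])
    (fun i j => by
      simp only [AddMonoidAlgebra.single_mul_single]; rw [dtVar_mul_dtVar, AddMonoidAlgebra.single_neg])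
    (by
      rw [AddMonoidAlgebra.one_def, ← sum_tVar (K := K)]
      exact (map_sum (AddMonoidAlgebra.singleAddHom (0 : ℤ)) _ _).symm)
    (by
      rw [← AddMonoidAlgebra.single_zero (R := Form K n) (1 : ℤ), ← sum_dtVar (K := K)]
      exact (map_sum (AddMonoidAlgebra.singleAddHom (1 : ℤ)) _ _).symm)

/-- The algebra homomorphism `a ↦ !![(-1) ^ |a| a, d a; 0, a]`, determined by its values on the
`t_k` and `dt_k`; its multiplicativity is the graded Leibniz rule. -/
def formMatrix : Form K n →ₐ[K] Matrix (Fin 2) (Fin 2) (Form K n) :=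
  Form.lift (fun k => !![tVar k, dtVar k; 0, tVar k]) (fun k => !![-dtVar k, 0; 0, dtVar k])
    (fun i j => by
      simp [tVar_mul_tVar i j, tVar_mul_dtVar, add_comm])
    (fun i j => by
      simp [tVar_mul_dtVar i j, dtVar_mul_dtVar i j])
    (fun i j => by
      simp [dtVar_mul_dtVar i j])
    (by
      ext i j
      rw [Matrix.sum_apply]
      fin_cases i <;> fin_cases j <;> simp [sum_tVar, sum_dtVar])
    (by
      ext i j
      rw [Matrix.sum_apply]
      fin_cases i <;> fin_cases j <;> simp [sum_dtVar])

/-- The de Rham differential. -/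
def formD : Form K n →ₗ[K] Form K n where
  toFun a := formMatrix K n a 0 1
  map_add' a b := by simp
  map_smul' c a := by simp

variable {K n}

theorem formMatrix_lower (a : Form K n) :
    formMatrix K n a 1 0 = 0 ∧ formMatrix K n a 1 1 = a := by
  refine form_ind (P := fun a => formMatrix K n a 1 0 = 0 ∧ formMatrix K n a 1 1 = a) (by simp)
    (fun x y hx hy => by simp [hx, hy]) (fun c x hx => by simp [hx]) (fun i a ha => ?_) a
  induction ha with
  | one => simp
  | t_mul k _ ih => simp [formMatrix, Form.lift_t, Matrix.mul_apply] at ih ⊢; simp [ih]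
  | dt_mul k _ ih => simp [formMatrix, Form.lift_dt, Matrix.mul_apply] at ih ⊢; simp [ih]

theorem formMatrix_upper {i : ℤ} {a : Form K n} (ha : a ∈ formGr K n i) :
    formMatrix K n a 0 0 = (-1 : K) ^ i • a := by
  refine formGr_ind (P := fun a => formMatrix K n a 0 0 = (-1 : K) ^ i • a) (by simp)
    (fun x y hx hy => by simp [hx, hy]) (fun c x hx => by simp [hx, smul_comm c])
    ?_ ha
  clear ha
  intro a ha
  induction ha with
  | one => simp
  | @t_mul k i a ha ih =>
    have := (formMatrix_lower a).1
    simp only [map_mul, Matrix.mul_apply, Fin.sum_univ_two, this, ih]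
    simp [formMatrix, Form.lift_t]
  | @dt_mul k i a ha ih =>
    have := (formMatrix_lower a).1
    simp only [map_mul, Matrix.mul_apply, Fin.sum_univ_two, this, ih, neg_one_zpow_add]
    simp [formMatrix, Form.lift_dt]

theorem formD_mul {i : ℤ} {a : Form K n} (ha : a ∈ formGr K n i) (b : Form K n) :
    formD K n (a * b) = formD K n a * b + (-1 : K) ^ i • (a * formD K n b) := by
  simp only [formD, LinearMap.coe_mk, AddHom.coe_mk, map_mul, Matrix.mul_apply, Fin.sum_univ_two,
    formMatrix_upper ha, (formMatrix_lower b).2]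
  rw [smul_mul_assoc, add_comm]

theorem tVar_mem (k : Fin (n + 1)) : (tVar k : Form K n) ∈ formGr K n 0 :=
  Submodule.subset_span (by simpa using IsMonomial.one.t_mul (K := K) k)

theorem dtVar_mem (k : Fin (n + 1)) : (dtVar k : Form K n) ∈ formGr K n 1 :=
  Submodule.subset_span (by simpa using IsMonomial.one.dt_mul (K := K) k)

theorem formD_tVar (k : Fin (n + 1)) : formD K n (tVar k) = dtVar k := by
  simp [formD, formMatrix, Form.lift_t]

theorem formD_dtVar (k : Fin (n + 1)) : formD K n (dtVar k) = 0 := by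
  simp [formD, formMatrix, Form.lift_dt]

theorem formD_tVar_mul (k : Fin (n + 1)) (a : Form K n) :
    formD K n (tVar k * a) = dtVar k * a + tVar k * formD K n a := by
  rw [formD_mul (tVar_mem k), formD_tVar, zpow_zero, one_smul]

theorem formD_dtVar_mul (k : Fin (n + 1)) (a : Form K n) :
    formD K n (dtVar k * a) = -(dtVar k * formD K n a) := by
  rw [formD_mul (dtVar_mem k), formD_dtVar, zpow_one, zero_mul, zero_add, neg_smul, one_smul]

theorem formD_one : formD K n 1 = 0 := by simp [formD]

theorem formD_mem {i : ℤ} {a : Form K n} (ha : a ∈ formGr K n i) :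
    formD K n a ∈ formGr K n (i + 1) := by
  refine formGr_ind (P := fun a => formD K n a ∈ formGr K n (i + 1)) (by simp)
    (fun x y hx hy => by rw [map_add]; exact Submodule.add_mem _ hx hy)
    (fun c x hx => by rw [map_smul]; exact Submodule.smul_mem _ c hx) ?_ ha
  clear ha
  intro a ha
  induction ha with
  | one => rw [formD_one]; exact Submodule.zero_mem _
  | t_mul k ha ih =>
    rw [formD_tVar_mul]
    exact Submodule.add_mem _ (dtVar_mul_mem k (Submodule.subset_span ha)) (tVar_mul_mem k ih)
  | dt_mul k ha ih =>
    rw [formD_dtVar_mul]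
    exact Submodule.neg_mem _ (dtVar_mul_mem k ih)

theorem formD_formD (a : Form K n) : formD K n (formD K n a) = 0 := by
  refine form_ind (P := fun a => formD K n (formD K n a) = 0) (by simp)
    (fun x y hx hy => by simp [hx, hy]) (fun c x hx => by simp [hx]) (fun i a ha => ?_) a
  induction ha with
  | one => rw [formD_one, map_zero]
  | t_mul k ha ih =>
    rw [formD_tVar_mul, map_add, formD_dtVar_mul, formD_tVar_mul, ih]
    simp
  | dt_mul k ha ih =>
    rw [formD_dtVar_mul, map_neg, formD_dtVar_mul, ih]
    simp

theorem IsMonomial.mul {i j : ℤ} {a b : Form K n} (ha : IsMonomial i a) (hb : IsMonomial j b) :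
    IsMonomial (i + j) (a * b) := by
  induction ha with
  | one => simpa using hb
  | t_mul k _ ih => rw [mul_assoc]; exact ih.t_mul k
  | dt_mul k _ ih =>
    rw [mul_assoc, add_right_comm]
    exact ih.dt_mul k

theorem tVar_comm (k : Fin (n + 1)) {j : ℤ} {b : Form K n} (hb : IsMonomial j b) :
    tVar k * b = b * tVar k := by
  induction hb with
  | one => simp
  | t_mul l _ ih => rw [← mul_assoc, tVar_mul_tVar, mul_assoc, ih, mul_assoc]
  | dt_mul l _ ih => rw [← mul_assoc, tVar_mul_dtVar, mul_assoc, ih, mul_assoc]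

theorem dtVar_comm (k : Fin (n + 1)) {j : ℤ} {b : Form K n} (hb : IsMonomial j b) :
    dtVar k * b = (-1 : K) ^ j • (b * dtVar k) := by
  induction hb with
  | one => simp
  | t_mul l _ ih => rw [← mul_assoc, ← tVar_mul_dtVar, mul_assoc, ih, mul_assoc, mul_smul_comm]
  | dt_mul l _ ih =>
    rw [← mul_assoc, dtVar_mul_dtVar, neg_mul, mul_assoc, ih, mul_assoc, mul_smul_comm,
      neg_one_zpow_add, zpow_one, mul_neg_one, neg_smul]

theorem IsMonomial.comm {i j : ℤ} {a b : Form K n} (ha : IsMonomial i a) (hb : IsMonomial j b) :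
    a * b = (-1 : K) ^ (i * j) • (b * a) := by
  induction ha with
  | one => simp
  | t_mul k _ ih =>
    rw [mul_assoc, ih, mul_smul_comm, ← mul_assoc, tVar_comm k hb, mul_assoc]
  | dt_mul k _ ih =>
    rw [mul_assoc, ih, mul_smul_comm, ← mul_assoc, dtVar_comm k hb, smul_mul_assoc, smul_smul,
      ← neg_one_zpow_add, add_one_mul, mul_assoc]

theorem IsMonomial.weight {i : ℤ} {a : Form K n} (ha : IsMonomial i a) :
    formWeight K n a = AddMonoidAlgebra.single i a := by
  induction ha with
  | one => rw [map_one, AddMonoidAlgebra.one_def]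
  | t_mul k _ ih =>
    rw [map_mul, ih, formWeight, Form.lift_t, AddMonoidAlgebra.single_mul_single, zero_add]
  | dt_mul k _ ih =>
    rw [map_mul, ih, formWeight, Form.lift_dt, AddMonoidAlgebra.single_mul_single, add_comm]

theorem formGr_isInternal : DirectSum.IsInternal (formGr K n) := by
  refine isInternal_of_weight (ι := Unit) (formGr K n) (fun _ => LinearMap.id) (fun x h => h ())
    (fun _ => (AddMonoidAlgebra.coeffLinearEquiv (S := Form K n) (M := ℤ) K).toLinearMap ∘ₗ
      (formWeight K n).toLinearMap) (fun _ i x hx => ?_) iSup_formGr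
  refine formGr_ind (P := fun x => (AddMonoidAlgebra.coeffLinearEquiv K) (formWeight K n x) =
    Finsupp.single i x) (by simp)
    (fun x y hx hy => by rw [map_add, map_add, hx, hy, Finsupp.single_add])
    (fun c x hx => by rw [map_smul, map_smul, hx, Finsupp.smul_single]) (fun a ha => ?_) hx
  rw [ha.weight]
  rfl

variable (K n)

/-- The differential graded commutative algebra `Ω_n` of polynomial differential forms on the
standard `n`-simplex. -/
def forms : CDGA.{u, u} K where
  carrier := Form K n
  gr := formGr K n
  isInternal := formGr_isInternal
  d := formD K n
  one_mem := Submodule.subset_span IsMonomial.one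
  mul_mem i j a ha b hb := by
    refine formGr_ind (P := fun a => a * b ∈ formGr K n (i + j)) (by simp)
      (fun x y hx hy => by rw [add_mul]; exact Submodule.add_mem _ hx hy)
      (fun c x hx => by rw [smul_mul_assoc]; exact Submodule.smul_mem _ c hx) (fun a ha => ?_) ha
    exact formGr_ind (P := fun b => a * b ∈ formGr K n (i + j)) (by simp)
      (fun x y hx hy => by rw [mul_add]; exact Submodule.add_mem _ hx hy)
      (fun c x hx => by rw [mul_smul_comm]; exact Submodule.smul_mem _ c hx)
      (fun b hb => Submodule.subset_span (ha.mul hb)) hb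
  d_mem i a ha := formD_mem ha
  d_d := formD_formD
  comm i j a ha b hb := by
    refine formGr_ind (P := fun a => a * b = (-1 : K) ^ (i * j) • (b * a)) (by simp)
      (fun x y hx hy => by rw [add_mul, mul_add, hx, hy, smul_add])
      (fun c x hx => by rw [smul_mul_assoc, hx, mul_smul_comm, smul_comm]) (fun a ha => ?_) ha
    exact formGr_ind (P := fun b => a * b = (-1 : K) ^ (i * j) • (b * a)) (by simp)
      (fun x y hx hy => by rw [add_mul, mul_add, hx, hy, smul_add])
      (fun c x hx => by rw [smul_mul_assoc, mul_smul_comm, hx, smul_comm])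
      (fun b hb => ha.comm hb) hb
  leibniz i a ha b := formD_mul ha b

/-- The face map `δ^{k,n+1} : Ω_{n+1} → Ω_n` on algebras: the restriction of forms to the face
`t_k = 0`, whose vertices are renumbered in increasing order. -/
def faceAlg (k : Fin (n + 2)) : Form K (n + 1) →ₐ[K] Form K n :=
  Form.lift (k.insertNth 0 tVar) (k.insertNth 0 dtVar)
    (fun i j => by
      induction i using k.succAboveCases <;> induction j using k.succAboveCases <;>
        simp [tVar_mul_tVar])
    (fun i j => by
      induction i using k.succAboveCases <;> induction j using k.succAboveCases <;>
        simp [tVar_mul_dtVar])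
    (fun i j => by
      induction i using k.succAboveCases with
      | x => simp
      | p i =>
        induction j using k.succAboveCases with
        | x => simp
        | p j => simpa using dtVar_mul_dtVar i j)
    (by rw [Fin.sum_univ_succAbove _ k]; simp [sum_tVar])
    (by rw [Fin.sum_univ_succAbove _ k]; simp [sum_dtVar])

/-- The face map `δ^{k,n+1} : Ω_{n+1} → Ω_n`. -/
def face (k : Fin (n + 2)) : (forms K (n + 1)).Hom (forms K n) where
  toAlg := faceAlg K n k
  map_mem i a ha := by
    refine formGr_ind (P := fun a => faceAlg K n k a ∈ formGr K n i) (by simp)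
      (fun x y hx hy => by rw [map_add]; exact Submodule.add_mem _ hx hy)
      (fun c x hx => by rw [map_smul]; exact Submodule.smul_mem _ c hx) ?_ ha
    clear ha
    intro a ha
    induction ha with
    | one => rw [map_one]; exact Submodule.subset_span IsMonomial.one
    | t_mul l _ ih =>
      rw [map_mul, faceAlg, Form.lift_t]
      induction l using k.succAboveCases with
      | x => simp
      | p l => rw [Fin.insertNth_apply_succAbove]; exact tVar_mul_mem l ih
    | dt_mul l _ ih =>
      rw [map_mul, faceAlg, Form.lift_dt]
      induction l using k.succAboveCases with
      | x => simp
      | p l => rw [Fin.insertNth_apply_succAbove]; exact dtVar_mul_mem l ih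
  map_d a := by
    refine form_ind (P := fun a => faceAlg K n k (formD K (n + 1) a) = formD K n (faceAlg K n k a))
      (by simp) (fun x y hx hy => by simp [hx, hy]) (fun c x hx => by simp [hx])
      (fun i a ha => ?_) a
    induction ha with
    | one => rw [formD_one, map_one, formD_one, map_zero]
    | t_mul l _ ih =>
      rw [formD_tVar_mul, map_add, map_mul, map_mul, map_mul, ih]
      induction l using k.succAboveCases with
      | x => simp [faceAlg, Form.lift_t, Form.lift_dt]
      | p l => simp [faceAlg, Form.lift_t, Form.lift_dt, formD_tVar_mul]
    | dt_mul l _ ih =>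
      rw [formD_dtVar_mul, map_neg, map_mul, map_mul, ih]
      induction l using k.succAboveCases with
      | x => simp [faceAlg, Form.lift_dt]
      | p l => simp [faceAlg, Form.lift_dt, formD_dtVar_mul]

end Forms

section Semicosimplicial

variable {K : Type u} [Field K]

/-- The identity morphism. -/
def DGLA.Hom.id (L : DGLA.{u, v} K) : L.Hom L where
  toLin := LinearMap.id
  map_mem _ _ hx := hx
  map_d _ := rfl
  map_bracket _ _ := rfl

/-- The identity morphism. -/
def CDGA.Hom.id (Ω : CDGA.{u, v} K) : Ω.Hom Ω where
  toAlg := AlgHom.id K Ω.carrier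
  map_mem _ _ hx := hx
  map_d _ := rfl

variable (K) in
/-- The zero differential graded Lie algebra. -/
def DGLA.zero : DGLA.{u, v} K where
  carrier := PUnit.{v + 1}
  gr _ := ⊥
  isInternal := isInternal_of_weight (ι := Unit) _ (fun _ => LinearMap.id) (fun _ h => h ())
    (fun _ => 0) (fun _ _ _ _ => Finsupp.ext fun _ => rfl) (Subsingleton.elim _ _)
  d := 0
  bracket := 0
  d_mem _ _ _ := Submodule.zero_mem _
  bracket_mem _ _ _ _ _ _ := Submodule.zero_mem _
  d_d _ := rfl
  skew _ _ _ _ _ _ := rfl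
  jacobi _ _ _ _ _ _ _ := rfl
  leibniz _ _ _ _ := rfl

/-- The zero morphism. -/
def DGLA.Hom.zero (L : DGLA.{u, v} K) (M : DGLA.{u, w} K) : L.Hom M where
  toLin := 0
  map_mem _ _ _ := Submodule.zero_mem _
  map_d _ := by simp
  map_bracket _ _ := by simp

variable (K) in
/-- A semicosimplicial differential graded Lie algebra. The morphism written `∂_{k,n+1}`, from
level `n` to level `n + 1`, is `coface n k`. -/
structure SemicosimplicialDGLA where
  /-- the differential graded Lie algebra at level `n` -/
  obj : ℕ → DGLA.{u, v} K
  /-- the morphisms `∂_{k,n+1}` for `k = 0, …, n + 1` -/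
  coface : ∀ n, Fin (n + 2) → (obj n).Hom (obj (n + 1))
  coface_coface : ∀ n (k l : Fin (n + 2)), l ≤ k → ∀ x,
    (coface (n + 1) k.succ).toLin ((coface n l).toLin x) =
      (coface (n + 1) l.castSucc).toLin ((coface n k).toLin x)

/-- The levels of the truncation between levels `0` and `1`. -/
def truncObj (g : SemicosimplicialDGLA.{u, v} K) : ℕ → DGLA.{u, v} K
  | 0 => g.obj 0
  | 1 => g.obj 1
  | _ + 2 => DGLA.zero K

/-- The morphisms of the truncation between levels `0` and `1`. -/
def truncCoface (g : SemicosimplicialDGLA.{u, v} K) :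
    ∀ n, Fin (n + 2) → (truncObj g n).Hom (truncObj g (n + 1))
  | 0 => g.coface 0
  | n + 1 => fun _ => DGLA.Hom.zero (truncObj g (n + 1)) (truncObj g (n + 2))

/-- The truncation of a semicosimplicial differential graded Lie algebra between levels `0` and
`1`: the levels `n ≥ 2` are replaced by zero. -/
def SemicosimplicialDGLA.trunc (g : SemicosimplicialDGLA.{u, v} K) :
    SemicosimplicialDGLA.{u, v} K where
  obj := truncObj g
  coface := truncCoface g
  coface_coface _ _ _ _ _ := rfl

variable (g : SemicosimplicialDGLA.{u, v} K)

/-- `δ^{k,n+1} ⊗ id : Ω_{n+1} ⊗ g_{n+1} → Ω_n ⊗ g_{n+1}`. -/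
def faceMap (n : ℕ) (k : Fin (n + 2)) : (tensor (forms K (n + 1)) (g.obj (n + 1))).Hom
    (tensor (forms K n) (g.obj (n + 1))) :=
  tensorMap (face K n k) (DGLA.Hom.id _)

/-- `id ⊗ ∂_{k,n+1} : Ω_n ⊗ g_n → Ω_n ⊗ g_{n+1}`. -/
def cofaceMap (n : ℕ) (k : Fin (n + 2)) : (tensor (forms K n) (g.obj n)).Hom
    (tensor (forms K n) (g.obj (n + 1))) :=
  tensorMap (CDGA.Hom.id _) (g.coface n k)

/-- Sequences `(x_n)` with `x_n ∈ Ω_n ⊗ g_n`. -/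
abbrev TotAmbient : Type (max u v) := ∀ n : ℕ, (tensor (forms K n) (g.obj n)).carrier

/-- The component of degree `k` of the Thom-Whitney complex: sequences `(x_n)` with
`x_n ∈ (Ω_n ⊗ g_n)^k` and `δ^{l,n+1} x_{n+1} = ∂_{l,n+1} x_n` for all `l` and `n`. -/
def totGr (k : ℤ) : Submodule K (TotAmbient g) where
  carrier := {x | (∀ n, x n ∈ (tensor (forms K n) (g.obj n)).gr k) ∧
    ∀ n l, (faceMap g n l).toLin (x (n + 1)) = (cofaceMap g n l).toLin (x n)}
  add_mem' {x y} hx hy := ⟨fun n => Submodule.add_mem _ (hx.1 n) (hy.1 n),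
    fun n l => by rw [Pi.add_apply, Pi.add_apply, map_add, map_add, hx.2, hy.2]⟩
  zero_mem' := ⟨fun n => Submodule.zero_mem _, fun n l => by simp⟩
  smul_mem' c x hx := ⟨fun n => Submodule.smul_mem _ c (hx.1 n),
    fun n l => by rw [Pi.smul_apply, Pi.smul_apply, map_smul, map_smul, hx.2]⟩

/-- The underlying vector space of the Thom-Whitney complex: the sum of all its degrees. -/
def totCarrier : Submodule K (TotAmbient g) := ⨆ k, totGr g k

/-- The componentwise differential. -/
def totD : TotAmbient g →ₗ[K] TotAmbient g :=
  LinearMap.pi fun n => (tensor (forms K n) (g.obj n)).d ∘ₗ LinearMap.proj n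

/-- The componentwise bracket. -/
def totBracket : TotAmbient g →ₗ[K] TotAmbient g →ₗ[K] TotAmbient g :=
  LinearMap.mk₂ K (fun x y n => (tensor (forms K n) (g.obj n)).bracket (x n) (y n))
    (fun x y z => by ext n; simp) (fun c x y => by ext n; simp)
    (fun x y z => by ext n; simp) (fun c x y => by ext n; simp)

variable {g}

theorem totD_mem_gr {k : ℤ} {x : TotAmbient g} (hx : x ∈ totGr g k) :
    totD g x ∈ totGr g (k + 1) :=
  ⟨fun n => (tensor (forms K n) (g.obj n)).d_mem k _ (hx.1 n), fun n l => by
    change (faceMap g n l).toLin ((tensor _ _).d (x (n + 1))) =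
      (cofaceMap g n l).toLin ((tensor _ _).d (x n))
    rw [(faceMap g n l).map_d, (cofaceMap g n l).map_d, hx.2]⟩

theorem totBracket_mem_gr {k m : ℤ} {x y : TotAmbient g} (hx : x ∈ totGr g k)
    (hy : y ∈ totGr g m) : totBracket g x y ∈ totGr g (k + m) :=
  ⟨fun n => (tensor (forms K n) (g.obj n)).bracket_mem k m _ (hx.1 n) _ (hy.1 n), fun n l => by
    change (faceMap g n l).toLin ((tensor _ _).bracket (x (n + 1)) (y (n + 1))) =
      (cofaceMap g n l).toLin ((tensor _ _).bracket (x n) (y n))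
    rw [(faceMap g n l).map_bracket, (cofaceMap g n l).map_bracket, hx.2, hy.2]⟩

theorem totD_mem {x : TotAmbient g} (hx : x ∈ totCarrier g) : totD g x ∈ totCarrier g :=
  Submodule.iSup_induction _ (motive := fun x => totD g x ∈ totCarrier g) hx
    (fun k _ hx => Submodule.mem_iSup_of_mem (k + 1) (totD_mem_gr hx)) (by simp)
    (fun x y hx hy => by rw [map_add]; exact Submodule.add_mem _ hx hy)

theorem totBracket_mem {x y : TotAmbient g} (hx : x ∈ totCarrier g) (hy : y ∈ totCarrier g) :
    totBracket g x y ∈ totCarrier g :=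
  Submodule.iSup_induction _ (motive := fun x => totBracket g x y ∈ totCarrier g) hx
    (fun k x hx => Submodule.iSup_induction _
      (motive := fun y => totBracket g x y ∈ totCarrier g) hy
      (fun m _ hy => Submodule.mem_iSup_of_mem (k + m) (totBracket_mem_gr hx hy)) (by simp)
      (fun y z hy hz => by rw [map_add]; exact Submodule.add_mem _ hy hz))
    (by simp) (fun x y hx hy => by
      rw [map_add, LinearMap.add_apply]; exact Submodule.add_mem _ hx hy)

variable (g)

/-- The Thom-Whitney differential graded Lie algebra `Tot_TW(g)`. -/
def totTW : DGLA.{u, max u v} K where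
  carrier := totCarrier g
  gr k := (totGr g k).comap (totCarrier g).subtype
  isInternal := by
    refine isInternal_of_weight _
      (fun n => (LinearMap.proj n : TotAmbient g →ₗ[K] _) ∘ₗ (totCarrier g).subtype)
      (fun x h => Subtype.ext (funext h))
      (fun n => weight _ (tensor (forms K n) (g.obj n)).isInternal)
      (fun n i x hx => weight_of_mem (tensor (forms K n) (g.obj n)).isInternal (hx.1 n)) ?_
    rw [eq_top_iff]
    rintro ⟨x, hx⟩ -
    refine Submodule.iSup_induction' _ (motive := fun x hx => (⟨x, hx⟩ : totCarrier g) ∈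
      ⨆ k, (totGr g k).comap (totCarrier g).subtype) (fun k x hx => ?_) ?_
      (fun x y _ _ hx hy => Submodule.add_mem _ hx hy) hx
    · exact Submodule.mem_iSup_of_mem k hx
    · exact Submodule.zero_mem _
  d := (totD g).restrict fun _ hx => totD_mem hx
  bracket := LinearMap.mk₂ K (fun x y => ⟨totBracket g x y, totBracket_mem x.2 y.2⟩)
    (fun x y z => Subtype.ext (by simp)) (fun c x y => Subtype.ext (by simp))
    (fun x y z => Subtype.ext (by simp)) (fun c x y => Subtype.ext (by simp))
  d_mem _ _ hx := totD_mem_gr hx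
  bracket_mem _ _ _ hx _ hy := totBracket_mem_gr hx hy
  d_d x := Subtype.ext (funext fun n => (tensor (forms K n) (g.obj n)).d_d _)
  skew i j x hx y hy := Subtype.ext (funext fun n =>
    (tensor (forms K n) (g.obj n)).skew i j _ (hx.1 n) _ (hy.1 n))
  jacobi i j x hx y hy z := Subtype.ext (funext fun n =>
    (tensor (forms K n) (g.obj n)).jacobi i j _ (hx.1 n) _ (hy.1 n) _)
  leibniz i x hx y := Subtype.ext (funext fun n =>
    (tensor (forms K n) (g.obj n)).leibniz i _ (hx.1 n) _)

/-- The projection of the Thom-Whitney algebra to `Ω_n ⊗ g_n`. -/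
def totProj (n : ℕ) : (totTW g).Hom (tensor (forms K n) (g.obj n)) where
  toLin := (LinearMap.proj n : TotAmbient g →ₗ[K] _) ∘ₗ (totCarrier g).subtype
  map_mem _ _ hx := hx.1 n
  map_d _ := rfl
  map_bracket _ _ := rfl

end Semicosimplicial

section Artin

/-- A local Artinian `K`-algebra with residue field `K`. -/
structure ArtAlg (K : Type u) [Field K] where
  /-- the underlying ring -/
  carrier : Type u
  [commRing : CommRing carrier]
  [algebra : Algebra K carrier]
  [isLocalRing : IsLocalRing carrier]
  [isArtinianRing : IsArtinianRing carrier]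
  residue : Function.Bijective (algebraMap K (IsLocalRing.ResidueField carrier))

attribute [instance] ArtAlg.commRing ArtAlg.algebra ArtAlg.isLocalRing ArtAlg.isArtinianRing

variable {K : Type u} [Field K]

/-- The category of local Artinian `K`-algebras with residue field `K`; all homomorphisms of
`K`-algebras between them are local. -/
instance : Category (ArtAlg K) where
  Hom A B := A.carrier →ₐ[K] B.carrier
  id A := AlgHom.id K A.carrier
  comp f g := AlgHom.comp g f

/-- A morphism as a homomorphism of algebras. -/
def ArtAlg.hom {A B : ArtAlg K} (f : A ⟶ B) : A.carrier →ₐ[K] B.carrier := f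

/-- The maximal ideal `𝔪_A`, as a vector space over `K`. -/
def ArtAlg.max (A : ArtAlg K) : Submodule K A.carrier :=
  (IsLocalRing.maximalIdeal A.carrier).restrictScalars K

theorem ArtAlg.max_nilpotent (A : ArtAlg K) :
    ∃ e, IsLocalRing.maximalIdeal A.carrier ^ e = ⊥ := by
  have := IsArtinianRing.isNilpotent_jacobson_bot (R := A.carrier)
  rwa [IsLocalRing.jacobson_eq_maximalIdeal ⊥ bot_ne_top] at this

theorem ArtAlg.hom_mem {A B : ArtAlg K} (f : A ⟶ B) {a : A.carrier} (ha : a ∈ A.max) :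
    ArtAlg.hom f a ∈ B.max := by
  obtain ⟨e, he⟩ := A.max_nilpotent
  have hnil : IsNilpotent a := ⟨e, by
    have := Ideal.pow_mem_pow (show a ∈ IsLocalRing.maximalIdeal A.carrier from ha) e
    rwa [he] at this⟩
  change _ ∈ IsLocalRing.maximalIdeal B.carrier
  rw [IsLocalRing.mem_maximalIdeal, mem_nonunits_iff]
  exact (hnil.map (ArtAlg.hom f)).not_isUnit

/-- The map `𝔪_A → 𝔪_B` induced by a morphism. -/
def ArtAlg.maxMap {A B : ArtAlg K} (f : A ⟶ B) : A.max →ₗ[K] B.max :=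
  (ArtAlg.hom f).toLinearMap.restrict fun _ ha => ArtAlg.hom_mem f ha

/-- The multiplication of `𝔪_A`. -/
def ArtAlg.maxMul (A : ArtAlg K) : A.max →ₗ[K] A.max →ₗ[K] A.max :=
  LinearMap.mk₂ K
    (fun a b => ⟨a * b, (IsLocalRing.maximalIdeal A.carrier).mul_mem_left a b.2⟩)
    (fun x y z => Subtype.ext (by simp [add_mul])) (fun c x y => Subtype.ext (by simp))
    (fun x y z => Subtype.ext (by simp [mul_add])) (fun c x y => Subtype.ext (by simp))

end Artin

section Nilpotent

theorem length_flatMap_replicate {X : Type*} (a b : X) (l : List (ℕ × ℕ)) :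
    (l.flatMap fun p => List.replicate p.1 a ++ List.replicate p.2 b).length =
      (l.map fun p => p.1 + p.2).sum := by
  simp [List.length_flatMap]

variable {K : Type u} [Field K] {V : Type v} [AddCommGroup V] [Module K V]

/-- The right-nested bracket `[x_1, [x_2, …, [x_{k-1}, x_k] … ]]` of a word. -/
def nested (br : V →ₗ[K] V →ₗ[K] V) : List V → V
  | [] => 0
  | [x] => x
  | x :: y :: l => br x (nested br (y :: l))

/-- The term of Dynkin's formula with index `(r_1, s_1), …, (r_n, s_n)`, where `r_i + s_i > 0`:
`(-1) ^ (n - 1) / n * 1 / (∑ (r_i + s_i)) * ∏ 1 / (r_i! s_i!)` times the right-nested bracket of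
`a` (`r_1` times), `b` (`s_1` times), …, `a` (`r_n` times), `b` (`s_n` times). -/
def dynkinTerm (br : V →ₗ[K] V →ₗ[K] V) (a b : V) (l : List (ℕ × ℕ)) : V :=
  if l ≠ [] ∧ ∀ p ∈ l, p ≠ (0, 0) then
    ((-1 : K) ^ (l.length + 1) / (l.length : K) *
      (((l.map fun p => p.1 + p.2).sum : ℕ) : K)⁻¹ *
      (l.map fun p => ((p.1.factorial * p.2.factorial : ℕ) : K)⁻¹).prod) •
        nested br (l.flatMap fun p => List.replicate p.1 a ++ List.replicate p.2 b)
  else 0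

/-- The Baker-Campbell-Hausdorff product `a • b = log (e^a e^b)`, by Dynkin's formula. The sum is
finite if the bracket is nilpotent. -/
def bch (br : V →ₗ[K] V →ₗ[K] V) (a b : V) : V := ∑ᶠ l : List (ℕ × ℕ), dynkinTerm br a b l

/-- The gauge action `e^a * x = x + ∑_{n ≥ 0} (ad a)^n / (n + 1)! ([a, x] - d a)`. The sum is
finite if the bracket is nilpotent. -/
def gauge (d : V →ₗ[K] V) (br : V →ₗ[K] V →ₗ[K] V) (a x : V) : V :=
  x + ∑ᶠ n : ℕ, (((n + 1).factorial : ℕ) : K)⁻¹ • ((br a)^[n]) (br a x - d a)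

/-- A filtration which makes a bracket nilpotent. -/
structure NilFiltration (br : V →ₗ[K] V →ₗ[K] V) (F : ℕ → Submodule K V) : Prop where
  one : ∀ x, x ∈ F 1
  bracket : ∀ i j, ∀ x ∈ F i, ∀ y ∈ F j, br x y ∈ F (i + j)
  bot : ∃ e, ∀ i, e ≤ i → F i = ⊥

variable {br : V →ₗ[K] V →ₗ[K] V} {F : ℕ → Submodule K V}

theorem NilFiltration.nested_mem (h : NilFiltration br F) :
    ∀ l : List V, l ≠ [] → nested br l ∈ F l.length
  | [], hl => absurd rfl hl
  | [x], _ => h.one x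
  | x :: y :: l, _ => by
    have := h.bracket 1 _ x (h.one x) _ (h.nested_mem (y :: l) (by simp))
    rw [add_comm] at this
    exact this

theorem NilFiltration.iterate_mem (h : NilFiltration br F) (a x : V) (n : ℕ) :
    ((br a)^[n]) x ∈ F (n + 1) := by
  induction n with
  | zero => exact h.one x
  | succ n ih =>
    rw [Function.iterate_succ_apply', add_comm]
    exact h.bracket 1 _ a (h.one a) _ ih

theorem NilFiltration.finite_gauge (h : NilFiltration br F) (a x : V) :
    (Function.support fun n : ℕ =>
      (((n + 1).factorial : ℕ) : K)⁻¹ • ((br a)^[n]) x).Finite := by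
  obtain ⟨e, he⟩ := h.bot
  refine (Set.finite_lt_nat e).subset fun n hn => ?_
  by_contra hlt
  have hlt : e ≤ n := by simpa using hlt
  refine hn ?_
  have := h.iterate_mem a x n
  rw [he _ (by omega), Submodule.mem_bot] at this
  simp [this]

theorem NilFiltration.finite_dynkin (h : NilFiltration br F) (a b : V) :
    (Function.support (dynkinTerm br a b)).Finite := by
  obtain ⟨e, he⟩ := h.bot
  have hfin : Set.Finite ((fun l : List (Fin e × Fin e) => l.map fun p => (p.1.val, p.2.val)) ''
      {l | l.length ≤ e}) := (List.finite_length_le (Fin e × Fin e) e).image _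
  refine hfin.subset fun l hl => ?_
  have hl' : l ≠ [] ∧ ∀ p ∈ l, p ≠ (0, 0) := by
    by_contra hc
    exact hl (if_neg hc)
  have hsum : (l.map fun p => p.1 + p.2).sum < e := by
    by_contra hc
    refine hl ?_
    have hpos : 0 < (l.map fun p => p.1 + p.2).sum := by
      obtain ⟨p, hp⟩ := List.exists_mem_of_ne_nil l hl'.1
      have h1 := List.single_le_sum (l := l.map fun p => p.1 + p.2) (by simp) _
        (List.mem_map_of_mem hp)
      have h2 := hl'.2 p hp
      rcases p with ⟨r, s⟩
      simp only [ne_eq, Prod.mk.injEq] at h1 h2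
      omega
    have hne : (l.flatMap fun p => List.replicate p.1 a ++ List.replicate p.2 b) ≠ [] := by
      rw [← List.length_pos_iff, length_flatMap_replicate]
      exact hpos
    have := h.nested_mem _ hne
    rw [length_flatMap_replicate, he _ (by omega), Submodule.mem_bot] at this
    rw [dynkinTerm, this, smul_zero, ite_self]
  have hb : ∀ p ∈ l, p.1 < e ∧ p.2 < e := fun p hp => by
    have h1 := List.single_le_sum (l := l.map fun p => p.1 + p.2) (by simp) _
      (List.mem_map_of_mem hp)
    omega
  have hlen : l.length ≤ (l.map fun p => p.1 + p.2).sum := by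
    have : ∀ l : List (ℕ × ℕ), (∀ p ∈ l, p ≠ (0, 0)) →
        l.length ≤ (l.map fun p => p.1 + p.2).sum := by
      intro l
      induction l with
      | nil => simp
      | cons p l ih =>
        intro hp
        have h1 := ih fun q hq => hp q (List.mem_cons_of_mem _ hq)
        have h2 := hp p List.mem_cons_self
        rcases p with ⟨r, s⟩
        simp only [ne_eq, Prod.mk.injEq] at h2
        simp only [List.length_cons, List.map_cons, List.sum_cons]
        omega
    exact this l hl'.2
  refine ⟨l.pmap (fun p hp => (⟨p.1, (hp : p.1 < e ∧ p.2 < e).1⟩, ⟨p.2, hp.2⟩)) hb, ?_, ?_⟩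
  · rw [Set.mem_ofPred_eq, List.length_pmap]; omega
  · simp [List.map_pmap]

variable {W : Type w} [AddCommGroup W] [Module K W] {br' : W →ₗ[K] W →ₗ[K] W}

theorem map_nested (f : V →ₗ[K] W) (hf : ∀ x y, f (br x y) = br' (f x) (f y)) :
    ∀ l : List V, f (nested br l) = nested br' (l.map f)
  | [] => map_zero f
  | [x] => rfl
  | x :: y :: l => by
    rw [nested, hf, map_nested f hf (y :: l)]
    rfl

theorem NilFiltration.map_bch (h : NilFiltration br F) (f : V →ₗ[K] W)
    (hf : ∀ x y, f (br x y) = br' (f x) (f y)) (a b : V) :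
    f (bch br a b) = bch br' (f a) (f b) := by
  rw [bch, bch, ← LinearMap.toAddMonoidHom_coe, AddMonoidHom.map_finsum _ (h.finite_dynkin a b)]
  refine finsum_congr fun l => ?_
  rw [dynkinTerm, dynkinTerm, LinearMap.toAddMonoidHom_coe]
  split_ifs
  · rw [map_smul, map_nested f hf, List.map_flatMap]
    simp
  · exact map_zero f

theorem NilFiltration.map_gauge (h : NilFiltration br F) (f : V →ₗ[K] W)
    (hf : ∀ x y, f (br x y) = br' (f x) (f y)) {d : V →ₗ[K] V} {d' : W →ₗ[K] W}
    (hd : ∀ x, f (d x) = d' (f x)) (a x : V) :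
    f (gauge d br a x) = gauge d' br' (f a) (f x) := by
  rw [gauge, gauge, map_add, ← LinearMap.toAddMonoidHom_coe,
    AddMonoidHom.map_finsum _ (h.finite_gauge a _)]
  refine congrArg₂ (· + ·) rfl (finsum_congr fun n => ?_)
  rw [LinearMap.toAddMonoidHom_coe, map_smul]
  congr 1
  induction n with
  | zero => simp [hf, hd]
  | succ n ih => rw [Function.iterate_succ_apply', Function.iterate_succ_apply', hf, ih]

end Nilpotent

section Functors

variable {K : Type u} [Field K]

/-- The vector space `L ⊗ 𝔪_A`. -/
abbrev DGLA.ext (L : DGLA.{u, v} K) (A : ArtAlg K) : Type (max u v) := L.carrier ⊗[K] A.max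

/-- The differential of `L ⊗ 𝔪_A`. -/
def DGLA.extD (L : DGLA.{u, v} K) (A : ArtAlg K) : L.ext A →ₗ[K] L.ext A := L.d.rTensor A.max

/-- The bracket of `L ⊗ 𝔪_A`. -/
def DGLA.extBr (L : DGLA.{u, v} K) (A : ArtAlg K) : L.ext A →ₗ[K] L.ext A →ₗ[K] L.ext A :=
  TensorProduct.map₂ L.bracket A.maxMul

/-- The subspace `L^i ⊗ 𝔪_A` of `L ⊗ 𝔪_A`. -/
def DGLA.extGr (L : DGLA.{u, v} K) (A : ArtAlg K) (i : ℤ) : Submodule K (L.ext A) :=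
  LinearMap.range ((L.gr i).subtype.rTensor A.max)

/-- The map `L ⊗ 𝔪_A → L ⊗ 𝔪_B` induced by a morphism `A → B`. -/
def DGLA.extMap (L : DGLA.{u, v} K) {A B : ArtAlg K} (f : A ⟶ B) : L.ext A →ₗ[K] L.ext B :=
  (ArtAlg.maxMap f).lTensor L.carrier

/-- The map `L ⊗ 𝔪_A → M ⊗ 𝔪_A` induced by a morphism `L → M`. -/
def DGLA.Hom.ext {L : DGLA.{u, v} K} {M : DGLA.{u, w} K} (φ : L.Hom M) (A : ArtAlg K) :
    L.ext A →ₗ[K] M.ext A := φ.toLin.rTensor A.max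

/-- The Baker-Campbell-Hausdorff product on `L ⊗ 𝔪_A`, used on `L^0 ⊗ 𝔪_A`. -/
def DGLA.bch (L : DGLA.{u, v} K) (A : ArtAlg K) (a b : L.ext A) : L.ext A :=
  ThomWhitney.bch (L.extBr A) a b

/-- The gauge action `e^a * x` of `a ∈ L^0 ⊗ 𝔪_A` on `x ∈ L^1 ⊗ 𝔪_A`. -/
def DGLA.gauge (L : DGLA.{u, v} K) (A : ArtAlg K) (a x : L.ext A) : L.ext A :=
  ThomWhitney.gauge (L.extD A) (L.extBr A) a x

/-- `x` is a Maurer-Cartan element: `x ∈ L^1 ⊗ 𝔪_A` and `d x + 1/2 [x, x] = 0`. -/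
def DGLA.IsMC (L : DGLA.{u, v} K) (A : ArtAlg K) (x : L.ext A) : Prop :=
  x ∈ L.extGr A 1 ∧ L.extD A x + (1 / 2 : K) • L.extBr A x x = 0

/-- The filtration of `L ⊗ 𝔪_A` by the `L ⊗ 𝔪_A^s`. -/
def DGLA.extFil (L : DGLA.{u, v} K) (A : ArtAlg K) (s : ℕ) : Submodule K (L.ext A) :=
  Submodule.span K {z | ∃ (x : L.carrier) (a : A.max),
    (a : A.carrier) ∈ IsLocalRing.maximalIdeal A.carrier ^ s ∧ z = x ⊗ₜ a}

theorem DGLA.nilFiltration (L : DGLA.{u, v} K) (A : ArtAlg K) :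
    NilFiltration (L.extBr A) (L.extFil A) where
  one z := by
    induction z using TensorProduct.induction_on with
    | zero => exact Submodule.zero_mem _
    | add x y hx hy => exact Submodule.add_mem _ hx hy
    | tmul x a => exact Submodule.subset_span ⟨x, a, by rw [pow_one]; exact a.2, rfl⟩
  bracket i j z hz w hw := by
    refine Submodule.span_induction (p := fun z _ => L.extBr A z w ∈ L.extFil A (i + j)) ?_
      (by simp) (fun x y _ _ hx hy => by rw [map_add]; exact Submodule.add_mem _ hx hy)
      (fun c x _ hx => by rw [map_smul]; exact Submodule.smul_mem _ c hx) hz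
    rintro _ ⟨x, a, ha, rfl⟩
    refine Submodule.span_induction
      (p := fun w _ => L.extBr A (x ⊗ₜ a) w ∈ L.extFil A (i + j)) ?_
      (by simp) (fun x y _ _ hx hy => by rw [map_add]; exact Submodule.add_mem _ hx hy)
      (fun c x _ hx => by rw [map_smul]; exact Submodule.smul_mem _ c hx) hw
    rintro _ ⟨y, b, hb, rfl⟩
    refine Submodule.subset_span ⟨L.bracket x y, A.maxMul a b, ?_, rfl⟩
    rw [pow_add]
    exact Ideal.mul_mem_mul ha hb
  bot := by
    obtain ⟨e, he⟩ := A.max_nilpotent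
    refine ⟨e, fun i hi => ?_⟩
    have hi' : IsLocalRing.maximalIdeal A.carrier ^ i = ⊥ :=
      le_bot_iff.mp (he ▸ Ideal.pow_le_pow_right hi)
    refine (Submodule.span_eq_bot).mpr ?_
    rintro _ ⟨x, a, ha, rfl⟩
    rw [hi', Ideal.mem_bot] at ha
    rw [show a = 0 from Subtype.ext ha, tmul_zero]

section Maps

variable (L : DGLA.{u, v} K) {M : DGLA.{u, w} K} {A B : ArtAlg K} (f : A ⟶ B)

theorem DGLA.extMap_d (x : L.ext A) : L.extMap f (L.extD A x) = L.extD B (L.extMap f x) := by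
  induction x using TensorProduct.induction_on with
  | zero => simp
  | add x y hx hy => simp only [map_add, hx, hy]
  | tmul x a => rfl

theorem DGLA.extMap_br (x y : L.ext A) :
    L.extMap f (L.extBr A x y) = L.extBr B (L.extMap f x) (L.extMap f y) := by
  induction x using TensorProduct.induction_on with
  | zero => simp
  | add x y hx hy => simp only [map_add, LinearMap.add_apply, hx, hy]
  | tmul x a =>
    induction y using TensorProduct.induction_on with
    | zero => simp
    | add x y hx hy => simp only [map_add, hx, hy]
    | tmul y b =>
      change L.bracket x y ⊗ₜ[K] ArtAlg.maxMap f (A.maxMul a b) =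
        L.bracket x y ⊗ₜ[K] B.maxMul (ArtAlg.maxMap f a) (ArtAlg.maxMap f b)
      congr 1
      exact Subtype.ext (map_mul (ArtAlg.hom f) _ _)

theorem DGLA.extMap_mem {i : ℤ} {x : L.ext A} (hx : x ∈ L.extGr A i) :
    L.extMap f x ∈ L.extGr B i := by
  obtain ⟨y, rfl⟩ := hx
  refine ⟨(ArtAlg.maxMap f).lTensor _ y, ?_⟩
  rw [DGLA.extMap, ← LinearMap.comp_apply, ← LinearMap.comp_apply, LinearMap.rTensor_comp_lTensor,
    LinearMap.lTensor_comp_rTensor]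

theorem DGLA.extMap_gauge (a x : L.ext A) :
    L.extMap f (L.gauge A a x) = L.gauge B (L.extMap f a) (L.extMap f x) :=
  (L.nilFiltration A).map_gauge _ (L.extMap_br f) (L.extMap_d f) a x

theorem DGLA.extMap_bch (a b : L.ext A) :
    L.extMap f (L.bch A a b) = L.bch B (L.extMap f a) (L.extMap f b) :=
  (L.nilFiltration A).map_bch _ (L.extMap_br f) a b

variable {L} in
theorem DGLA.Hom.extMap_ext (φ : L.Hom M) (x : L.ext A) :
    M.extMap f (φ.ext A x) = φ.ext B (L.extMap f x) := by
  rw [DGLA.extMap, DGLA.extMap, DGLA.Hom.ext, DGLA.Hom.ext, ← LinearMap.comp_apply,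
    ← LinearMap.comp_apply, LinearMap.rTensor_comp_lTensor, LinearMap.lTensor_comp_rTensor]

theorem DGLA.extMap_isMC {x : L.ext A} (hx : L.IsMC A x) : L.IsMC B (L.extMap f x) :=
  ⟨L.extMap_mem f hx.1, by
    rw [← L.extMap_d, ← L.extMap_br, ← map_smul, ← map_add, hx.2, map_zero]⟩

theorem DGLA.extMap_id (x : L.ext A) : L.extMap (𝟙 A) x = x := by
  have : ArtAlg.maxMap (𝟙 A) = LinearMap.id := rfl
  rw [DGLA.extMap, this, LinearMap.lTensor_id]
  rfl

theorem DGLA.extMap_comp {C : ArtAlg K} (h : B ⟶ C) (x : L.ext A) :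
    L.extMap (f ≫ h) x = L.extMap h (L.extMap f x) := by
  have : ArtAlg.maxMap (f ≫ h) = ArtAlg.maxMap h ∘ₗ ArtAlg.maxMap f := rfl
  rw [DGLA.extMap, this, LinearMap.lTensor_comp]
  rfl

end Maps

/-- The set of Maurer-Cartan elements of `L ⊗ 𝔪_A`. -/
def DGLA.MC (L : DGLA.{u, v} K) (A : ArtAlg K) : Type (max u v) := {x : L.ext A // L.IsMC A x}

/-- Gauge equivalence of Maurer-Cartan elements. -/
def DGLA.GaugeEquiv (L : DGLA.{u, v} K) (A : ArtAlg K) (x y : L.MC A) : Prop :=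
  ∃ a ∈ L.extGr A 0, L.gauge A a x.1 = y.1

/-- The functor `Def_L`: Maurer-Cartan elements modulo gauge equivalence. -/
def DGLA.Def (L : DGLA.{u, v} K) : ArtAlg.{u} K ⥤ Type (max u v) where
  obj A := Quot (L.GaugeEquiv A)
  map {A B} f := TypeCat.ofHom (Quot.map
    (fun x : L.MC A => (⟨L.extMap f x.1, L.extMap_isMC f x.2⟩ : L.MC B))
    (by
      rintro x y ⟨a, ha, h⟩
      exact ⟨L.extMap f a, L.extMap_mem f ha, by rw [← L.extMap_gauge, h]⟩))
  map_id A := by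
    ext x
    induction x using Quot.ind
    exact congrArg (Quot.mk _) (Subtype.ext (L.extMap_id _))
  map_comp f h := by
    ext x
    induction x using Quot.ind
    exact congrArg (Quot.mk _) (Subtype.ext (L.extMap_comp f h _))

variable (g : SemicosimplicialDGLA.{u, v} K)

/-- The set `Z^1_sc(exp g)(A)` of pairs `(l, m)` with `l ∈ g_0^1 ⊗ 𝔪_A`, `m ∈ g_1^0 ⊗ 𝔪_A`,
`d l + 1/2 [l, l] = 0`, `∂_{1,1} l = e^m * ∂_{0,1} l` and, for some `n ∈ g_2^{-1} ⊗ 𝔪_A`,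
`∂_{0,2} m • (-∂_{1,2} m) • ∂_{2,2} m = d n + [∂_{2,2} ∂_{0,1} l, n]`. -/
def Z1 (A : ArtAlg K) : Set ((g.obj 0).ext A × (g.obj 1).ext A) :=
  {q | (g.obj 0).IsMC A q.1 ∧ q.2 ∈ (g.obj 1).extGr A 0 ∧
    (g.coface 0 1).ext A q.1 = (g.obj 1).gauge A q.2 ((g.coface 0 0).ext A q.1) ∧
    ∃ n ∈ (g.obj 2).extGr A (-1),
      (g.obj 2).bch A
        ((g.obj 2).bch A ((g.coface 1 0).ext A q.2) (-(g.coface 1 1).ext A q.2))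
        ((g.coface 1 2).ext A q.2) =
      (g.obj 2).extD A n +
        (g.obj 2).extBr A ((g.coface 1 2).ext A ((g.coface 0 0).ext A q.1)) n}

/-- The relation `(l_0, m_0) ∼ (l_1, m_1)`: there are `a ∈ g_0^0 ⊗ 𝔪_A` and
`b ∈ g_1^{-1} ⊗ 𝔪_A` with `e^a * l_0 = l_1` and
`(-m_0) • (-∂_{1,1} a) • m_1 • ∂_{0,1} a = d b + [∂_{0,1} l_0, b]`. -/
def Z1Rel (A : ArtAlg K) (q r : Z1 g A) : Prop :=
  ∃ a ∈ (g.obj 0).extGr A 0, ∃ b ∈ (g.obj 1).extGr A (-1),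
    (g.obj 0).gauge A a q.1.1 = r.1.1 ∧
    (g.obj 1).bch A
      ((g.obj 1).bch A ((g.obj 1).bch A (-q.1.2) (-(g.coface 0 1).ext A a)) r.1.2)
      ((g.coface 0 0).ext A a) =
    (g.obj 1).extD A b + (g.obj 1).extBr A ((g.coface 0 0).ext A q.1.1) b

variable {g}

theorem Z1_map {A B : ArtAlg K} (f : A ⟶ B) {q} (hq : q ∈ Z1 g A) :
    ((g.obj 0).extMap f q.1, (g.obj 1).extMap f q.2) ∈ Z1 g B := by
  obtain ⟨h₁, h₂, h₃, n, hn, h₄⟩ := hq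
  refine ⟨(g.obj 0).extMap_isMC f h₁, (g.obj 1).extMap_mem f h₂, ?_,
    (g.obj 2).extMap f n, (g.obj 2).extMap_mem f hn, ?_⟩
  · simp only [← DGLA.Hom.extMap_ext, ← DGLA.extMap_gauge, h₃]
  · have h := congrArg ((g.obj 2).extMap f) h₄
    simpa only [DGLA.extMap_bch, map_neg, map_add, DGLA.extMap_d, DGLA.extMap_br,
      DGLA.Hom.extMap_ext] using h

theorem Z1Rel_map {A B : ArtAlg K} (f : A ⟶ B) {q r : Z1 g A} (h : Z1Rel g A q r) :
    Z1Rel g B ⟨_, Z1_map f q.2⟩ ⟨_, Z1_map f r.2⟩ := by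
  obtain ⟨a, ha, b, hb, h₁, h₂⟩ := h
  refine ⟨(g.obj 0).extMap f a, (g.obj 0).extMap_mem f ha, (g.obj 1).extMap f b,
    (g.obj 1).extMap_mem f hb, ?_, ?_⟩
  · simp only [← DGLA.extMap_gauge, h₁]
  · have h := congrArg ((g.obj 1).extMap f) h₂
    simpa only [DGLA.extMap_bch, map_neg, map_add, DGLA.extMap_d, DGLA.extMap_br,
      DGLA.Hom.extMap_ext] using h

variable (g)

/-- The functor `H^1_sc(exp g) = Z^1_sc(exp g) / ∼`. -/
def H1sc : ArtAlg.{u} K ⥤ Type (max u v) where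
  obj A := Quot (Z1Rel g A)
  map {A B} f := TypeCat.ofHom (Quot.map
    (fun q : Z1 g A => (⟨_, Z1_map f q.2⟩ : Z1 g B)) (fun _ _ h => Z1Rel_map f h))
  map_id A := by
    ext x
    induction x using Quot.ind
    exact congrArg (Quot.mk _)
      (Subtype.ext (Prod.ext ((g.obj 0).extMap_id _) ((g.obj 1).extMap_id _)))
  map_comp f h := by
    ext x
    induction x using Quot.ind
    exact congrArg (Quot.mk _)
      (Subtype.ext (Prod.ext ((g.obj 0).extMap_comp f h _) ((g.obj 1).extMap_comp f h _)))

/-- A deformation functor: a functor `F` on local Artinian `K`-algebras with residue field `K`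
such that `F(K)` is a point and, for `P = B ×_A C`, the map `F(P) → F(B) ×_{F(A)} F(C)` is
surjective if `B → A` is surjective, and bijective if `A = K`. -/
structure IsDeformationFunctor (F : ArtAlg.{u} K ⥤ Type w) : Prop where
  point : ∀ A : ArtAlg.{u} K, Function.Bijective (algebraMap K A.carrier) →
    Nonempty (Unique (F.obj A))
  surjective : ∀ {P B C A : ArtAlg.{u} K} (p : P ⟶ B) (q : P ⟶ C) (f : B ⟶ A) (h : C ⟶ A),
    p ≫ f = q ≫ h →
    (∀ b c, ArtAlg.hom f b = ArtAlg.hom h c → ∃! x, ArtAlg.hom p x = b ∧ ArtAlg.hom q x = c) →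
    Function.Surjective (ArtAlg.hom f) →
    ∀ y z, F.map f y = F.map h z → ∃ x, F.map p x = y ∧ F.map q x = z
  bijective : ∀ {P B C A : ArtAlg.{u} K} (p : P ⟶ B) (q : P ⟶ C) (f : B ⟶ A) (h : C ⟶ A),
    p ≫ f = q ≫ h →
    (∀ b c, ArtAlg.hom f b = ArtAlg.hom h c → ∃! x, ArtAlg.hom p x = b ∧ ArtAlg.hom q x = c) →
    Function.Bijective (algebraMap K A.carrier) →
    ∀ y z, F.map f y = F.map h z → ∃! x, F.map p x = y ∧ F.map q x = z

/-- The map `x ↦ ω ⊗ x` from `L ⊗ 𝔪_A` to `Ω ⊗ L ⊗ 𝔪_A`. -/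
def formMul (Ω : CDGA.{u, u} K) (L : DGLA.{u, v} K) (A : ArtAlg K) (ω : Ω.carrier) :
    L.ext A →ₗ[K] (tensor Ω L).ext A :=
  LinearMap.rTensor A.max (TensorProduct.mk K Ω.carrier L.carrier ω)

/-- The polynomial `p(t) = ∑ t^k p_k`, as an element of `Ω_1 ⊗ L ⊗ 𝔪_A`. The coordinate `t` of
the `1`-simplex is `t_0`: it is `0` on the face of index `0` and `1` on the face of index `1`. -/
def polyForm (L : DGLA.{u, v} K) (A : ArtAlg K) (p : ℕ →₀ L.ext A) :
    (tensor (forms K 1) L).ext A :=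
  p.sum fun k c => formMul (forms K 1) L A ((tVar 0 : Form K 1) ^ k) c

/-- The value `p(1)`. -/
def polyEvalOne (L : DGLA.{u, v} K) (A : ArtAlg K) (p : ℕ →₀ L.ext A) : L.ext A :=
  p.sum fun _ c => c

/-- The Maurer-Cartan element `η` of `Tot_TW(g) ⊗ 𝔪_A` has the components
`(x, e^{p(t)} * ∂_{0,1} x)` at the levels `0` and `1`, where `x` is a Maurer-Cartan element of
`g_0 ⊗ 𝔪_A` and `p(t) ∈ (g_1^0[t] t) ⊗ 𝔪_A`. -/
structure HasForm (A : ArtAlg K) (η : (totTW g).MC A) (x : (g.obj 0).ext A)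
    (p : ℕ →₀ (g.obj 1).ext A) : Prop where
  isMC : (g.obj 0).IsMC A x
  zero : p 0 = 0
  mem : ∀ k, p k ∈ (g.obj 1).extGr A 0
  level_zero : (totProj g 0).ext A η.1 = formMul (forms K 0) (g.obj 0) A 1 x
  level_one : (totProj g 1).ext A η.1 = (tensor (forms K 1) (g.obj 1)).gauge A
    (polyForm (g.obj 1) A p) (formMul (forms K 1) (g.obj 1) A 1 ((g.coface 0 0).ext A x))

end Functors

end ThomWhitney

end

open ThomWhitney CategoryTheory

/-! The truncated problem is a nilpotent differential equation on the interval. Levels from 2 on are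
zero and forms on a point are scalars. An element of `Tot_TW ⊗ 𝔪_A` is therefore an element of `g_0
⊗ 𝔪_A` together with a form on the interval, with coefficients in `g_1 ⊗ 𝔪_A`, whose values at `t =
0` and `t = 1` are prescribed by the two cofaces (`tot_ext`, `exists_tot_of_vertexVal`,
`tot_vertexVal`).

Write such a form of degree 1 as `P(t) + Q(t) dt`. The `dt`-component of the Maurer-Cartan equation
is a linear differential equation for `P`, so a solution is determined by `Q` and `P(0)`
(`isMC_ext`). The gauge transform `e^{p(t)} * u` of a constant `u` has `dt`-part `-((e^{ad p} - 1) /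
ad p) p'`, independently of `u` (`gauge_polyFun`). Picard iteration along the powers of `𝔪_A` solves
this for `p` with `p(0) = 0`, uniquely (`NilFiltration.existsUnique_ode`). This is the normal form
(`hasForm_existsUnique`), and its value at `t = 1` is the cocycle condition. Conversely a cocycle
`(l, m)` comes from `p(t) = t m` (`exists_hasForm`).

For the relations, let `(a, H)` be a gauge transformation from `(x, e^P * u)` to `(x', e^{P'} *
u')`, where `u = ∂_0 x` and `u' = ∂_0 x'`. Then `(-P) • (-H) • P' • ∂_0 a` stabilizes the constant
`u`. It is `0` at `t = 0`, and at `t = 1` it is the product in the definition of `∼`. A form `p + r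
dt` of degree 0 stabilizing `u` satisfies `p' = d r + [r, u]`, so its endpoints differ by `d b + [u,
b]` with `b` the integral of `r` (`exists_of_stabilizes`). Conversely `t s + b dt` is a path of
stabilizers ending at `s = d b + [u, b]`, provided `s` itself stabilizes `u`
(`stabilizes_of_exact`).

These manipulations need the group law. Since `•` is given by Dynkin's formula, `e^{a • b} = e^a
e^b` has to be proved in nilpotent representations (`NilLie.nexp_bch`). The differential equation
provides some `z` with `e^z = e^a e^b`. Over `V[X]`, with `Xa` and `Xb` in place of `a` and `b`, the
Euler derivation `X d/dX` counts letters of words, and expanding `log (e^a e^b)` in its affine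
representation identifies `z` with Dynkin's series (`NilFiltration.derivation_bch`). The gauge
action is the exponential of an affine representation, so it is a group action (`DGLA.gauge_bch`).
The Maurer-Cartan equation is a bilinear condition on which this representation acts by derivations
(`DGLA.gauge_isMC`).

Finally, tensoring over a field preserves fiber products of Artinian algebras, which makes every
`Def_L` a deformation functor (`DGLA.isDeformationFunctor_def`). The property is transported along
the isomorphism. -/

namespace ThomWhitney

/-! ### Commutators with nilpotent elements -/

section Commutator

variable (K : Type u) [Field K] {R : Type v} [Ring R] [Algebra K R]

/-- The commutator with `Z`. -/
def comm (Z : R) : Module.End K R := LinearMap.mulLeft K Z - LinearMap.mulRight K Z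

variable {K}

theorem comm_apply (Z T : R) : comm K Z T = Z * T - T * Z := rfl

theorem mulLeft_isNilpotent {Z : R} (hZ : IsNilpotent Z) : IsNilpotent (LinearMap.mulLeft K Z) := by
  obtain ⟨k, hk⟩ := hZ
  exact ⟨k, by rw [LinearMap.pow_mulLeft, hk, LinearMap.mulLeft_zero_eq_zero]⟩

theorem mulRight_isNilpotent {Z : R} (hZ : IsNilpotent Z) :
    IsNilpotent (LinearMap.mulRight K Z) := by
  obtain ⟨k, hk⟩ := hZ
  exact ⟨k, by rw [LinearMap.pow_mulRight, hk, LinearMap.mulRight_zero_eq_zero]⟩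

/-- Left and right multiplication by `Z` are commuting nilpotent operators, so their difference is
nilpotent. -/
theorem comm_isNilpotent {Z : R} (hZ : IsNilpotent Z) : IsNilpotent (comm K Z) :=
  (LinearMap.commute_mulLeft_right Z Z).isNilpotent_sub (mulLeft_isNilpotent hZ)
    (mulRight_isNilpotent hZ)

end Commutator

/-! ### Exponential and logarithm of nilpotent elements -/

section NilpotentExp

variable (K : Type u) [Field K] [CharZero K] {R : Type v} [Ring R] [Algebra K R]

/-- The exponential of a nilpotent element of an algebra over a field of characteristic zero. -/
noncomputable def nexp (r : R) : R :=
  letI : Module ℚ R := Module.compHom R (algebraMap ℚ K)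
  IsNilpotent.exp r

variable {K}

theorem nexp_eq_sum {r : R} {k : ℕ} (h : r ^ k = 0) :
    nexp K r = ∑ i ∈ Finset.range k, ((i.factorial : ℕ) : K)⁻¹ • r ^ i := by
  let : Module ℚ R := Module.compHom R (algebraMap ℚ K)
  refine (IsNilpotent.exp_eq_sum h).trans (Finset.sum_congr rfl fun i _ => ?_)
  change algebraMap ℚ K _ • r ^ i = _
  simp

variable (K R) in
theorem nexp_zero : nexp K (0 : R) = 1 :=
  letI : Module ℚ R := Module.compHom R (algebraMap ℚ K)
  IsNilpotent.exp_zero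

theorem nexp_add {a b : R} (h : Commute a b) (ha : IsNilpotent a) (hb : IsNilpotent b) :
    nexp K (a + b) = nexp K a * nexp K b :=
  letI : Module ℚ R := Module.compHom R (algebraMap ℚ K)
  IsNilpotent.exp_add_of_commute h ha hb

theorem nexp_mul_nexp_neg {a : R} (ha : IsNilpotent a) : nexp K a * nexp K (-a) = 1 := by
  rw [← nexp_add (Commute.neg_right rfl) ha ha.neg, add_neg_cancel, nexp_zero]

theorem nexp_neg_mul_nexp {a : R} (ha : IsNilpotent a) : nexp K (-a) * nexp K a = 1 := by
  rw [← nexp_add (Commute.neg_left rfl) ha.neg ha, neg_add_cancel, nexp_zero]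

theorem map_nexp {S : Type w} [Ring S] [Algebra K S] (f : R →ₐ[K] S) {a : R}
    (ha : IsNilpotent a) : f (nexp K a) = nexp K (f a) := by
  obtain ⟨k, hk⟩ := ha
  rw [nexp_eq_sum hk, nexp_eq_sum (k := k) (by rw [← map_pow, hk, map_zero])]
  simp

/-- Intertwined nilpotent operators have intertwined exponentials. -/
theorem nexp_intertwine {M : Type v} {N : Type w} [AddCommGroup M] [Module K M] [AddCommGroup N]
    [Module K N] {S : Module.End K M} {T : Module.End K N} (hS : IsNilpotent S)
    (hT : IsNilpotent T) (f : M →ₗ[K] N) (h : ∀ m, f (S m) = T (f m)) (m : M) :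
    f (nexp K S m) = nexp K T (f m) := by
  obtain ⟨k, hk⟩ := hS
  obtain ⟨l, hl⟩ := hT
  have hpow : ∀ i, f ((S ^ i) m) = (T ^ i) (f m) := by
    intro i
    induction i with
    | zero => rfl
    | succ i ih => rw [pow_succ', Module.End.mul_apply, h, ih, pow_succ', Module.End.mul_apply]
  rw [nexp_eq_sum (pow_eq_zero_of_le (le_max_left k l) hk),
    nexp_eq_sum (pow_eq_zero_of_le (le_max_right k l) hl)]
  simp [LinearMap.sum_apply, hpow]

/-- `e^Z T e^{-Z} = e^{ad Z} T`. -/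
theorem nexp_conj {Z : R} (hZ : IsNilpotent Z) (T : R) :
    nexp K Z * T * nexp K (-Z) = nexp K (comm K Z) T := by
  have hL : nexp K (LinearMap.mulLeft K Z) = LinearMap.mulLeft K (nexp K Z) := by
    obtain ⟨k, hk⟩ := hZ
    rw [nexp_eq_sum hk, nexp_eq_sum (k := k) (by
      rw [LinearMap.pow_mulLeft, hk, LinearMap.mulLeft_zero_eq_zero])]
    ext x
    simp [LinearMap.pow_mulLeft, Finset.sum_mul]
  have hR : nexp K (-LinearMap.mulRight K Z) = LinearMap.mulRight K (nexp K (-Z)) := by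
    have hneg : -LinearMap.mulRight K Z = LinearMap.mulRight K (-Z) := by ext; simp
    obtain ⟨k, hk⟩ := hZ.neg
    rw [hneg, nexp_eq_sum hk, nexp_eq_sum (k := k) (by
      rw [LinearMap.pow_mulRight, hk, LinearMap.mulRight_zero_eq_zero])]
    ext x
    simp [LinearMap.pow_mulRight, Finset.mul_sum]
  -- `ad Z` is a difference of commuting operators, so its exponential is left multiplication by
  -- `e^Z` followed by right multiplication by `e^{-Z}`.
  rw [comm, sub_eq_add_neg, nexp_add (Commute.neg_right (LinearMap.commute_mulLeft_right (R := K) Z Z))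
    (mulLeft_isNilpotent hZ) (mulRight_isNilpotent hZ).neg, hL, hR]
  simp [mul_assoc]

/-- The derivative of the exponential: `D (e^Z) = ((e^{ad Z} - 1) / ad Z) (D Z) e^Z`. -/
theorem deriv_nexp (D : R →ₗ[K] R) (hD : ∀ x y, D (x * y) = D x * y + x * D y) {Z : R}
    (hZ : IsNilpotent Z) : ∃ k₀, ∀ k ≥ k₀, D (nexp K Z) =
      (∑ n ∈ Finset.range k, (((n + 1).factorial : ℕ) : K)⁻¹ • (comm K Z ^ n) (D Z)) *
        nexp K Z := by
  have hD1 : D 1 = 0 := by simpa using hD 1 1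
  have hlm : ∀ a x, Algebra.lmul K R a x = a * x := fun _ _ => rfl
  have hℓ : IsNilpotent (Algebra.lmul K R Z) := hZ.map _
  obtain ⟨k₀, hk₀⟩ := comm_isNilpotent (K := K) hℓ
  refine ⟨k₀, fun k hk => ?_⟩
  -- The Leibniz rule says that `[L_Z, D] = -L_{D Z}` in `End R`, with `L` left multiplication.
  -- Further commutators with `L_Z` act inside the image of `L`.
  have hc : ∀ n, (comm K (Algebra.lmul K R Z) ^ (n + 1)) D =
      -Algebra.lmul K R ((comm K Z ^ n) (D Z)) := by
    intro n
    induction n with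
    | zero =>
      ext x
      simp [comm_apply, hD]
    | succ n ih =>
      rw [pow_succ', Module.End.mul_apply, ih, pow_succ', Module.End.mul_apply, comm_apply,
        comm_apply, map_sub, map_mul, map_mul]
      ext x
      simp only [LinearMap.sub_apply, LinearMap.neg_apply, Module.End.mul_apply, hlm, mul_neg]
      abel
  have h := nexp_conj (K := K) hℓ D
  rw [nexp_eq_sum (r := comm K _) (k := k + 1) (pow_eq_zero_of_le (by omega) hk₀), ← map_neg,
    ← map_nexp _ hZ, ← map_nexp _ hZ.neg, Finset.sum_range_succ'] at h
  -- The conjugation formula for the operator `D` itself, applied to `e^Z`: the conjugated side is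
  -- `e^Z D(e^{-Z} e^Z) = e^Z D(1) = 0`.
  have h' := LinearMap.congr_fun h (nexp K Z)
  simp only [LinearMap.add_apply, LinearMap.sum_apply, LinearMap.smul_apply, hc,
    LinearMap.neg_apply, Module.End.mul_apply, hlm, nexp_neg_mul_nexp hZ, hD1, mul_zero, pow_zero,
    Module.End.one_apply, Nat.factorial_zero, Nat.cast_one, inv_one, one_smul, smul_neg,
    Finset.sum_neg_distrib] at h'
  rw [Finset.sum_mul]
  simp only [smul_mul_assoc]
  exact (neg_add_eq_zero.mp h'.symm).symm

open Polynomial in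
/-- `log (e^X) = X` up to order `k`. -/
theorem X_pow_dvd_log_exp (k : ℕ) :
    (X : K[X]) ^ (k + 1) ∣ ∑ n ∈ Finset.range (k + 1), ((-1 : K) ^ (n + 1) / (n : K)) •
      (∑ i ∈ Finset.range (k + 1), ((i.factorial : ℕ) : K)⁻¹ • (X : K[X]) ^ i - 1) ^ n - X := by
  set E : K[X] := ∑ i ∈ Finset.range (k + 1), ((i.factorial : ℕ) : K)⁻¹ • (X : K[X]) ^ i with hE
  set U := E - 1 with hU
  have hXU : X ∣ U := by
    rw [hU, hE, Finset.sum_range_succ']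
    simp only [pow_zero, Nat.factorial_zero, Nat.cast_one, inv_one, one_smul, add_sub_cancel_right]
    exact Finset.dvd_sum fun i _ => dvd_smul_of_dvd _ (dvd_pow_self X (Nat.succ_ne_zero i))
  have hE' : derivative E = E - ((k.factorial : ℕ) : K)⁻¹ • X ^ k := by
    rw [hE, Finset.sum_range_succ, add_sub_cancel_right, map_add, map_sum, ← Finset.sum_range_succ
      (fun i => derivative (((i.factorial : ℕ) : K)⁻¹ • (X : K[X]) ^ i)), Finset.sum_range_succ']
    simp only [derivative_smul, derivative_X_pow, pow_zero, derivative_one, smul_zero, add_zero]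
    refine Finset.sum_congr rfl fun i _ => ?_
    rw [Nat.add_sub_cancel, ← smul_eq_C_mul, smul_smul]
    congr 1
    have h1 : ((i + 1 : ℕ) : K) ≠ 0 := by exact_mod_cast Nat.succ_ne_zero i
    have h2 : ((i.factorial : ℕ) : K) ≠ 0 := by exact_mod_cast Nat.factorial_ne_zero i
    rw [Nat.factorial_succ]
    push_cast at h1 ⊢
    field_simp
  have hU' : derivative U = 1 + U - ((k.factorial : ℕ) : K)⁻¹ • X ^ k := by
    rw [hU, map_sub, hE', derivative_one]; ring
  -- The derivative of the truncated logarithm is a geometric sum times `U'`. As `U' = 1 + U` up to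
  -- the top term of `E`, the sum telescopes to `1` up to `(-U)^k` and a multiple of `X^k`; both
  -- errors are divisible by `X^k` because `X` divides `U`.
  have hder : (X : K[X]) ^ k ∣ derivative (∑ n ∈ Finset.range (k + 1),
      ((-1 : K) ^ (n + 1) / (n : K)) • U ^ n - X) := by
    have h1 : derivative (∑ n ∈ Finset.range (k + 1), ((-1 : K) ^ (n + 1) / (n : K)) • U ^ n) =
        (∑ n ∈ Finset.range k, (-U) ^ n) * derivative U := by
      rw [map_sum, Finset.sum_range_succ', Finset.sum_mul]
      simp only [derivative_smul, derivative_pow, pow_zero, derivative_one, smul_zero, add_zero,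
        Nat.add_sub_cancel]
      refine Finset.sum_congr rfl fun i _ => ?_
      have h1 : ((i + 1 : ℕ) : K) ≠ 0 := by exact_mod_cast Nat.succ_ne_zero i
      rw [mul_assoc, ← smul_eq_C_mul, smul_smul, div_mul_cancel₀ _ h1, neg_pow U, smul_eq_C_mul]
      simp [pow_succ, mul_assoc]
    have h2 : (∑ n ∈ Finset.range k, (-U) ^ n) * (1 + U) = 1 - (-U) ^ k := by
      have := geom_sum_mul_neg (-U) k
      rwa [sub_neg_eq_add] at this
    rw [map_sub, h1, hU', mul_sub, h2, derivative_X]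
    rw [show ∀ a b : K[X], 1 - a - b - 1 = -(a + b) by intros; ring]
    refine (dvd_add ?_ ?_).neg_right
    · exact pow_dvd_pow_of_dvd hXU.neg_right k
    · exact Dvd.dvd.mul_left (dvd_smul_of_dvd _ (dvd_refl _)) _
  rw [X_pow_dvd_iff] at hder ⊢
  rintro (_ | d) hd
  · have h0 : U.coeff 0 = 0 := X_dvd_iff.mp hXU
    have h0' : ∀ n, (U ^ (n + 1)).coeff 0 = 0 := fun n => by
      rw [pow_succ, mul_coeff_zero, h0, mul_zero]
    -- The term of index 0 contributes nothing: its coefficient is a division by zero, hence 0.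
    rw [Finset.sum_range_succ']
    simp [h0']
  · have := hder d (by omega)
    rw [coeff_derivative] at this
    exact (mul_eq_zero.mp this).resolve_right (by exact_mod_cast Nat.succ_ne_zero d)

/-- The logarithm inverts the exponential. -/
theorem log_nexp {Z : R} {k : ℕ} (hZ : Z ^ k = 0) :
    ∑ n ∈ Finset.range k, ((-1 : K) ^ (n + 1) / (n : K)) • (nexp K Z - 1) ^ n = Z := by
  rcases k with _ | k
  · have : (1 : R) = 0 := by simpa using hZ
    rw [← mul_one Z, this, mul_zero]; simp
  -- Substituting `Z` for the variable kills the error term, a multiple of `X^(k+1)`.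
  · obtain ⟨Q, hQ⟩ := X_pow_dvd_log_exp (K := K) k
    have h := congrArg (Polynomial.aeval Z) hQ
    simp only [map_sub, map_sum, map_smul, map_pow, map_mul, Polynomial.aeval_X, map_one, hZ,
      zero_mul] at h
    rw [nexp_eq_sum hZ]
    exact sub_eq_zero.mp h

/-- The truncated logarithm recovers the exponent; both exponents are truncated at a common order.
-/
theorem nexp_injective {Y Z : R} (hY : IsNilpotent Y) (hZ : IsNilpotent Z)
    (h : nexp K Y = nexp K Z) : Y = Z := by
  obtain ⟨k, hk⟩ := hY
  obtain ⟨l, hl⟩ := hZ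
  rw [← log_nexp (K := K) (pow_eq_zero_of_le (le_max_left k l) hk), h,
    log_nexp (pow_eq_zero_of_le (le_max_right k l) hl)]

end NilpotentExp

/-! ### Polynomials with coefficients in a vector space: derivative, primitive, evaluation -/

section Polynomials

open Polynomial

variable {K : Type u} [Field K]

/-- Polynomials with coefficients in a vector space. -/
abbrev PolyMod (K : Type u) [Field K] (V : Type v) [AddCommGroup V] [Module K V] :
    Type (max u v) := K[X] ⊗[K] V

variable {V : Type v} [AddCommGroup V] [Module K V] {W : Type w} [AddCommGroup W] [Module K W]

/-- The `K[X]`-bilinear extension of a bracket. -/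
noncomputable def polyBr (br : V →ₗ[K] V →ₗ[K] V) :
    PolyMod K V →ₗ[K] PolyMod K V →ₗ[K] PolyMod K V :=
  TensorProduct.map₂ (LinearMap.mul K K[X]) br

@[simp]
theorem polyBr_tmul (br : V →ₗ[K] V →ₗ[K] V) (f g : K[X]) (x y : V) :
    polyBr br (f ⊗ₜ x) (g ⊗ₜ y) = (f * g) ⊗ₜ br x y := rfl

variable (K V) in
/-- The derivative `d/dX`. -/
noncomputable def polyD : PolyMod K V →ₗ[K] PolyMod K V := (derivative (R := K)).rTensor V

@[simp]
theorem polyD_tmul (f : K[X]) (x : V) : polyD K V (f ⊗ₜ x) = derivative f ⊗ₜ x := rfl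

/-- The value at `c`. -/
noncomputable def polyEval (c : K) : PolyMod K V →ₗ[K] V :=
  (TensorProduct.lid K V).toLinearMap ∘ₗ (leval c).rTensor V

@[simp]
theorem polyEval_tmul (c : K) (f : K[X]) (x : V) : polyEval c (f ⊗ₜ[K] x) = f.eval c • x := by
  simp [polyEval, leval]

variable (K) in
/-- The primitive with value `0` at `0`. -/
noncomputable def primitive : K[X] →ₗ[K] K[X] :=
  lsum fun n => ((n : K) + 1)⁻¹ • monomial (n + 1)

theorem primitive_monomial (n : ℕ) (a : K) :
    primitive K (monomial n a) = monomial (n + 1) (((n : K) + 1)⁻¹ * a) := by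
  simp [primitive, lsum_apply, smul_monomial]

variable (K V) in
/-- The primitive with value `0` at `0`. -/
noncomputable def polyInt : PolyMod K V →ₗ[K] PolyMod K V := (primitive K).rTensor V

@[simp]
theorem polyInt_tmul (f : K[X]) (x : V) : polyInt K V (f ⊗ₜ x) = primitive K f ⊗ₜ x := rfl

theorem polyEval_zero_polyInt (p : PolyMod K V) : polyEval 0 (polyInt K V p) = 0 := by
  induction p using TensorProduct.induction_on with
  | zero => simp
  | add p q hp hq => simp [hp, hq]
  | tmul f x =>
    have : (primitive K f).eval 0 = 0 := by
      induction f using Polynomial.induction_on' with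
      | add f g hf hg => simp [hf, hg]
      | monomial n a => simp [primitive_monomial]
    simp [this]

theorem polyD_polyInt [CharZero K] (p : PolyMod K V) : polyD K V (polyInt K V p) = p := by
  induction p using TensorProduct.induction_on with
  | zero => simp
  | add p q hp hq => simp [hp, hq]
  | tmul f x =>
    have : derivative (primitive K f) = f := by
      induction f using Polynomial.induction_on' with
      | add f g hf hg => simp [hf, hg]
      | monomial n a =>
        rw [primitive_monomial, derivative_monomial]
        have h : (n : K) + 1 ≠ 0 := by exact_mod_cast Nat.succ_ne_zero n
        push_cast
        rw [mul_right_comm, inv_mul_cancel₀ h, one_mul]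
    simp [this]

/-- The fundamental theorem of calculus. It turns a differential equation with initial value into a
fixed-point equation. -/
theorem polyInt_polyD [CharZero K] (p : PolyMod K V) :
    polyInt K V (polyD K V p) = p - 1 ⊗ₜ polyEval 0 p := by
  induction p using TensorProduct.induction_on with
  | zero => simp
  | add p q hp hq => simp only [map_add, hp, hq, tmul_add]; abel
  | tmul f x =>
    have : primitive K (derivative f) = f - C (f.eval 0) := by
      induction f using Polynomial.induction_on' with
      | add f g hf hg => simp only [map_add, hf, hg, eval_add]; abel
      | monomial n a =>
        rcases n with _ | n
        · simp
        · have h : (n : K) + 1 ≠ 0 := by exact_mod_cast Nat.succ_ne_zero n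
          rw [derivative_monomial, Nat.add_sub_cancel, primitive_monomial]
          push_cast
          rw [mul_comm a, ← mul_assoc, inv_mul_cancel₀ h, one_mul]
          simp
    rw [polyD_tmul, polyInt_tmul, this, polyEval_tmul, sub_tmul, tmul_smul, smul_tmul',
      smul_eq_C_mul, mul_one]

theorem polyEval_one_polyInt_polyD [CharZero K] (p : PolyMod K V) :
    polyEval 1 (polyInt K V (polyD K V p)) = polyEval 1 p - polyEval 0 p := by
  rw [polyInt_polyD, map_sub, polyEval_tmul, eval_one, one_smul]

/-- A polynomial is determined by its derivative and its value at `0`. -/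
theorem polyMod_ext [CharZero K] {p q : PolyMod K V} (h : polyD K V p = polyD K V q)
    (h0 : polyEval 0 p = polyEval 0 q) : p = q := by
  have := congrArg (polyInt K V) h
  rw [polyInt_polyD, polyInt_polyD, h0] at this
  exact sub_left_injective this

theorem polyEval_polyBr (br : V →ₗ[K] V →ₗ[K] V) (c : K) (p q : PolyMod K V) :
    polyEval c (polyBr br p q) = br (polyEval c p) (polyEval c q) := by
  induction p using TensorProduct.induction_on with
  | zero => simp
  | add p p' hp hp' => simp only [map_add, LinearMap.add_apply, hp, hp']
  | tmul f x =>
    induction q using TensorProduct.induction_on with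
    | zero => simp
    | add q q' hq hq' => simp only [map_add, hq, hq']
    | tmul g y => simp [smul_smul, mul_comm]

theorem polyD_polyBr (br : V →ₗ[K] V →ₗ[K] V) (p q : PolyMod K V) :
    polyD K V (polyBr br p q) = polyBr br (polyD K V p) q + polyBr br p (polyD K V q) := by
  induction p using TensorProduct.induction_on with
  | zero => simp
  | add p p' hp hp' => simp only [map_add, LinearMap.add_apply, hp, hp']; abel
  | tmul f x =>
    induction q using TensorProduct.induction_on with
    | zero => simp
    | add q q' hq hq' => simp only [map_add, hq, hq']; abel
    | tmul g y => simp [add_tmul]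

/-- The action of a linear map on coefficients. -/
noncomputable abbrev polyMap (f : V →ₗ[K] W) : PolyMod K V →ₗ[K] PolyMod K W := f.lTensor K[X]

theorem polyMap_polyBr {br : V →ₗ[K] V →ₗ[K] V} {br' : W →ₗ[K] W →ₗ[K] W} (f : V →ₗ[K] W)
    (hf : ∀ x y, f (br x y) = br' (f x) (f y)) (p q : PolyMod K V) :
    polyMap f (polyBr br p q) = polyBr br' (polyMap f p) (polyMap f q) := by
  induction p using TensorProduct.induction_on with
  | zero => simp
  | add p p' hp hp' => simp only [map_add, LinearMap.add_apply, hp, hp']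
  | tmul g x =>
    induction q using TensorProduct.induction_on with
    | zero => simp
    | add q q' hq hq' => simp only [map_add, hq, hq']
    | tmul h y => simp [hf]

theorem polyMap_polyD (f : V →ₗ[K] W) (p : PolyMod K V) :
    polyMap f (polyD K V p) = polyD K W (polyMap f p) := by
  induction p using TensorProduct.induction_on with
  | zero => simp
  | add p q hp hq => simp only [map_add, hp, hq]
  | tmul g x => simp

theorem polyMap_polyInt (f : V →ₗ[K] W) (p : PolyMod K V) :
    polyMap f (polyInt K V p) = polyInt K W (polyMap f p) := by
  induction p using TensorProduct.induction_on with
  | zero => simp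
  | add p q hp hq => simp only [map_add, hp, hq]
  | tmul g x => simp

theorem polyMap_polyEval (f : V →ₗ[K] W) (c : K) (p : PolyMod K V) :
    polyEval c (polyMap f p) = f (polyEval c p) := by
  induction p using TensorProduct.induction_on with
  | zero => simp
  | add p q hp hq => simp only [map_add, hp, hq]
  | tmul g x => simp

theorem polyMap_injective {f : V →ₗ[K] W} (hf : Function.Injective f) :
    Function.Injective (polyMap f) :=
  Module.Flat.lTensor_preserves_injective_linearMap f hf

/-- The polynomials with coefficients in a subspace. -/
noncomputable def polySub (S : Submodule K V) : Submodule K (PolyMod K V) :=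
  LinearMap.range (polyMap S.subtype)

theorem tmul_mem_polySub {S : Submodule K V} (f : K[X]) {x : V} (hx : x ∈ S) :
    f ⊗ₜ x ∈ polySub S := ⟨f ⊗ₜ ⟨x, hx⟩, rfl⟩

theorem polySub_ind {S : Submodule K V} {P : PolyMod K V → Prop} (h0 : P 0)
    (hadd : ∀ p q, P p → P q → P (p + q)) (h : ∀ f, ∀ x ∈ S, P (f ⊗ₜ x)) {p}
    (hp : p ∈ polySub S) : P p := by
  obtain ⟨q, rfl⟩ := hp
  induction q using TensorProduct.induction_on with
  | zero => simpa using h0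
  | add p q hp hq => rw [map_add]; exact hadd _ _ hp hq
  | tmul f x => exact h f x x.2

theorem polySub_mono {S T : Submodule K V} (h : S ≤ T) : polySub S ≤ polySub T := fun _ hp =>
  polySub_ind (P := (· ∈ polySub T)) (Submodule.zero_mem _) (fun _ _ => Submodule.add_mem _)
    (fun f _ hx => tmul_mem_polySub f (h hx)) hp

theorem polySub_top (p : PolyMod K V) {S : Submodule K V} (h : ∀ x, x ∈ S) : p ∈ polySub S := by
  induction p using TensorProduct.induction_on with
  | zero => exact Submodule.zero_mem _
  | add p q hp hq => exact Submodule.add_mem _ hp hq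
  | tmul f x => exact tmul_mem_polySub f (h x)

theorem polySub_bot : polySub (⊥ : Submodule K V) = ⊥ := by
  rw [eq_bot_iff]
  intro p hp
  refine polySub_ind (P := (· ∈ (⊥ : Submodule K (PolyMod K V)))) (Submodule.zero_mem _)
    (fun _ _ => Submodule.add_mem _) (fun f x hx => ?_) hp
  rw [(Submodule.mem_bot K).mp hx, tmul_zero]
  exact Submodule.zero_mem _

theorem polyD_mem {S : Submodule K V} {p : PolyMod K V} (hp : p ∈ polySub S) :
    polyD K V p ∈ polySub S := by
  obtain ⟨q, rfl⟩ := hp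
  exact ⟨polyD K S q, polyMap_polyD _ _⟩

theorem polyInt_mem {S : Submodule K V} {p : PolyMod K V} (hp : p ∈ polySub S) :
    polyInt K V p ∈ polySub S := by
  obtain ⟨q, rfl⟩ := hp
  exact ⟨polyInt K S q, polyMap_polyInt _ _⟩

theorem polyEval_mem {S : Submodule K V} (c : K) {p : PolyMod K V} (hp : p ∈ polySub S) :
    polyEval c p ∈ S := by
  obtain ⟨q, rfl⟩ := hp
  rw [polyMap_polyEval]
  exact (polyEval c q).2

theorem polyBr_mem {br : V →ₗ[K] V →ₗ[K] V} {S T U : Submodule K V}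
    (h : ∀ x ∈ S, ∀ y ∈ T, br x y ∈ U) {p q : PolyMod K V} (hp : p ∈ polySub S)
    (hq : q ∈ polySub T) : polyBr br p q ∈ polySub U := by
  refine polySub_ind (P := fun p => polyBr br p q ∈ polySub U) (by simp)
    (fun _ _ h h' => by rw [map_add]; exact Submodule.add_mem _ h h') (fun f x hx => ?_) hp
  refine polySub_ind (P := fun q => polyBr br (f ⊗ₜ x) q ∈ polySub U) (by simp)
    (fun _ _ h h' => by rw [map_add]; exact Submodule.add_mem _ h h') (fun g y hy => ?_) hq
  exact tmul_mem_polySub _ (h x hx y hy)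

/-- Filtering coefficientwise keeps the length of the filtration, whatever the degree in `X`. This
is why formal solutions of differential equations are reached after finitely many steps and stay
polynomial. -/
theorem NilFiltration.poly {br : V →ₗ[K] V →ₗ[K] V} {F : ℕ → Submodule K V}
    (h : NilFiltration br F) : NilFiltration (polyBr br) fun i => polySub (F i) where
  one p := polySub_top p h.one
  bracket i j _ hp _ hq := polyBr_mem (h.bracket i j) hp hq
  bot := by
    obtain ⟨e, he⟩ := h.bot
    exact ⟨e, fun i hi => by simp only [he i hi, polySub_bot]⟩

end Polynomials

/-! ### Nilpotent differential equations -/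

section NilpotentODE

variable {K : Type u} [Field K] {V : Type v} [AddCommGroup V] [Module K V]
  {br : V →ₗ[K] V →ₗ[K] V} {F : ℕ → Submodule K V}

/-- The series `((e^{ad a} - 1) / ad a) y`. -/
noncomputable def expm (br : V →ₗ[K] V →ₗ[K] V) (a y : V) : V :=
  ∑ᶠ n : ℕ, (((n + 1).factorial : ℕ) : K)⁻¹ • ((br a)^[n]) y

theorem gauge_eq_expm (d : V →ₗ[K] V) (a x : V) :
    gauge d br a x = x + expm br a (br a x - d a) := rfl

/-- The bound comes from the length of the filtration alone, hence is uniform in `a` and `y`.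
Identities between these series become identities between sums over a common range. -/
theorem NilFiltration.expm_eq_sum (h : NilFiltration br F) : ∃ k₀, ∀ k ≥ k₀, ∀ a y,
    expm br a y = ∑ n ∈ Finset.range k, (((n + 1).factorial : ℕ) : K)⁻¹ • ((br a)^[n]) y := by
  obtain ⟨e, he⟩ := h.bot
  refine ⟨e, fun k hk a y => finsum_eq_sum_of_support_subset _ fun n hn => ?_⟩
  by_contra hlt
  have hlt : k ≤ n := by simpa using hlt
  refine hn ?_
  have := h.iterate_mem a y n
  rw [he _ (by omega), Submodule.mem_bot] at this
  simp [this]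

theorem NilFiltration.iterate_mem_of_mem (h : NilFiltration br F) (a : V) {y : V} {i : ℕ}
    (hy : y ∈ F i) (n : ℕ) : ((br a)^[n]) y ∈ F (i + n) := by
  induction n with
  | zero => exact hy
  | succ n ih =>
    rw [Function.iterate_succ_apply', ← add_assoc, add_comm _ 1]
    exact h.bracket 1 _ a (h.one a) _ ih

/-- Every element lies in the first step, and the hypothesis pushes it down the filtration until it
reaches zero. All uniqueness arguments below have this form. -/
theorem NilFiltration.eq_zero_of_forall_mem (h : NilFiltration br F) {y : V}
    (hy : ∀ i, y ∈ F i → y ∈ F (i + 1)) : y = 0 := by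
  obtain ⟨e, he⟩ := h.bot
  have : ∀ i, y ∈ F (i + 1) := by
    intro i
    induction i with
    | zero => exact h.one y
    | succ i ih => exact hy _ ih
  have := this e
  rwa [he _ (by omega), Submodule.mem_bot] at this

/-- The series is `y` plus terms with at least one bracket with `a`, which lie deeper in the
filtration than `y`. -/
theorem NilFiltration.eq_zero_of_expm (h : NilFiltration br F) (hF : Antitone F) {a y : V}
    (hy : expm br a y = 0) : y = 0 := by
  refine h.eq_zero_of_forall_mem fun i hi => ?_
  obtain ⟨k₀, hk₀⟩ := h.expm_eq_sum
  rw [hk₀ (k₀ + 1) (by omega), Finset.sum_range_succ'] at hy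
  have h1 : y = -∑ n ∈ Finset.range k₀,
      (((n + 1 + 1).factorial : ℕ) : K)⁻¹ • ((br a)^[n + 1]) y := by
    simp only [Function.iterate_zero, zero_add, Nat.factorial_one, Nat.cast_one, inv_one, one_smul,
      id_eq] at hy
    rw [eq_neg_iff_add_eq_zero, add_comm, hy]
  rw [h1]
  refine Submodule.neg_mem _ (Submodule.sum_mem _ fun n _ => Submodule.smul_mem _ _ ?_)
  exact hF (by omega) (h.iterate_mem_of_mem a hi (n + 1))

theorem NilFiltration.expm_add (h : NilFiltration br F) (a x y : V) :
    expm br a (x + y) = expm br a x + expm br a y := by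
  obtain ⟨k, hk⟩ := h.expm_eq_sum
  simp only [hk k le_rfl, ← Finset.sum_add_distrib, ← smul_add]
  refine Finset.sum_congr rfl fun n _ => ?_
  rw [← Module.End.coe_pow, map_add]

theorem NilFiltration.expm_neg (h : NilFiltration br F) (a x : V) :
    expm br a (-x) = -expm br a x := by
  obtain ⟨k, hk⟩ := h.expm_eq_sum
  simp only [hk k le_rfl, ← Finset.sum_neg_distrib, ← smul_neg]
  refine Finset.sum_congr rfl fun n _ => ?_
  rw [← Module.End.coe_pow, map_neg]

theorem NilFiltration.expm_zero (h : NilFiltration br F) (a : V) : expm br a 0 = 0 := by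
  simpa using h.expm_add a 0 0

/-- Only the intertwining of `ad a` with `ad b` is required, not compatibility with the whole
bracket. This allows maps such as `q ↦ q dt`. -/
theorem NilFiltration.map_expm {W : Type w} [AddCommGroup W] [Module K W]
    {br' : W →ₗ[K] W →ₗ[K] W} (h : NilFiltration br F) {G : ℕ → Submodule K W}
    (h' : NilFiltration br' G) (f : V →ₗ[K] W) {a : V} {b : W}
    (hf : ∀ x, f (br a x) = br' b (f x)) (y : V) :
    f (expm br a y) = expm br' b (f y) := by
  obtain ⟨k, hk⟩ := h.expm_eq_sum
  obtain ⟨l, hl⟩ := h'.expm_eq_sum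
  have hit : ∀ n, f (((br a)^[n]) y) = ((br' b)^[n]) (f y) := by
    intro n
    induction n with
    | zero => rfl
    | succ n ih => rw [Function.iterate_succ_apply', hf, ih, Function.iterate_succ_apply']
  rw [hk (max k l) (le_max_left _ _), hl (max k l) (le_max_right _ _), map_sum]
  exact Finset.sum_congr rfl fun n _ => by rw [map_smul, hit]

/-- A map which contracts a finite filtration has a unique fixed point. -/
theorem NilFiltration.existsUnique_fixedPoint (h : NilFiltration br F) (T : V → V)
    (hT : ∀ i x y, x - y ∈ F i → T x - T y ∈ F (i + 1)) : ∃! x, T x = x := by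
  obtain ⟨e, he⟩ := h.bot
  -- The iterates of `0` gain one order of accuracy at each step, so the `e`-th one is fixed
  -- exactly.
  have hstep : ∀ n, T (T^[n] 0) - T^[n] 0 ∈ F (n + 1) := by
    intro n
    induction n with
    | zero => exact h.one _
    | succ n ih => rw [Function.iterate_succ_apply']; exact hT _ _ _ ih
  refine ⟨T^[e] 0, ?_, fun y hy => ?_⟩
  · have := hstep e
    rw [he _ (by omega), Submodule.mem_bot, sub_eq_zero] at this
    exact this
  · refine sub_eq_zero.mp (h.eq_zero_of_forall_mem fun i hi => ?_)
    have hfix : T (T^[e] 0) = T^[e] 0 := by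
      have := hstep e
      rwa [he _ (by omega), Submodule.mem_bot, sub_eq_zero] at this
    have := hT i _ _ hi
    rwa [hy, hfix] at this

/-- The nilpotent differential equation `((e^{ad p} - 1) / ad p) p' = u` with initial value
`p(0) = a` has a unique polynomial solution. -/
theorem NilFiltration.existsUnique_ode [CharZero K] (h : NilFiltration br F) (hF : Antitone F)
    (a : V) (u : PolyMod K V) :
    ∃! p : PolyMod K V, polyEval 0 p = a ∧ expm (polyBr br) p (polyD K V p) = u := by
  have hp := h.poly
  obtain ⟨k₀, hk₀⟩ := hp.expm_eq_sum
  have hsplit : ∀ p y, expm (polyBr br) p y = ∑ n ∈ Finset.range k₀,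
      (((n + 1 + 1).factorial : ℕ) : K)⁻¹ • ((polyBr br p)^[n + 1]) y + y := by
    intro p y
    rw [hk₀ (k₀ + 1) (by omega), Finset.sum_range_succ']
    simp
  -- The nonlinear part of the equation: it now reads `p' + ψ p = u`, and every term of `ψ` contains
  -- at least one bracket with `p`.
  set ψ : PolyMod K V → PolyMod K V := fun p => ∑ n ∈ Finset.range k₀,
      (((n + 1 + 1).factorial : ℕ) : K)⁻¹ • ((polyBr br p)^[n + 1]) (polyD K V p) with hψ
  -- The integral form of the equation, to be solved by Picard iteration.
  have hiff : ∀ p, (1 ⊗ₜ a + polyInt K V (u - ψ p) = p) ↔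
      (polyEval 0 p = a ∧ expm (polyBr br) p (polyD K V p) = u) := by
    intro p
    rw [hsplit]
    constructor
    · intro hfix
      have hd : polyD K V p = u - ψ p := by
        conv_lhs => rw [← hfix]
        rw [map_add, polyD_polyInt, polyD_tmul, Polynomial.derivative_one, zero_tmul, zero_add]
      refine ⟨?_, ?_⟩
      · conv_lhs => rw [← hfix]
        rw [map_add, polyEval_zero_polyInt, polyEval_tmul, Polynomial.eval_one, one_smul, add_zero]
      · change ψ p + polyD K V p = u
        rw [hd]; abel
    · rintro ⟨h0, hu⟩
      change ψ p + polyD K V p = u at hu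
      rw [← hu, add_sub_cancel_left, polyInt_polyD, h0]
      abel
  have key := hp.existsUnique_fixedPoint (fun p => 1 ⊗ₜ a + polyInt K V (u - ψ p)) ?_
  · exact (existsUnique_congr hiff).mp key
  · intro i p q hpq
    -- Each bracket raises the filtration degree of the difference by one, by bilinearity. Only the
    -- terms with `n ≥ 1` occur in `ψ`, which gives the contraction; differentiation and integration
    -- preserve the filtration.
    have hit : ∀ n, ((polyBr br p)^[n]) (polyD K V p) - ((polyBr br q)^[n]) (polyD K V q) ∈
        polySub (F (i + n)) := by
      intro n
      induction n with
      | zero => simpa using polyD_mem hpq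
      | succ n ih =>
        rw [Function.iterate_succ_apply', Function.iterate_succ_apply']
        set x := ((polyBr br p)^[n]) (polyD K V p)
        set y := ((polyBr br q)^[n]) (polyD K V q)
        have : polyBr br p x - polyBr br q y = polyBr br (p - q) x + polyBr br q (x - y) := by
          simp only [map_sub, LinearMap.sub_apply]; abel
        rw [this, ← add_assoc]
        refine Submodule.add_mem _ ?_ ?_
        · have h1 : x ∈ polySub (F (n + 1)) := hp.iterate_mem p _ n
          exact hp.bracket i (n + 1) _ hpq _ h1
        · have := hp.bracket 1 _ q (hp.one q) _ ih
          rwa [add_comm 1] at this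
    have : (1 ⊗ₜ[K] a + polyInt K V (u - ψ p)) - (1 ⊗ₜ[K] a + polyInt K V (u - ψ q)) =
        -polyInt K V (ψ p - ψ q) := by
      simp only [map_sub]; abel
    simp only [this]
    refine Submodule.neg_mem _ (polyInt_mem ?_)
    simp only [hψ, ← Finset.sum_sub_distrib]
    refine Submodule.sum_mem _ fun n _ => ?_
    have hmem := Submodule.smul_mem _ (((n + 1 + 1).factorial : ℕ) : K)⁻¹
      (polySub_mono (hF (show i + 1 ≤ i + (n + 1) by omega)) (hit (n + 1)))
    rw [smul_sub] at hmem
    exact hmem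

end NilpotentODE

/-! ### Nilpotent Lie algebras and their representations -/

section LieAlgebras

variable {K : Type u} [Field K] {V : Type v} [AddCommGroup V] [Module K V]

/-- A filtered nilpotent Lie algebra. -/
structure NilLie (br : V →ₗ[K] V →ₗ[K] V) (F : ℕ → Submodule K V) : Prop
    extends NilFiltration br F where
  antitone : Antitone F
  skew : ∀ x y, br x y = -br y x
  jacobi : ∀ x y z, br x (br y z) = br (br x y) z + br y (br x z)

theorem NilLie.poly {br : V →ₗ[K] V →ₗ[K] V} {F : ℕ → Submodule K V} (h : NilLie br F) :
    NilLie (polyBr br) fun i => polySub (F i) where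
  toNilFiltration := h.toNilFiltration.poly
  antitone i j hij := polySub_mono (h.antitone hij)
  skew p q := by
    induction p using TensorProduct.induction_on with
    | zero => simp
    | add p p' hp hp' => simp only [map_add, LinearMap.add_apply, hp, hp']; abel
    | tmul f x =>
      induction q using TensorProduct.induction_on with
      | zero => simp
      | add q q' hq hq' => simp only [map_add, LinearMap.add_apply, hq, hq']; abel
      | tmul g y => rw [polyBr_tmul, polyBr_tmul, h.skew, tmul_neg, mul_comm]
  jacobi p q r := by
    induction p using TensorProduct.induction_on with
    | zero => simp
    | add p p' hp hp' => simp only [map_add, LinearMap.add_apply, hp, hp']; abel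
    | tmul f x =>
      induction q using TensorProduct.induction_on with
      | zero => simp
      | add q q' hq hq' => simp only [map_add, LinearMap.add_apply, hq, hq']; abel
      | tmul g y =>
        induction r using TensorProduct.induction_on with
        | zero => simp
        | add r r' hr hr' => simp only [map_add, hr, hr']; abel
        | tmul k z =>
          simp only [polyBr_tmul, h.jacobi x, tmul_add]
          rw [mul_assoc, mul_left_comm g]

variable {R : Type w} [Ring R] [Algebra K R]

/-- A representation in an associative algebra with nilpotent image. -/
structure IsNilRep (br : V →ₗ[K] V →ₗ[K] V) (ρ : V →ₗ[K] R) : Prop where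
  map_br : ∀ x y, ρ (br x y) = ρ x * ρ y - ρ y * ρ x
  nilpotent : ∃ e, LinearMap.range ρ ^ e = ⊥

variable {br : V →ₗ[K] V →ₗ[K] V} {F : ℕ → Submodule K V} {ρ : V →ₗ[K] R}

theorem IsNilRep.isNilpotent (h : IsNilRep br ρ) (x : V) : IsNilpotent (ρ x) := by
  obtain ⟨e, he⟩ := h.nilpotent
  have := Submodule.pow_mem_pow _ (LinearMap.mem_range_self ρ x) e
  rw [he, Submodule.mem_bot] at this
  exact ⟨e, this⟩

theorem IsNilRep.comp (h : IsNilRep br ρ) {V' : Type*} [AddCommGroup V'] [Module K V']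
    {br' : V' →ₗ[K] V' →ₗ[K] V'} (f : V' →ₗ[K] V) (hf : ∀ x y, f (br' x y) = br (f x) (f y)) :
    IsNilRep br' (ρ ∘ₗ f) where
  map_br x y := by simp [hf, h.map_br]
  nilpotent := by
    obtain ⟨e, he⟩ := h.nilpotent
    exact ⟨e, le_bot_iff.mp (he ▸ pow_le_pow_left' (LinearMap.range_comp_le_range f ρ) e)⟩

theorem poly_mul_eq (p q : PolyMod K R) : p * q = polyBr (LinearMap.mul K R) p q := by
  induction p using TensorProduct.induction_on with
  | zero => simp
  | add p p' hp hp' => rw [add_mul, hp, hp', map_add, LinearMap.add_apply]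
  | tmul f x =>
    induction q using TensorProduct.induction_on with
    | zero => simp
    | add q q' hq hq' => rw [mul_add, hq, hq', map_add]
    | tmul g y => simp

theorem polyD_mul (p q : PolyMod K R) :
    polyD K R (p * q) = polyD K R p * q + p * polyD K R q := by
  simp only [poly_mul_eq, polyD_polyBr]

variable (R) in
/-- The value at `c`, as a homomorphism of algebras. -/
noncomputable def polyEvalAlg (c : K) : PolyMod K R →ₐ[K] R :=
  AlgHom.ofLinearMap (polyEval c) (by simp [Algebra.TensorProduct.one_def])
    (fun p q => by rw [poly_mul_eq, polyEval_polyBr]; rfl)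

/-- The `n`-th power has its coefficients in the `n`-th power of the range of `ρ`. Nilpotency of the
whole image, not just of each operator, is what makes this work. -/
theorem IsNilRep.poly_isNilpotent (h : IsNilRep br ρ) (p : PolyMod K V) :
    IsNilpotent (polyMap ρ p) := by
  obtain ⟨e, he⟩ := h.nilpotent
  have hmem : polyMap ρ p ∈ polySub (LinearMap.range ρ) := by
    induction p using TensorProduct.induction_on with
    | zero => simp
    | add p q hp hq => rw [map_add]; exact Submodule.add_mem _ hp hq
    | tmul f x => exact tmul_mem_polySub f (LinearMap.mem_range_self ρ x)
  have hpow : ∀ n, polyMap ρ p ^ n ∈ polySub (LinearMap.range ρ ^ n) := by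
    intro n
    induction n with
    | zero => exact tmul_mem_polySub 1 (by rw [pow_zero]; exact Submodule.one_le.mp le_rfl)
    | succ n ih =>
      rw [pow_succ, pow_succ, poly_mul_eq]
      exact polyBr_mem (fun x hx y hy => Submodule.mul_mem_mul hx hy) ih hmem
  have := hpow e
  rw [he, polySub_bot, Submodule.mem_bot] at this
  exact ⟨e, this⟩

theorem IsNilRep.poly_map_br (h : IsNilRep br ρ) (p q : PolyMod K V) :
    polyMap ρ (polyBr br p q) = polyMap ρ p * polyMap ρ q - polyMap ρ q * polyMap ρ p := by
  induction p using TensorProduct.induction_on with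
  | zero => simp
  | add p p' hp hp' => simp only [map_add, LinearMap.add_apply, hp, hp', add_mul, mul_add]; abel
  | tmul f x =>
    induction q using TensorProduct.induction_on with
    | zero => simp
    | add q q' hq hq' => simp only [map_add, hq, hq', add_mul, mul_add]; abel
    | tmul g y => simp [h.map_br, tmul_sub, mul_comm g f]

theorem X_tmul_isNilpotent {r : R} (hr : IsNilpotent r) :
    IsNilpotent (Polynomial.X (R := K) ⊗ₜ[K] r) := by
  obtain ⟨k, hk⟩ := hr
  exact ⟨k, by rw [Algebra.TensorProduct.tmul_pow, hk, tmul_zero]⟩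

variable [CharZero K]

/-- This is `deriv_nexp` for the derivation `d/dX` of `R[X]`: `ρ` turns brackets into commutators,
so the derivative series is the image of `expm`. -/
theorem IsNilRep.polyD_nexp (h : NilFiltration br F) (hρ : IsNilRep br ρ) (p : PolyMod K V) :
    polyD K R (nexp K (polyMap ρ p)) =
      polyMap ρ (expm (polyBr br) p (polyD K V p)) * nexp K (polyMap ρ p) := by
  obtain ⟨k, hk⟩ := deriv_nexp (K := K) (polyD K R) polyD_mul (hρ.poly_isNilpotent p)
  obtain ⟨l, hl⟩ := h.poly.expm_eq_sum
  rw [hk (max k l) (le_max_left _ _), hl (max k l) (le_max_right _ _), map_sum]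
  congr 1
  refine Finset.sum_congr rfl fun n _ => ?_
  rw [map_smul]
  congr 1
  clear * - hρ
  induction n with
  | zero => simp [polyMap_polyD]
  | succ n ih =>
    rw [pow_succ', Module.End.mul_apply, ih, Function.iterate_succ_apply', hρ.poly_map_br,
      comm_apply]

/-- All commutators of `X r` with its derivative `r` vanish, so only the leading term of the series
remains. -/
theorem polyD_nexp_X {r : R} (hr : IsNilpotent r) :
    polyD K R (nexp K (Polynomial.X (R := K) ⊗ₜ[K] r)) =
      nexp K (Polynomial.X (R := K) ⊗ₜ[K] r) * (1 ⊗ₜ r) := by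
  have hX := X_tmul_isNilpotent (K := K) hr
  have hcomm : Commute (Polynomial.X (R := K) ⊗ₜ[K] r) (1 ⊗ₜ r) := by
    simp [Commute, SemiconjBy]
  have hcomm' : Commute (nexp K (Polynomial.X (R := K) ⊗ₜ[K] r)) (1 ⊗ₜ r) := by
    obtain ⟨k, hk⟩ := hX
    rw [nexp_eq_sum hk]
    exact Commute.sum_left _ _ _ fun i _ => (hcomm.pow_left i).smul_left _
  obtain ⟨k, hk⟩ := deriv_nexp (K := K) (polyD K R) polyD_mul hX
  rw [hk (k + 1) (by omega), Finset.sum_range_succ', Finset.sum_eq_zero]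
  · simp only [zero_add, Nat.factorial_one, Nat.cast_one, inv_one, pow_zero, one_smul,
      Module.End.one_apply, polyD_tmul, Polynomial.derivative_X, hcomm'.eq]
  · intro n _
    rw [pow_succ, Module.End.mul_apply, comm_apply, polyD_tmul, Polynomial.derivative_X,
      hcomm.eq, sub_self, map_zero, smul_zero]

/-- If `p` solves `((e^{ad p} - 1) / ad p) p' = b`, then `e^{p(1)} = e^b e^{p(0)}` in every
representation. -/
theorem IsNilRep.nexp_ode (h : NilFiltration br F) (hρ : IsNilRep br ρ) {p : PolyMod K V} {b : V}
    (hp : expm (polyBr br) p (polyD K V p) = 1 ⊗ₜ b) :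
    nexp K (ρ (polyEval 1 p)) = nexp K (ρ b) * nexp K (ρ (polyEval 0 p)) := by
  set E := nexp K (polyMap ρ p) with hE
  set Y := nexp K (Polynomial.X (R := K) ⊗ₜ[K] (-ρ b)) with hY
  have hb := hρ.isNilpotent b
  have hX := X_tmul_isNilpotent (K := K) hb.neg
  -- With `Y = e^{-X ρ(b)}` and `E = e^{ρ(p)}` one has `Y' = -Y ρ(b)` and `E' = ρ(b) E`. Hence `Y E`
  -- is constant, and comparing its values at 0 and 1 gives the claim.
  have hD : polyD K R (Y * E) = 0 := by
    rw [polyD_mul, polyD_nexp_X hb.neg, hρ.polyD_nexp h, hp, LinearMap.lTensor_tmul,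
      mul_assoc, ← mul_add, ← add_mul, ← tmul_add, neg_add_cancel, tmul_zero, zero_mul, mul_zero]
  have hev := polyEval_one_polyInt_polyD (Y * E)
  rw [hD, map_zero, map_zero] at hev
  have hevE : ∀ c : K, polyEval c (Y * E) =
      nexp K (c • -ρ b) * nexp K (ρ (polyEval c p)) := by
    intro c
    change polyEvalAlg R c (Y * E) = _
    rw [map_mul, hY, hE, map_nexp _ hX, map_nexp _ (hρ.poly_isNilpotent p)]
    change nexp K (polyEval c (Polynomial.X ⊗ₜ[K] (-ρ b))) * nexp K (polyEval c (polyMap ρ p)) = _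
    rw [polyEval_tmul, polyMap_polyEval, Polynomial.eval_X]
  have h10 : nexp K (-ρ b) * nexp K (ρ (polyEval 1 p)) = nexp K (ρ (polyEval 0 p)) := by
    have := (sub_eq_zero.mp hev.symm)
    rw [hevE, hevE, one_smul, zero_smul, nexp_zero, one_mul] at this
    exact this
  rw [← h10, ← mul_assoc, nexp_mul_nexp_neg hb, one_mul]

end LieAlgebras

/-! ### Affine representations defined by cocycles -/

section AffineRep

variable {K : Type u} [Field K] {V : Type v} [AddCommGroup V] [Module K V]
  {M : Type w} [AddCommGroup M] [Module K M]

/-- The affine action `a ↦ ((x, c) ↦ (a x + c δ a, 0))` defined by a cocycle `δ`. -/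
def affRep (act : V →ₗ[K] M →ₗ[K] M) (δ : V →ₗ[K] M) : V →ₗ[K] Module.End K (M × K) :=
  LinearMap.mk₂ K (fun a z => (act a z.1 + z.2 • δ a, 0))
    (fun a b z => by ext <;> simp; abel) (fun c a z => by ext <;> simp [smul_comm c])
    (fun a z z' => by ext <;> simp [add_smul]; abel) (fun c a z => by ext <;> simp [mul_smul])

@[simp]
theorem affRep_apply (act : V →ₗ[K] M →ₗ[K] M) (δ : V →ₗ[K] M) (a : V) (z : M × K) :
    affRep act δ a z = (act a z.1 + z.2 • δ a, 0) := rfl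

variable {br : V →ₗ[K] V →ₗ[K] V} {act : V →ₗ[K] M →ₗ[K] M} {δ : V →ₗ[K] M}

/-- The cocycle identity for `δ` is what turns brackets into commutators. Each operator kills the
scalar coordinate of its output, and every further operator raises the filtration, so long products
vanish. -/
theorem isNilRep_affRep (hact : ∀ a b x, act (br a b) x = act a (act b x) - act b (act a x))
    (hδ : ∀ a b, δ (br a b) = act a (δ b) - act b (δ a)) (G : ℕ → Submodule K M)
    (hG1 : ∀ x, x ∈ G 1) (hG : ∀ i a, ∀ x ∈ G i, act a x ∈ G (i + 1)) {e : ℕ} (he : ∀ i, e ≤ i → G i = ⊥) :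
    IsNilRep br (affRep act δ) where
  map_br a b := by
    ext z <;> simp [hact, hδ]
  nilpotent := by
    have key : ∀ n, ∀ T ∈ LinearMap.range (affRep act δ) ^ (n + 1), ∀ z,
        (T z).1 ∈ G (n + 1) ∧ (T z).2 = 0 := by
      intro n
      induction n with
      | zero =>
        intro T hT z
        rw [zero_add, pow_one] at hT
        obtain ⟨a, rfl⟩ := hT
        exact ⟨hG1 _, rfl⟩
      | succ n ih =>
        intro T hT
        rw [pow_succ'] at hT
        refine Submodule.mul_induction_on (C := fun T => ∀ z, (T z).1 ∈ G (n + 1 + 1) ∧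
          (T z).2 = 0) hT ?_ ?_
        · rintro _ ⟨a, rfl⟩ S hS z
          obtain ⟨h1, h2⟩ := ih S hS z
          rw [Module.End.mul_apply, affRep_apply, h2, zero_smul, add_zero]
          exact ⟨hG _ _ _ h1, rfl⟩
        · intro S T hS hT z
          exact ⟨Submodule.add_mem _ (hS z).1 (hT z).1, by simp [(hS z).2, (hT z).2]⟩
    refine ⟨e + 1, (Submodule.eq_bot_iff _).mpr fun T hT => LinearMap.ext fun z => ?_⟩
    obtain ⟨h1, h2⟩ := key e T hT z
    rw [he _ (Nat.le_succ e), Submodule.mem_bot] at h1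
    exact Prod.ext h1 h2

theorem affRep_pow_succ (a : V) (n : ℕ) (z : M × K) :
    (affRep act δ a ^ (n + 1)) z = (((act a)^[n]) (act a z.1 + z.2 • δ a), 0) := by
  induction n with
  | zero => simp
  | succ n ih =>
    rw [pow_succ', Module.End.mul_apply, ih, affRep_apply, Function.iterate_succ_apply']
    simp

/-- After one application the scalar coordinate is 0, so `δ a` enters each power once. With `δ = -d`
and scalar coordinate 1 this is the series of the gauge action, now the exponential of a linear
operator. -/
theorem nexp_affRep [CharZero K] (a : V) (h : IsNilpotent (affRep act δ a)) : ∃ k₀, ∀ k ≥ k₀,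
    ∀ z : M × K, nexp K (affRep act δ a) z = (z.1 + ∑ n ∈ Finset.range k,
      (((n + 1).factorial : ℕ) : K)⁻¹ • ((act a)^[n]) (act a z.1 + z.2 • δ a), z.2) := by
  obtain ⟨k₀, hk₀⟩ := h
  refine ⟨k₀, fun k hk z => ?_⟩
  rw [nexp_eq_sum (k := k + 1) (pow_eq_zero_of_le (by omega) hk₀), Finset.sum_range_succ',
    LinearMap.add_apply, LinearMap.sum_apply]
  simp only [LinearMap.smul_apply, affRep_pow_succ]
  ext
  · simp [Prod.fst_sum, add_comm]
  · simp [Prod.snd_sum]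

end AffineRep

/-! ### Powers of sums in noncommutative rings -/

section Lists

/-- The lists of length `n` with entries in `S`. -/
def listsOf {α : Type*} [DecidableEq α] (S : Finset α) : ℕ → Finset (List α)
  | 0 => {[]}
  | n + 1 => (S ×ˢ listsOf S n).image fun q => q.1 :: q.2

theorem mem_listsOf {α : Type*} [DecidableEq α] {S : Finset α} {n : ℕ} {l : List α} :
    l ∈ listsOf S n ↔ l.length = n ∧ ∀ a ∈ l, a ∈ S := by
  induction n generalizing l with
  | zero =>
    rw [listsOf, Finset.mem_singleton, List.length_eq_zero_iff]
    exact ⟨fun h => ⟨h, by simp [h]⟩, fun h => h.1⟩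
  | succ n ih =>
    rw [listsOf, Finset.mem_image]
    constructor
    · rintro ⟨⟨a, l'⟩, hq, rfl⟩
      rw [Finset.mem_product, ih] at hq
      simpa [hq.2.1] using ⟨hq.1, hq.2.2⟩
    · rintro ⟨hl, hS⟩
      rcases l with _ | ⟨a, l⟩
      · simp at hl
      · exact ⟨(a, l), Finset.mem_product.mpr ⟨hS a (by simp), ih.mpr ⟨by simpa using hl,
          fun b hb => hS b (by simp [hb])⟩⟩, rfl⟩

/-- The expansion of a power of a sum in a noncommutative ring. -/
theorem sum_listsOf {α : Type*} [DecidableEq α] {R : Type*} [Ring R] (S : Finset α) (f : α → R)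
    (n : ℕ) : ∑ l ∈ listsOf S n, (l.map f).prod = (∑ a ∈ S, f a) ^ n := by
  induction n with
  | zero => simp [listsOf]
  | succ n ih =>
    rw [listsOf, Finset.sum_image, Finset.sum_product, pow_succ', Finset.sum_mul]
    · simp only [List.map_cons, List.prod_cons, ← Finset.mul_sum, ih]
    · rintro ⟨a, l⟩ _ ⟨b, m⟩ _ h
      simpa using h

end Lists

/-! ### The words of Dynkin's formula -/

section Words

variable {V : Type v}

/-- The word of `a` (`r_1` times), `b` (`s_1` times), …, `a` (`r_n` times), `b` (`s_n` times). -/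
def dynkinWord (a b : V) (l : List (ℕ × ℕ)) : List V :=
  l.flatMap fun p => List.replicate p.1 a ++ List.replicate p.2 b

theorem dynkinWord_length (a b : V) (l : List (ℕ × ℕ)) :
    (dynkinWord a b l).length = (l.map fun p => p.1 + p.2).sum := length_flatMap_replicate a b l

theorem mem_dynkinWord {a b x : V} {l : List (ℕ × ℕ)} (hx : x ∈ dynkinWord a b l) :
    x = a ∨ x = b := by
  simp only [dynkinWord, List.mem_flatMap, List.mem_append, List.mem_replicate] at hx
  obtain ⟨p, -, h | h⟩ := hx
  · exact Or.inl h.2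
  · exact Or.inr h.2

theorem dynkinWord_ne_nil {a b : V} {l : List (ℕ × ℕ)} (hl : l ≠ []) (h : ∀ p ∈ l, p ≠ (0, 0)) :
    dynkinWord a b l ≠ [] := by
  rcases l with _ | ⟨⟨r, s⟩, l⟩
  · exact absurd rfl hl
  · have := h (r, s) (by simp)
    simp only [ne_eq, Prod.mk.injEq, not_and] at this
    simp only [dynkinWord, List.flatMap_cons, ne_eq, List.append_eq_nil_iff,
      List.replicate_eq_nil_iff]
    tauto

theorem prod_map_dynkinWord {R : Type w} [Ring R] (f : V → R) (a b : V) (l : List (ℕ × ℕ)) :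
    ((dynkinWord a b l).map f).prod = (l.map fun p => f a ^ p.1 * f b ^ p.2).prod := by
  induction l with
  | nil => rfl
  | cons p l ih =>
    rw [List.map_cons, List.prod_cons, ← ih]
    simp [dynkinWord, mul_assoc]

end Words

/-! ### Dynkin's theorem -/

section Dynkin

variable {K : Type u} [Field K] {V : Type v} [AddCommGroup V] [Module K V]
  {br : V →ₗ[K] V →ₗ[K] V} {F : ℕ → Submodule K V}

/-- The coefficient of Dynkin's formula before the division by the degree. -/
def dynkinCoeff (K : Type u) [Field K] (l : List (ℕ × ℕ)) : K :=
  (l.map fun p => ((p.1.factorial * p.2.factorial : ℕ) : K)⁻¹).prod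

theorem dynkinTerm_eq (a b : V) {l : List (ℕ × ℕ)} (hl : l ≠ []) (h : ∀ p ∈ l, p ≠ (0, 0)) :
    dynkinTerm br a b l = ((-1 : K) ^ (l.length + 1) / (l.length : K) *
      (((dynkinWord a b l).length : ℕ) : K)⁻¹ * dynkinCoeff K l) •
        nested br (dynkinWord a b l) := by
  rw [dynkinTerm, if_pos ⟨hl, h⟩, dynkinWord_length]
  rfl

/-- The expansion of `(e^A e^B - 1)^n`. -/
theorem pow_exp_mul_exp [CharZero K] {R : Type w} [Ring R] [Algebra K R] {A B : R} {k : ℕ}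
    (hA : A ^ (k + 1) = 0) (hB : B ^ (k + 1) = 0) (n : ℕ) :
    (nexp K A * nexp K B - 1) ^ n =
      ∑ l ∈ listsOf ((Finset.range (k + 1) ×ˢ Finset.range (k + 1)).erase (0, 0)) n,
        dynkinCoeff K l • (l.map fun p => A ^ p.1 * B ^ p.2).prod := by
  have h1 : nexp K A * nexp K B - 1 =
      ∑ p ∈ (Finset.range (k + 1) ×ˢ Finset.range (k + 1)).erase (0, 0),
        ((p.1.factorial * p.2.factorial : ℕ) : K)⁻¹ • (A ^ p.1 * B ^ p.2) := by
    rw [nexp_eq_sum hA, nexp_eq_sum hB, Finset.sum_mul_sum, ← Finset.sum_product',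
      ← Finset.add_sum_erase _ _ (a := (0, 0)) (by simp)]
    simp only [Nat.factorial_zero, Nat.cast_one, inv_one, pow_zero, one_smul, mul_one,
      add_sub_cancel_left]
    refine Finset.sum_congr rfl fun p _ => ?_
    rw [smul_mul_smul_comm, Nat.cast_mul, mul_inv]
  rw [h1, ← sum_listsOf]
  refine Finset.sum_congr rfl fun l _ => ?_
  clear * -
  induction l with
  | nil => simp [dynkinCoeff]
  | cons p l ih =>
    rw [List.map_cons, List.prod_cons, ih, smul_mul_smul_comm]
    simp [dynkinCoeff]

/-- Iterated application of affine operators whose cocycle fixes the letters. -/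
theorem affRep_word {δ : V →ₗ[K] V} {l : List V} (hl : l ≠ []) (h : ∀ x ∈ l, δ x = x) :
    (l.map (affRep br δ)).prod (0, 1) = (nested br l, 0) := by
  induction l with
  | nil => exact absurd rfl hl
  | cons x l ih =>
    -- The last letter acts first: it sends `(0, 1)` to `(δ x, 0) = (x, 0)`. The scalar is then 0,
    -- and the remaining letters act by brackets only, nested to the right.
    rcases l with _ | ⟨y, l⟩
    · simp [nested, h x]
    · rw [List.map_cons, List.prod_cons, Module.End.mul_apply, ih (by simp)
        fun z hz => h z (List.mem_cons_of_mem _ hz), affRep_apply]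
      simp [nested]

/-- A derivation fixing the letters counts them. The factor is the length of the word, which cancels
the denominator in Dynkin's formula. -/
theorem derivation_nested {δ : V →ₗ[K] V} (hδ : ∀ x y, δ (br x y) = br (δ x) y + br x (δ y)) :
    ∀ l : List V, (∀ x ∈ l, δ x = x) → δ (nested br l) = (l.length : K) • nested br l
  | [], _ => by simp [nested]
  | [x], h => by simp [nested, h x]
  | x :: y :: l, h => by
    rw [nested, hδ, derivation_nested hδ (y :: l) fun z hz => h z (List.mem_cons_of_mem _ hz),
      h x (by simp), map_smul]
    simp only [List.length_cons, Nat.cast_add, Nat.cast_one]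
    module

theorem NilFiltration.bch_eq_sum (h : NilFiltration br F) (a b : V) : ∃ k₀, ∀ k ≥ k₀,
    bch br a b = ∑ n ∈ Finset.range k,
      ∑ l ∈ listsOf ((Finset.range k ×ˢ Finset.range k).erase (0, 0)) n,
        dynkinTerm br a b l := by
  have hfin := h.finite_dynkin a b
  -- A bound exceeding the length and every exponent of a list, so that the finite support of the
  -- series is covered by one box.
  set N : List (ℕ × ℕ) → ℕ := fun l => l.length + (l.map fun p => p.1 + p.2).sum + 1
  refine ⟨hfin.toFinset.sup N, fun k hk => ?_⟩
  rw [← Finset.sum_biUnion]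
  · refine finsum_eq_sum_of_support_subset _ fun l hl => ?_
    have hN : l.length + (l.map fun p => p.1 + p.2).sum + 1 ≤ k := (Finset.le_sup (f := N) (hfin.mem_toFinset.mpr hl)).trans hk
    have hl' : l ≠ [] ∧ ∀ p ∈ l, p ≠ (0, 0) := by
      by_contra hc
      exact hl (if_neg hc)
    simp only [Finset.coe_biUnion, Set.mem_iUnion, Finset.mem_coe, mem_listsOf, exists_prop]
    refine ⟨l.length, Finset.mem_range.mpr (by omega), rfl, fun p hp => ?_⟩
    have h1 := List.single_le_sum (l := l.map fun p => p.1 + p.2) (by simp) _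
      (List.mem_map_of_mem hp)
    simp only [Finset.mem_erase, Finset.mem_product, Finset.mem_range]
    exact ⟨hl'.2 p hp, by omega, by omega⟩
  · intro m _ n _ hmn
    refine Finset.disjoint_left.mpr fun l hm hn => hmn ?_
    rw [← (mem_listsOf.mp hm).1, (mem_listsOf.mp hn).1]

/-- Dynkin's theorem: if `e^A e^B` is the exponential of an element `z` in the affine
representation of a derivation `δ` which fixes `a` and `b`, then `δ z = δ (a • b)`. -/
theorem NilFiltration.derivation_bch [CharZero K] (h : NilFiltration br F) {δ : V →ₗ[K] V}
    (hδ : ∀ x y, δ (br x y) = br (δ x) y + br x (δ y)) (hnil : IsNilRep br (affRep br δ))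
    {a b z : V} (ha : δ a = a) (hb : δ b = b)
    (hz : nexp K (affRep br δ z) = nexp K (affRep br δ a) * nexp K (affRep br δ b)) :
    δ z = δ (bch br a b) := by
  obtain ⟨k₀, hk₀⟩ := h.bch_eq_sum a b
  obtain ⟨k₁, hk₁⟩ := hnil.isNilpotent a
  obtain ⟨k₂, hk₂⟩ := hnil.isNilpotent b
  obtain ⟨k₃, hk₃⟩ := hnil.isNilpotent z
  set k := k₀ + k₁ + k₂ + k₃ + 1 with hk
  -- In the affine representation, `z` is recovered as the logarithm of `e^a e^b`, and `δ z` as the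
  -- vector obtained by applying it to `(0, 1)`.
  have hlog := LinearMap.congr_fun (log_nexp (K := K) (pow_eq_zero_of_le (show k₃ ≤ k by omega) hk₃))
    (0, 1)
  rw [hz] at hlog
  have h1 : δ z = (affRep br δ z (0, 1)).1 := by simp
  rw [h1, ← hlog, hk₀ k (by omega), LinearMap.sum_apply, Prod.fst_sum, map_sum]
  refine Finset.sum_congr rfl fun n _ => ?_
  rw [LinearMap.smul_apply, pow_exp_mul_exp (k := k₀ + k₁ + k₂ + k₃)
    (pow_eq_zero_of_le (by omega) hk₁) (pow_eq_zero_of_le (by omega) hk₂), ← hk, LinearMap.sum_apply, Prod.smul_fst, Prod.fst_sum,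
    map_sum, Finset.smul_sum]
  refine Finset.sum_congr rfl fun l hl => ?_
  obtain ⟨hlen, hmem⟩ := mem_listsOf.mp hl
  -- The empty list occurs only for `n = 0`, where the coefficient is a division by zero, hence 0.
  rcases eq_or_ne l [] with rfl | hne
  · have : n = 0 := by simpa using hlen.symm
    simp [this, dynkinTerm]
  · have hl0 : ∀ p ∈ l, p ≠ (0, 0) := fun p hp => (Finset.mem_erase.mp (hmem p hp)).1
    have hw := dynkinWord_ne_nil (a := a) (b := b) hne hl0
    have hfix : ∀ x ∈ dynkinWord a b l, δ x = x := fun x hx => by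
      rcases mem_dynkinWord hx with rfl | rfl <;> assumption
    -- One side has the nested bracket of the word from its affine action; the other has `δ` of
    -- Dynkin's term, whose factor `1 / length` is cancelled by the count of letters.
    rw [dynkinTerm_eq a b hne hl0, map_smul, derivation_nested hδ _ hfix, LinearMap.smul_apply,
      ← prod_map_dynkinWord, affRep_word hw hfix, Prod.smul_fst, smul_smul, smul_smul, hlen]
    congr 1
    have : ((dynkinWord a b l).length : K) ≠ 0 := by
      exact_mod_cast (List.length_pos_iff.mpr hw).ne'
    field_simp

end Dynkin

/-! ### The Euler derivation, the Baker-Campbell-Hausdorff formula and the group laws -/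

section Euler

open Polynomial

variable {K : Type u} [Field K] {V : Type v} [AddCommGroup V] [Module K V]

variable (K V) in
/-- The derivation `X d/dX`. -/
noncomputable def polyEuler : PolyMod K V →ₗ[K] PolyMod K V :=
  (LinearMap.mulLeft K (X : K[X])).rTensor V ∘ₗ polyD K V

theorem polyEuler_tmul (f : K[X]) (x : V) :
    polyEuler K V (f ⊗ₜ x) = (X * derivative f) ⊗ₜ x := by simp [polyEuler]

theorem polyEuler_X (x : V) : polyEuler K V (X ⊗ₜ x) = X ⊗ₜ x := by simp [polyEuler_tmul]

theorem polyEuler_polyBr (br : V →ₗ[K] V →ₗ[K] V) (p q : PolyMod K V) :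
    polyEuler K V (polyBr br p q) =
      polyBr br (polyEuler K V p) q + polyBr br p (polyEuler K V q) := by
  induction p using TensorProduct.induction_on with
  | zero => simp
  | add p p' hp hp' => simp only [map_add, LinearMap.add_apply, hp, hp']; abel
  | tmul f x =>
    induction q using TensorProduct.induction_on with
    | zero => simp
    | add q q' hq hq' => simp only [map_add, hq, hq']; abel
    | tmul g y =>
      simp only [polyEuler_tmul, polyBr_tmul, derivative_mul, ← add_tmul]
      congr 1
      ring

/-- A polynomial is determined by its image under `X d/dX` and its value at `0`. -/
theorem polyMod_ext_euler [CharZero K] {p q : PolyMod K V}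
    (h : polyEuler K V p = polyEuler K V q) (h0 : polyEval 0 p = polyEval 0 q) : p = q := by
  refine polyMod_ext ?_ h0
  exact Module.Flat.rTensor_preserves_injective_linearMap _
    (fun f g hfg => mul_left_cancel₀ X_ne_zero hfg) h

variable {br : V →ₗ[K] V →ₗ[K] V} {F : ℕ → Submodule K V}

/-- A derivation is a cocycle for the adjoint action. Since `X d/dX` kills only constants, this
representation separates polynomials with the same value at 0. -/
theorem NilLie.isNilRep_euler (h : NilLie br F) :
    IsNilRep (R := Module.End K (PolyMod K V × K)) (polyBr br)
      (affRep (polyBr br) (polyEuler K V)) := by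
  have hp := h.poly
  obtain ⟨e, he⟩ := hp.bot
  refine isNilRep_affRep (fun a b x => ?_) (fun a b => ?_) _ hp.one
    (fun i a x hx => ?_) he
  · rw [hp.jacobi a b x]; abel
  · rw [polyEuler_polyBr, hp.skew (polyEuler K V a)]; abel
  · have := hp.bracket 1 i a (hp.one a) x hx
    rwa [add_comm] at this

/-- Naturality of the series under the zero map. -/
theorem NilFiltration.bch_zero_zero (h : NilFiltration br F) : bch br 0 0 = 0 := by
  have := h.map_bch (br' := br) (0 : V →ₗ[K] V) (by simp) 0 0
  simpa using this.symm

variable [CharZero K]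

/-- The exponential of the affine representation determines a polynomial with a given value
at `0`. -/
theorem NilLie.eq_of_nexp_euler (h : NilLie br F) {p q : PolyMod K V}
    (h0 : polyEval 0 p = polyEval 0 q)
    (hpq : nexp K (affRep (polyBr br) (polyEuler K V) p) =
      nexp K (affRep (polyBr br) (polyEuler K V) q)) : p = q := by
  have := nexp_injective (h.isNilRep_euler.isNilpotent p) (h.isNilRep_euler.isNilpotent q) hpq
  refine polyMod_ext_euler ?_ h0
  simpa using congrArg Prod.fst (LinearMap.congr_fun this (0, 1))

/-- The Baker-Campbell-Hausdorff formula: `e^{a • b} = e^a e^b` in every nilpotent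
representation. -/
theorem NilLie.nexp_bch (h : NilLie br F) {R : Type w} [Ring R] [Algebra K R] {ρ : V →ₗ[K] R}
    (hρ : IsNilRep br ρ) (a b : V) : nexp K (ρ (bch br a b)) = nexp K (ρ a) * nexp K (ρ b) := by
  have hp := h.poly
  -- There are two polynomial variables: the inner `X` marks degree, and the outer one is the time
  -- of the differential equation. The path `ζ` starts at `Xb`, and its endpoint has exponential
  -- `e^{Xa} e^{Xb}` in every nilpotent representation.
  obtain ⟨ζ, ⟨hζ0, hζ⟩, -⟩ := hp.existsUnique_ode hp.antitone (X ⊗ₜ b) (1 ⊗ₜ (X ⊗ₜ a))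
  have hz : polyEval 1 ζ = bch (polyBr br) (X ⊗ₜ a) (X ⊗ₜ b) := by
    refine polyMod_ext_euler ?_ ?_
    · refine hp.derivation_bch (polyEuler_polyBr br) h.isNilRep_euler (polyEuler_X a)
        (polyEuler_X b) ?_
      rw [h.isNilRep_euler.nexp_ode hp.toNilFiltration hζ, hζ0]
    · rw [hp.map_bch (polyEval 0) (polyEval_polyBr br 0)]
      simp only [polyEval_tmul, eval_X, zero_smul, h.bch_zero_zero]
      rw [← polyMap_polyEval (polyEval 0) 1 ζ]
      -- At `X = 0` the right-hand side of the equation vanishes, so the path is constant and stays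
      -- at its initial value 0.
      have hD : polyD K V (polyMap (polyEval 0) ζ) = 0 := by
        refine h.poly.eq_zero_of_expm h.poly.antitone (a := polyMap (polyEval 0) ζ) ?_
        rw [← polyMap_polyD, ← hp.poly.map_expm h.poly.toNilFiltration (polyMap (polyEval 0))
          (fun x => polyMap_polyBr _ (polyEval_polyBr br 0) _ _), hζ]
        simp
      have h10 := polyEval_one_polyInt_polyD (polyMap (polyEval 0) ζ)
      rw [hD, map_zero, map_zero, polyMap_polyEval _ 0, hζ0] at h10
      simpa using h10.symm
  -- The given representation is pulled back along `X = 1`, which turns `Xa` and `Xb` into `a` and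
  -- `b`.
  have hρ' := hρ.comp (polyEval 1) (polyEval_polyBr br 1)
  have key := hρ'.nexp_ode hp.toNilFiltration hζ
  rw [hζ0, hz] at key
  simpa [hp.map_bch (polyEval 1) (polyEval_polyBr br 1)] using key

/-- An identity in the group `exp V` may be checked in the affine representation of the
polynomials. -/
theorem NilLie.eq_of_forall_nexp (h : NilLie br F) {p q : PolyMod K V}
    (h0 : polyEval 0 p = polyEval 0 q)
    (hpq : ∀ ρ : PolyMod K V →ₗ[K] Module.End K (PolyMod K V × K),
      IsNilRep (R := Module.End K (PolyMod K V × K)) (polyBr br) ρ → nexp K (ρ p) = nexp K (ρ q)) : polyEval 1 p = polyEval 1 q := by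
  rw [h.eq_of_nexp_euler h0 (hpq _ h.isNilRep_euler)]

/-- Like the other group laws below, this is checked with `Xa` in place of `a`, where the
representations separate the two sides, and then specialized at `X = 1`. -/
theorem NilLie.bch_zero (h : NilLie br F) (a : V) : bch br a 0 = a := by
  have hp := h.poly
  have := h.eq_of_forall_nexp (p := bch (polyBr br) (X ⊗ₜ a) 0) (q := X ⊗ₜ a) ?_ ?_
  · simpa [hp.map_bch (polyEval 1) (polyEval_polyBr br 1)] using this
  · simp [hp.map_bch (polyEval 0) (polyEval_polyBr br 0), h.bch_zero_zero]
  · intro ρ hρ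
    rw [hp.nexp_bch hρ, map_zero, nexp_zero, mul_one]

theorem NilLie.zero_bch (h : NilLie br F) (a : V) : bch br 0 a = a := by
  have hp := h.poly
  have := h.eq_of_forall_nexp (p := bch (polyBr br) 0 (X ⊗ₜ a)) (q := X ⊗ₜ a) ?_ ?_
  · simpa [hp.map_bch (polyEval 1) (polyEval_polyBr br 1)] using this
  · simp [hp.map_bch (polyEval 0) (polyEval_polyBr br 0), h.bch_zero_zero]
  · intro ρ hρ
    rw [hp.nexp_bch hρ, map_zero, nexp_zero, one_mul]

theorem NilLie.neg_bch (h : NilLie br F) (a : V) : bch br (-a) a = 0 := by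
  have hp := h.poly
  have := h.eq_of_forall_nexp (p := bch (polyBr br) (-(X ⊗ₜ a)) (X ⊗ₜ a)) (q := 0) ?_ ?_
  · simpa [hp.map_bch (polyEval 1) (polyEval_polyBr br 1)] using this
  · simp [hp.map_bch (polyEval 0) (polyEval_polyBr br 0), h.bch_zero_zero]
  · intro ρ hρ
    rw [hp.nexp_bch hρ, map_zero, nexp_zero, map_neg, nexp_neg_mul_nexp (hρ.isNilpotent _)]

theorem NilLie.bch_assoc (h : NilLie br F) (a b c : V) :
    bch br (bch br a b) c = bch br a (bch br b c) := by
  have hp := h.poly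
  have := h.eq_of_forall_nexp
    (p := bch (polyBr br) (bch (polyBr br) (X ⊗ₜ a) (X ⊗ₜ b)) (X ⊗ₜ c))
    (q := bch (polyBr br) (X ⊗ₜ a) (bch (polyBr br) (X ⊗ₜ b) (X ⊗ₜ c))) ?_ ?_
  · simpa [hp.map_bch (polyEval 1) (polyEval_polyBr br 1)] using this
  · simp [hp.map_bch (polyEval 0) (polyEval_polyBr br 0), h.bch_zero_zero]
  · intro ρ hρ
    simp only [hp.nexp_bch hρ, mul_assoc]

end Euler

/-- The exponential of a nilpotent derivation of a bilinear map is an automorphism. -/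
theorem nexp_bilinear {K : Type u} [Field K] [CharZero K] {M : Type v} {N : Type w}
    [AddCommGroup M] [Module K M] [AddCommGroup N] [Module K N] {D : Module.End K M}
    {T : Module.End K N} (hD : IsNilpotent D) (hT : IsNilpotent T) (B : M →ₗ[K] M →ₗ[K] N)
    (h : ∀ z w, B (D z) w + B z (D w) = T (B z w)) (z w : M) :
    B (nexp K D z) (nexp K D w) = nexp K T (B z w) := by
  set r := Module.End.rTensorAlgHom K M M
  set l := Module.End.lTensorAlgHom K M M
  have hr : ∀ (S : Module.End K M) z w, r S (z ⊗ₜ w) = S z ⊗ₜ w := fun _ _ _ => rfl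
  have hl : ∀ (S : Module.End K M) z w, l S (z ⊗ₜ w) = z ⊗ₜ S w := fun _ _ _ => rfl
  have hcomm : Commute (r D) (l D) := TensorProduct.ext' fun x y => by
    simp only [Module.End.mul_apply, hr, hl]
  -- The hypothesis says that the map on `M ⊗ M` induced by `B` intertwines `D ⊗ 1 + 1 ⊗ D` with
  -- `T`. The two summands commute, so the exponential of their sum is `e^D ⊗ e^D`.
  have key := nexp_intertwine (K := K) (hcomm.isNilpotent_add (hD.map r) (hD.map l)) hT
    (TensorProduct.lift B) (fun t => by
      induction t using TensorProduct.induction_on with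
      | zero => simp
      | add s t hs ht => simp only [map_add, hs, ht]
      | tmul z w =>
        rw [TensorProduct.lift.tmul, ← h, LinearMap.add_apply, hr, hl, map_add,
          TensorProduct.lift.tmul, TensorProduct.lift.tmul]) (z ⊗ₜ w)
  rwa [nexp_add hcomm (hD.map r) (hD.map l), ← map_nexp _ hD, ← map_nexp _ hD,
    Module.End.mul_apply, hl, hr, TensorProduct.lift.tmul, TensorProduct.lift.tmul] at key

/-! ### The algebra `L ⊗ 𝔪_A`, the gauge action and the Maurer-Cartan equation -/

section Extension

variable {K : Type u} [Field K] (L : DGLA.{u, v} K) (A : ArtAlg.{u} K)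

variable {L A} in
theorem DGLA.tmul_mem_extGr {i : ℤ} {y : L.carrier} (hy : y ∈ L.gr i) (a : A.max) :
    y ⊗ₜ a ∈ L.extGr A i := ⟨(⟨y, hy⟩ : L.gr i) ⊗ₜ a, rfl⟩

variable {L A} in
theorem DGLA.extGr_ind {i : ℤ} {P : L.ext A → Prop} (h0 : P 0)
    (hadd : ∀ x y, P x → P y → P (x + y)) (h : ∀ y ∈ L.gr i, ∀ a : A.max, P (y ⊗ₜ a)) {x}
    (hx : x ∈ L.extGr A i) : P x := by
  obtain ⟨z, rfl⟩ := hx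
  induction z using TensorProduct.induction_on with
  | zero => simpa using h0
  | add x y hx hy => rw [map_add]; exact hadd _ _ hx hy
  | tmul y a => exact h y y.2 a

theorem DGLA.extBr_tmul (x y : L.carrier) (a b : A.max) :
    L.extBr A (x ⊗ₜ a) (y ⊗ₜ b) = L.bracket x y ⊗ₜ A.maxMul a b := rfl

theorem DGLA.extD_tmul (x : L.carrier) (a : A.max) : L.extD A (x ⊗ₜ a) = L.d x ⊗ₜ a := rfl

theorem ArtAlg.maxMul_comm (a b : A.max) : A.maxMul a b = A.maxMul b a :=
  Subtype.ext (mul_comm (a : A.carrier) b)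

theorem ArtAlg.maxMul_left_comm (a b c : A.max) :
    A.maxMul a (A.maxMul b c) = A.maxMul b (A.maxMul a c) :=
  Subtype.ext (mul_left_comm (a : A.carrier) b c)

theorem ArtAlg.maxMul_assoc (a b c : A.max) :
    A.maxMul (A.maxMul a b) c = A.maxMul a (A.maxMul b c) :=
  Subtype.ext (mul_assoc (a : A.carrier) b c)

variable {L A}

theorem DGLA.extD_mem {i : ℤ} {x : L.ext A} (hx : x ∈ L.extGr A i) :
    L.extD A x ∈ L.extGr A (i + 1) :=
  DGLA.extGr_ind (P := fun x => L.extD A x ∈ L.extGr A (i + 1)) (by simp)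
    (fun x y hx hy => by rw [map_add]; exact Submodule.add_mem _ hx hy)
    (fun y hy a => DGLA.tmul_mem_extGr (L.d_mem i y hy) a) hx

theorem DGLA.extBr_mem {i j : ℤ} {x y : L.ext A} (hx : x ∈ L.extGr A i) (hy : y ∈ L.extGr A j) :
    L.extBr A x y ∈ L.extGr A (i + j) := by
  refine DGLA.extGr_ind (P := fun x => L.extBr A x y ∈ L.extGr A (i + j)) (by simp)
    (fun x y hx hy => by rw [map_add]; exact Submodule.add_mem _ hx hy) (fun x hx a => ?_) hx
  exact DGLA.extGr_ind (P := fun y => L.extBr A (x ⊗ₜ a) y ∈ L.extGr A (i + j)) (by simp)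
    (fun x y hx hy => by rw [map_add]; exact Submodule.add_mem _ hx hy)
    (fun y hy b => DGLA.tmul_mem_extGr (L.bracket_mem i j x hx y hy) _) hy

theorem DGLA.extD_extD (x : L.ext A) : L.extD A (L.extD A x) = 0 := by
  induction x using TensorProduct.induction_on with
  | zero => simp
  | add x y hx hy => rw [map_add, map_add, hx, hy, add_zero]
  | tmul x a => rw [DGLA.extD_tmul, DGLA.extD_tmul, L.d_d, zero_tmul]

theorem DGLA.ext_skew {i j : ℤ} {x y : L.ext A} (hx : x ∈ L.extGr A i) (hy : y ∈ L.extGr A j) :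
    L.extBr A x y = -((-1 : K) ^ (i * j) • L.extBr A y x) := by
  refine DGLA.extGr_ind (P := fun x => L.extBr A x y = -((-1 : K) ^ (i * j) • L.extBr A y x))
    (by simp) (fun x y hx hy => by simp only [map_add, LinearMap.add_apply, hx, hy]; module)
    (fun x hx a => ?_) hx
  refine DGLA.extGr_ind (P := fun y => L.extBr A (x ⊗ₜ a) y =
    -((-1 : K) ^ (i * j) • L.extBr A y (x ⊗ₜ a))) (by simp)
    (fun x y hx hy => by simp only [map_add, LinearMap.add_apply, hx, hy]; module)
    (fun y hy b => ?_) hy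
  rw [DGLA.extBr_tmul, DGLA.extBr_tmul, L.skew i j x hx y hy, A.maxMul_comm a, neg_tmul,
    smul_tmul']

theorem DGLA.ext_jacobi {i j : ℤ} {x y : L.ext A} (hx : x ∈ L.extGr A i)
    (hy : y ∈ L.extGr A j) (z : L.ext A) : L.extBr A x (L.extBr A y z) =
      L.extBr A (L.extBr A x y) z + (-1 : K) ^ (i * j) • L.extBr A y (L.extBr A x z) := by
  refine DGLA.extGr_ind (P := fun x => L.extBr A x (L.extBr A y z) =
      L.extBr A (L.extBr A x y) z + (-1 : K) ^ (i * j) • L.extBr A y (L.extBr A x z))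
    (by simp) (fun x y hx hy => by simp only [map_add, LinearMap.add_apply, hx, hy]; module)
    (fun x hx a => ?_) hx
  refine DGLA.extGr_ind (P := fun y => L.extBr A (x ⊗ₜ a) (L.extBr A y z) =
      L.extBr A (L.extBr A (x ⊗ₜ a) y) z +
        (-1 : K) ^ (i * j) • L.extBr A y (L.extBr A (x ⊗ₜ a) z)) (by simp)
    (fun x y hx hy => by simp only [map_add, LinearMap.add_apply, hx, hy]; module)
    (fun y hy b => ?_) hy
  induction z using TensorProduct.induction_on with
  | zero => simp
  | add z w hz hw => simp only [map_add, hz, hw]; module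
  | tmul z c =>
    simp only [DGLA.extBr_tmul]
    rw [L.jacobi i j x hx y hy z, add_tmul, A.maxMul_assoc, A.maxMul_left_comm b, smul_tmul']

theorem DGLA.ext_leibniz {i : ℤ} {x : L.ext A} (hx : x ∈ L.extGr A i) (y : L.ext A) :
    L.extD A (L.extBr A x y) =
      L.extBr A (L.extD A x) y + (-1 : K) ^ i • L.extBr A x (L.extD A y) := by
  refine DGLA.extGr_ind (P := fun x => L.extD A (L.extBr A x y) =
      L.extBr A (L.extD A x) y + (-1 : K) ^ i • L.extBr A x (L.extD A y))
    (by simp) (fun x y hx hy => by simp only [map_add, LinearMap.add_apply, hx, hy]; module)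
    (fun x hx a => ?_) hx
  induction y using TensorProduct.induction_on with
  | zero => simp
  | add z w hz hw => simp only [map_add, hz, hw]; module
  | tmul y b =>
    simp only [DGLA.extBr_tmul, DGLA.extD_tmul]
    rw [L.leibniz i x hx y, add_tmul, smul_tmul']

variable (L A)

theorem DGLA.extFil_antitone : Antitone (L.extFil A) := by
  intro i j hij
  refine Submodule.span_mono ?_
  rintro _ ⟨x, a, ha, rfl⟩
  exact ⟨x, a, Ideal.pow_le_pow_right hij ha, rfl⟩

/-- The bracket of `L^0 ⊗ 𝔪_A`. -/
noncomputable def DGLA.zeroBr :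
    L.extGr A 0 →ₗ[K] L.extGr A 0 →ₗ[K] L.extGr A 0 :=
  LinearMap.mk₂ K (fun x y => ⟨L.extBr A x y, by
      have := DGLA.extBr_mem x.2 y.2; rwa [add_zero] at this⟩)
    (fun x y z => Subtype.ext (by simp)) (fun c x y => Subtype.ext (by simp))
    (fun x y z => Subtype.ext (by simp)) (fun c x y => Subtype.ext (by simp))

/-- In degree 0 all signs are trivial, leaving an ordinary Lie algebra, nilpotent along the powers
of `𝔪_A`. -/
theorem DGLA.nilLie_zeroBr : NilLie (L.zeroBr A)
    fun i => (L.extFil A i).comap (L.extGr A 0).subtype where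
  one x := (L.nilFiltration A).one x
  bracket i j x hx y hy := (L.nilFiltration A).bracket i j x hx y hy
  bot := by
    obtain ⟨e, he⟩ := (L.nilFiltration A).bot
    exact ⟨e, fun i hi => by
      rw [he i hi, Submodule.comap_bot, LinearMap.ker_eq_bot]
      exact Subtype.val_injective⟩
  antitone i j hij x hx := L.extFil_antitone A hij hx
  skew x y := Subtype.ext (by
    have := DGLA.ext_skew x.2 y.2
    rwa [mul_zero, zpow_zero, one_smul] at this)
  jacobi x y z := Subtype.ext (by
    have := DGLA.ext_jacobi x.2 y.2 z.1
    rwa [mul_zero, zpow_zero, one_smul] at this)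

/-- The action of `L^0 ⊗ 𝔪_A` on `L^1 ⊗ 𝔪_A`. -/
noncomputable def DGLA.oneAct :
    L.extGr A 0 →ₗ[K] L.extGr A 1 →ₗ[K] L.extGr A 1 :=
  LinearMap.mk₂ K (fun x y => ⟨L.extBr A x y, by
      have := DGLA.extBr_mem x.2 y.2; rwa [zero_add] at this⟩)
    (fun x y z => Subtype.ext (by simp)) (fun c x y => Subtype.ext (by simp))
    (fun x y z => Subtype.ext (by simp)) (fun c x y => Subtype.ext (by simp))

/-- The map `a ↦ -d a` on `L^0 ⊗ 𝔪_A`. -/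
noncomputable def DGLA.negD : L.extGr A 0 →ₗ[K] L.extGr A 1 :=
  ((-L.extD A).comp (L.extGr A 0).subtype).codRestrict _ fun x =>
    Submodule.neg_mem _ (by have := DGLA.extD_mem x.2; rwa [zero_add] at this)

/-- The affine action whose exponential is the gauge action. -/
noncomputable def DGLA.gaugeRep : L.extGr A 0 →ₗ[K] Module.End K (L.extGr A 1 × K) :=
  affRep (L.oneAct A) (L.negD A)

/-- The Leibniz rule makes `-d` a cocycle with values in `L^1 ⊗ 𝔪_A`; the sign that appears is
antisymmetry between degrees 1 and 0. -/
theorem DGLA.isNilRep_gaugeRep :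
    IsNilRep (R := Module.End K (L.extGr A 1 × K)) (L.zeroBr A) (L.gaugeRep A) := by
  obtain ⟨e, he⟩ := (L.nilFiltration A).bot
  refine isNilRep_affRep (fun a b x => Subtype.ext ?_) (fun a b => Subtype.ext ?_)
    (fun i => (L.extFil A i).comap (L.extGr A 1).subtype) (fun x => (L.nilFiltration A).one x)
    (fun i a x hx => ?_) (e := e) (fun i hi => ?_)
  · have := DGLA.ext_jacobi a.2 b.2 x.1
    rw [mul_zero, zpow_zero, one_smul] at this
    exact eq_sub_of_add_eq this.symm
  · have h1 := DGLA.ext_leibniz a.2 b.1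
    rw [zpow_zero, one_smul] at h1
    have h2 := DGLA.ext_skew (DGLA.extD_mem a.2) b.2
    rw [mul_zero, zpow_zero, one_smul] at h2
    change -L.extD A (L.extBr A a b) =
      L.extBr A a (-L.extD A b) - L.extBr A b (-L.extD A a)
    rw [h1, h2, map_neg, map_neg]
    abel
  · have := (L.nilFiltration A).bracket 1 i a.1 ((L.nilFiltration A).one a.1) x.1 hx
    rwa [add_comm] at this
  · rw [he i hi, Submodule.comap_bot, LinearMap.ker_eq_bot]
    exact Subtype.val_injective

variable {L A}

/-- Dynkin's series is natural, so the product formed with the graded bracket of `L ⊗ 𝔪_A` agrees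
with that of the Lie algebra in degree 0, where the group laws are known. -/
theorem DGLA.bch_coe (a b : L.extGr A 0) :
    L.bch A a b = (ThomWhitney.bch (L.zeroBr A) a b : L.extGr A 0) :=
  ((L.nilLie_zeroBr A).map_bch (L.extGr A 0).subtype (fun _ _ => rfl) a b).symm

theorem DGLA.bch_mem {a b : L.ext A} (ha : a ∈ L.extGr A 0) (hb : b ∈ L.extGr A 0) :
    L.bch A a b ∈ L.extGr A 0 := by
  rw [L.bch_coe ⟨a, ha⟩ ⟨b, hb⟩]
  exact Subtype.prop _

theorem DGLA.gauge_eq (a x : L.ext A) :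
    L.gauge A a x = x + expm (L.extBr A) a (L.extBr A a x - L.extD A a) := rfl

theorem DGLA.gauge_zero (x : L.ext A) : L.gauge A 0 x = x := by
  rw [DGLA.gauge_eq, map_zero, map_zero, LinearMap.zero_apply, sub_zero,
    (L.nilFiltration A).expm_zero, add_zero]

/-- The operator `(e^{ad a} - 1) / ad a` is injective, so being a stabilizer is a condition linear
in `a`. -/
theorem DGLA.gauge_eq_self_iff {a x : L.ext A} :
    L.gauge A a x = x ↔ L.extBr A a x = L.extD A a := by
  rw [DGLA.gauge_eq, add_eq_left]
  constructor
  · intro h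
    exact sub_eq_zero.mp ((L.nilFiltration A).eq_zero_of_expm (L.extFil_antitone A) h)
  · intro h
    rw [h, sub_self, (L.nilFiltration A).expm_zero]

variable (L A) in
/-- The polarization `([x, y] + c d y + c' d x)` of the Maurer-Cartan equation. -/
noncomputable def DGLA.curv : L.extGr A 1 × K →ₗ[K] L.extGr A 1 × K →ₗ[K] L.ext A :=
  LinearMap.mk₂ K (fun z w => L.extBr A z.1 w.1 + z.2 • L.extD A w.1 + w.2 • L.extD A z.1)
    (by
      intro z z' w
      simp only [Prod.fst_add, Prod.snd_add, Submodule.coe_add, map_add, LinearMap.add_apply]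
      module)
    (by
      intro c z w
      simp only [Prod.smul_fst, Prod.smul_snd, Submodule.coe_smul, map_smul, LinearMap.smul_apply,
        smul_eq_mul]
      module)
    (by
      intro z w w'
      simp only [Prod.fst_add, Prod.snd_add, Submodule.coe_add, map_add]
      module)
    (by
      intro c z w
      simp only [Prod.smul_fst, Prod.smul_snd, Submodule.coe_smul, map_smul, smul_eq_mul]
      module)

/-- The terms containing `d a` cancel: the Leibniz rule produces `[da, x]`, and `[x, da] = [da, x]`
because both have degree 1. -/
theorem DGLA.curv_gaugeRep (a : L.extGr A 0) (z w : L.extGr A 1 × K) :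
    L.curv A (L.gaugeRep A a z) w + L.curv A z (L.gaugeRep A a w) =
      L.extBr A a (L.curv A z w) := by
  obtain ⟨x, c⟩ := z
  obtain ⟨y, c'⟩ := w
  change (L.extBr A (L.extBr A a x + c • -L.extD A a) y + (0 : K) • L.extD A y +
      c' • L.extD A (L.extBr A a x + c • -L.extD A a)) +
    (L.extBr A x (L.extBr A a y + c' • -L.extD A a) +
      c • L.extD A (L.extBr A a y + c' • -L.extD A a) + (0 : K) • L.extD A x) =
    L.extBr A a (L.extBr A x y + c • L.extD A y + c' • L.extD A x)
  have h1 := DGLA.ext_jacobi a.2 x.2 y.1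
  have h2 := DGLA.ext_leibniz a.2 x.1
  have h3 := DGLA.ext_leibniz a.2 y.1
  have h4 := DGLA.ext_skew x.2 (DGLA.extD_mem a.2)
  simp only [zero_add, zpow_zero, one_smul, mul_one, zpow_one, neg_smul, neg_neg]
    at h1 h2 h3 h4
  simp only [map_add, map_smul, map_neg, LinearMap.add_apply, LinearMap.smul_apply,
    LinearMap.neg_apply, h1, h2, h3, h4, DGLA.extD_extD]
  module

theorem DGLA.isNilpotent_extBr (a : L.ext A) :
    IsNilpotent (L.extBr A a : Module.End K (L.ext A)) := by
  obtain ⟨e, he⟩ := (L.nilFiltration A).bot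
  refine ⟨e, LinearMap.ext fun x => ?_⟩
  have := (L.nilFiltration A).iterate_mem a x e
  rw [he _ (by omega), Submodule.mem_bot] at this
  rw [Module.End.pow_apply, this, LinearMap.zero_apply]

variable [CharZero K]

/-- The gauge action is the linear action of `e^a` on the affine hyperplane of scalar coordinate 1.
Everything about it follows from properties of exponentials. -/
theorem DGLA.nexp_gaugeRep (a : L.extGr A 0) (x : L.extGr A 1) :
    ∃ h : L.gauge A a x ∈ L.extGr A 1,
      nexp K (L.gaugeRep A a) (x, 1) = (⟨L.gauge A a x, h⟩, 1) := by
  obtain ⟨k, hk⟩ := nexp_affRep a ((L.isNilRep_gaugeRep A).isNilpotent a)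
  obtain ⟨l, hl⟩ := (L.nilFiltration A).expm_eq_sum
  have key : L.gauge A a x = (nexp K (L.gaugeRep A a) (x, 1)).1 := by
    rw [DGLA.gaugeRep, hk (max k l) (le_max_left _ _), DGLA.gauge_eq,
      hl (max k l) (le_max_right _ _), Submodule.coe_add]
    congr 1
    rw [AddSubmonoidClass.coe_finsetSum]
    refine Finset.sum_congr rfl fun n _ => ?_
    rw [Submodule.coe_smul]
    congr 1
    clear * -
    induction n with
    | zero =>
      rw [one_smul, Function.iterate_zero, id, Function.iterate_zero, id, sub_eq_add_neg]
      rfl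
    | succ n ih => rw [Function.iterate_succ_apply', ih, Function.iterate_succ_apply']; rfl
  have h2 : (nexp K (L.gaugeRep A a) (x, 1)).2 = 1 := by
    rw [DGLA.gaugeRep, hk k le_rfl]
  refine ⟨key ▸ Subtype.prop _, Prod.ext (Subtype.ext key.symm) h2⟩

theorem DGLA.gauge_mem {a x : L.ext A} (ha : a ∈ L.extGr A 0) (hx : x ∈ L.extGr A 1) :
    L.gauge A a x ∈ L.extGr A 1 := (DGLA.nexp_gaugeRep ⟨a, ha⟩ ⟨x, hx⟩).1

/-- The Baker-Campbell-Hausdorff formula in the affine representation, read on vectors of scalar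
coordinate 1. -/
theorem DGLA.gauge_bch {a b x : L.ext A} (ha : a ∈ L.extGr A 0) (hb : b ∈ L.extGr A 0)
    (hx : x ∈ L.extGr A 1) : L.gauge A (L.bch A a b) x = L.gauge A a (L.gauge A b x) := by
  obtain ⟨hm, h1⟩ := DGLA.nexp_gaugeRep (ThomWhitney.bch (L.zeroBr A) ⟨a, ha⟩ ⟨b, hb⟩) ⟨x, hx⟩
  obtain ⟨hm', h2⟩ := DGLA.nexp_gaugeRep ⟨b, hb⟩ ⟨x, hx⟩
  obtain ⟨hm'', h3⟩ := DGLA.nexp_gaugeRep ⟨a, ha⟩ ⟨_, hm'⟩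
  rw [(L.nilLie_zeroBr A).nexp_bch (L.isNilRep_gaugeRep A), Module.End.mul_apply, h2, h3] at h1
  have := congrArg (fun z => (z.1 : L.ext A)) h1
  rw [L.bch_coe ⟨a, ha⟩ ⟨b, hb⟩]
  exact this.symm

theorem DGLA.zero_bch {a : L.ext A} (ha : a ∈ L.extGr A 0) : L.bch A 0 a = a :=
  (L.bch_coe 0 ⟨a, ha⟩).trans (congrArg Subtype.val ((L.nilLie_zeroBr A).zero_bch _))

theorem DGLA.bch_zero {a : L.ext A} (ha : a ∈ L.extGr A 0) : L.bch A a 0 = a :=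
  (L.bch_coe ⟨a, ha⟩ 0).trans (congrArg Subtype.val ((L.nilLie_zeroBr A).bch_zero _))

theorem DGLA.neg_bch {a : L.ext A} (ha : a ∈ L.extGr A 0) : L.bch A (-a) a = 0 :=
  (L.bch_coe (-⟨a, ha⟩) ⟨a, ha⟩).trans (congrArg Subtype.val ((L.nilLie_zeroBr A).neg_bch _))

theorem DGLA.gauge_neg_gauge {a x : L.ext A} (ha : a ∈ L.extGr A 0) (hx : x ∈ L.extGr A 1) :
    L.gauge A (-a) (L.gauge A a x) = x := by
  rw [← DGLA.gauge_bch (Submodule.neg_mem _ ha) ha hx, DGLA.neg_bch ha, DGLA.gauge_zero]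

theorem DGLA.curv_nexp (a : L.extGr A 0) (z w : L.extGr A 1 × K) :
    L.curv A (nexp K (L.gaugeRep A a) z) (nexp K (L.gaugeRep A a) w) =
      nexp K (L.extBr A a : Module.End K (L.ext A)) (L.curv A z w) :=
  nexp_bilinear ((L.isNilRep_gaugeRep A).isNilpotent a) (DGLA.isNilpotent_extBr a.1) _
    (DGLA.curv_gaugeRep a) z w

/-- On the hyperplane of scalar coordinate 1 the diagonal of `curv` is twice the left side of the
Maurer-Cartan equation, which is thereby homogenized. -/
theorem DGLA.isMC_iff_curv (x : L.extGr A 1) : L.IsMC A x ↔ L.curv A (x, 1) (x, 1) = 0 := by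
  have h2 : (2 : K) ≠ 0 := two_ne_zero
  have : L.curv A (x, 1) (x, 1) = (2 : K) • (L.extD A x + (1 / 2 : K) • L.extBr A x x) := by
    change L.extBr A x x + (1 : K) • L.extD A x + (1 : K) • L.extD A x = _
    rw [smul_add, smul_smul, mul_one_div_cancel h2]
    module
  rw [this, smul_eq_zero_iff_right h2]
  exact ⟨fun h => h.2, fun h => ⟨x.2, h⟩⟩

/-- The gauge action preserves Maurer-Cartan elements. -/
theorem DGLA.gauge_isMC {a x : L.ext A} (ha : a ∈ L.extGr A 0) (hx : L.IsMC A x) :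
    L.IsMC A (L.gauge A a x) := by
  obtain ⟨hm, h⟩ := DGLA.nexp_gaugeRep ⟨a, ha⟩ ⟨x, hx.1⟩
  refine (DGLA.isMC_iff_curv ⟨_, hm⟩).mpr ?_
  rw [← h, DGLA.curv_nexp, (DGLA.isMC_iff_curv ⟨x, hx.1⟩).mp hx, map_zero]

end Extension

/-! ### Tensor products and fiber products -/

section FiberProducts

/-- Tensor products over a field preserve fiber products. -/
theorem lTensor_fiber {K : Type*} [Field K] (W : Type*) {P B C A : Type*} [AddCommGroup W]
    [Module K W] [AddCommGroup P] [Module K P] [AddCommGroup B] [Module K B] [AddCommGroup C]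
    [Module K C] [AddCommGroup A] [Module K A] (p : P →ₗ[K] B) (q : P →ₗ[K] C) (f : B →ₗ[K] A)
    (h : C →ₗ[K] A) (hcomm : ∀ x, f (p x) = h (q x))
    (hex : ∀ b c, f b = h c → ∃! x, p x = b ∧ q x = c) (y : W ⊗[K] B) (z : W ⊗[K] C)
    (hyz : f.lTensor W y = h.lTensor W z) :
    ∃! x : W ⊗[K] P, p.lTensor W x = y ∧ q.lTensor W x = z := by
  have hinj : Function.Injective (p.prod q) := by
    intro x x' hx
    have h1 : p x = p x' := congrArg Prod.fst hx
    have h2 : q x = q x' := congrArg Prod.snd hx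
    exact (hex (p x') (q x') (hcomm x')).unique ⟨h1, h2⟩ ⟨rfl, rfl⟩
  -- A fiber product is the kernel of the difference map on `B × C`, and flatness preserves this
  -- exact sequence.
  have hexact : Function.Exact (p.prod q)
      (f ∘ₗ LinearMap.fst K B C - h ∘ₗ LinearMap.snd K B C) := by
    rintro ⟨b, c⟩
    constructor
    · intro hbc
      obtain ⟨x, ⟨h1, h2⟩, -⟩ := hex b c (sub_eq_zero.mp hbc)
      exact ⟨x, Prod.ext h1 h2⟩
    · rintro ⟨x, hx⟩
      rw [← hx]
      exact sub_eq_zero.mpr (hcomm x)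
  have hinj' := Module.Flat.lTensor_preserves_injective_linearMap (M := W) _ hinj
  have hexact' := Module.Flat.lTensor_exact W hexact
  have hφ : ∀ x, (p.prod q).lTensor W x = (LinearMap.inl K B C).lTensor W (p.lTensor W x) +
      (LinearMap.inr K B C).lTensor W (q.lTensor W x) := by
    intro x
    rw [← LinearMap.lTensor_comp_apply, ← LinearMap.lTensor_comp_apply, ← LinearMap.add_apply,
      ← LinearMap.lTensor_add]
    congr 2
    ext x <;> simp
  have hp : ∀ x, p.lTensor W x =
      (LinearMap.fst K B C).lTensor W ((p.prod q).lTensor W x) := fun x => by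
    rw [← LinearMap.lTensor_comp_apply, LinearMap.fst_prod]
  have hq : ∀ x, q.lTensor W x =
      (LinearMap.snd K B C).lTensor W ((p.prod q).lTensor W x) := fun x => by
    rw [← LinearMap.lTensor_comp_apply, LinearMap.snd_prod]
  obtain ⟨x, hx⟩ := (hexact' ((LinearMap.inl K B C).lTensor W y +
      (LinearMap.inr K B C).lTensor W z)).mp (by
    simp only [LinearMap.lTensor_sub, LinearMap.lTensor_comp, LinearMap.sub_apply,
      LinearMap.comp_apply, map_add, ← LinearMap.lTensor_comp_apply, LinearMap.fst_comp_inl,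
      LinearMap.fst_comp_inr, LinearMap.snd_comp_inl, LinearMap.snd_comp_inr, LinearMap.lTensor_id,
      LinearMap.lTensor_zero, LinearMap.id_apply, LinearMap.zero_apply, map_zero, sub_zero,
      zero_sub, hyz, add_neg_cancel])
  refine ⟨x, ⟨?_, ?_⟩, ?_⟩
  · rw [hp, hx, map_add, ← LinearMap.lTensor_comp_apply, ← LinearMap.lTensor_comp_apply]
    simp
  · rw [hq, hx, map_add, ← LinearMap.lTensor_comp_apply, ← LinearMap.lTensor_comp_apply]
    simp
  · rintro x' ⟨h1, h2⟩
    refine hinj' ?_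
    rw [hφ, h1, h2, hx]

variable {K : Type u} [Field K] {P B C A : ArtAlg.{u} K} {p : P ⟶ B} {q : P ⟶ C} {f : B ⟶ A}
  {h : C ⟶ A}

/-- The element of the fiber product over a pair of non-units is itself a non-unit, since ring
homomorphisms preserve units. -/
theorem maxMap_fiber
    (hex : ∀ b c, ArtAlg.hom f b = ArtAlg.hom h c →
      ∃! x, ArtAlg.hom p x = b ∧ ArtAlg.hom q x = c) (b : B.max) (c : C.max)
    (hbc : ArtAlg.maxMap f b = ArtAlg.maxMap h c) :
    ∃! x, ArtAlg.maxMap p x = b ∧ ArtAlg.maxMap q x = c := by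
  obtain ⟨x, ⟨h1, h2⟩, hu⟩ := hex b c (congrArg Subtype.val hbc)
  have hx : x ∈ P.max := by
    change x ∈ IsLocalRing.maximalIdeal P.carrier
    rw [IsLocalRing.mem_maximalIdeal, mem_nonunits_iff]
    intro hunit
    have hb : (b : B.carrier) ∈ nonunits B.carrier := b.2
    exact hb (h1 ▸ hunit.map (ArtAlg.hom p))
  refine ⟨⟨x, hx⟩, ⟨Subtype.ext h1, Subtype.ext h2⟩, ?_⟩
  rintro x' ⟨h1', h2'⟩
  exact Subtype.ext (hu _ ⟨congrArg Subtype.val h1', congrArg Subtype.val h2'⟩)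

theorem maxMap_comm (hcomm : p ≫ f = q ≫ h) (x : P.max) :
    ArtAlg.maxMap f (ArtAlg.maxMap p x) = ArtAlg.maxMap h (ArtAlg.maxMap q x) :=
  Subtype.ext (congrArg (fun φ : P ⟶ A => ArtAlg.hom φ x) hcomm)

variable (L : DGLA.{u, v} K)

theorem DGLA.extMap_fiber (hcomm : p ≫ f = q ≫ h)
    (hex : ∀ b c, ArtAlg.hom f b = ArtAlg.hom h c →
      ∃! x, ArtAlg.hom p x = b ∧ ArtAlg.hom q x = c) (y : L.ext B) (z : L.ext C)
    (hyz : L.extMap f y = L.extMap h z) : ∃! x, L.extMap p x = y ∧ L.extMap q x = z :=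
  lTensor_fiber L.carrier _ _ _ _ (maxMap_comm hcomm) (maxMap_fiber hex) y z hyz

/-- The fiber product property also holds for `L^i` in place of `L`; the element glued there agrees
with `x` by uniqueness in `L ⊗ 𝔪_P`. -/
theorem DGLA.mem_extGr_of_fiber (hcomm : p ≫ f = q ≫ h)
    (hex : ∀ b c, ArtAlg.hom f b = ArtAlg.hom h c →
      ∃! x, ArtAlg.hom p x = b ∧ ArtAlg.hom q x = c) {i : ℤ} {x : L.ext P}
    (h1 : L.extMap p x ∈ L.extGr B i) (h2 : L.extMap q x ∈ L.extGr C i) : x ∈ L.extGr P i := by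
  obtain ⟨y, hy⟩ := h1
  obtain ⟨z, hz⟩ := h2
  have hincl : ∀ {A B : ArtAlg.{u} K} (f : A ⟶ B) (y : L.gr i ⊗[K] A.max),
      L.extMap f ((L.gr i).subtype.rTensor A.max y) =
        (L.gr i).subtype.rTensor B.max ((ArtAlg.maxMap f).lTensor (L.gr i) y) := by
    intro A B f y
    rw [DGLA.extMap, ← LinearMap.comp_apply, ← LinearMap.comp_apply,
      LinearMap.rTensor_comp_lTensor, LinearMap.lTensor_comp_rTensor]
  have hinj : Function.Injective ((L.gr i).subtype.rTensor A.max) :=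
    Module.Flat.rTensor_preserves_injective_linearMap _ Subtype.val_injective
  obtain ⟨x', ⟨hx1, hx2⟩, -⟩ := lTensor_fiber (L.gr i) _ _ _ _ (maxMap_comm hcomm)
    (maxMap_fiber hex) y z (hinj (by
      rw [← hincl, ← hincl, hy, hz, ← L.extMap_comp, ← L.extMap_comp, hcomm]))
  refine ⟨x', ?_⟩
  refine (L.extMap_fiber hcomm hex (L.extMap p x) (L.extMap q x)
    (by rw [← L.extMap_comp, ← L.extMap_comp, hcomm])).unique ⟨?_, ?_⟩ ⟨rfl, rfl⟩
  · rw [hincl, hx1, hy]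
  · rw [hincl, hx2, hz]

theorem maxMap_surjective (hf : Function.Surjective (ArtAlg.hom f)) :
    Function.Surjective (ArtAlg.maxMap f) := by
  rintro ⟨a, ha⟩
  obtain ⟨b, rfl⟩ := hf a
  refine ⟨⟨b, ?_⟩, rfl⟩
  change b ∈ IsLocalRing.maximalIdeal B.carrier
  rw [IsLocalRing.mem_maximalIdeal, mem_nonunits_iff]
  intro hunit
  have ha' : ArtAlg.hom f b ∈ nonunits A.carrier := ha
  exact ha' (hunit.map (ArtAlg.hom f))

/-- Gauge parameters lift along surjections within their degree: preimages of non-units are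
non-units, and tensor products are right exact. -/
theorem DGLA.exists_extMap_eq (hf : Function.Surjective (ArtAlg.hom f)) {i : ℤ} {a : L.ext A}
    (ha : a ∈ L.extGr A i) : ∃ b ∈ L.extGr B i, L.extMap f b = a := by
  obtain ⟨y, rfl⟩ := ha
  obtain ⟨z, rfl⟩ := LinearMap.lTensor_surjective (L.gr i) (maxMap_surjective hf) y
  refine ⟨_, ⟨z, rfl⟩, ?_⟩
  rw [DGLA.extMap, ← LinearMap.comp_apply, ← LinearMap.comp_apply,
    LinearMap.rTensor_comp_lTensor, LinearMap.lTensor_comp_rTensor]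

theorem max_subsingleton (hA : Function.Bijective (algebraMap K A.carrier)) :
    Subsingleton A.max := by
  refine ⟨fun x y => ?_⟩
  have key : ∀ x : A.max, x = 0 := by
    rintro ⟨x, hx⟩
    obtain ⟨c, rfl⟩ := hA.2 x
    refine Subtype.ext ?_
    rcases eq_or_ne c 0 with rfl | hc
    · exact map_zero _
    · exact absurd ((IsUnit.mk0 c hc).map (algebraMap K A.carrier)) hx
  rw [key x, key y]

theorem DGLA.ext_subsingleton (hA : Function.Bijective (algebraMap K A.carrier)) :
    Subsingleton (L.ext A) := by
  have := max_subsingleton hA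
  refine subsingleton_of_forall_eq 0 fun x => ?_
  induction x using TensorProduct.induction_on with
  | zero => rfl
  | add x y hx hy => rw [hx, hy, add_zero]
  | tmul x a => rw [Subsingleton.elim a 0, tmul_zero]

theorem hom_surjective (hA : Function.Bijective (algebraMap K A.carrier)) :
    Function.Surjective (ArtAlg.hom f) := by
  intro a
  obtain ⟨c, rfl⟩ := hA.2 a
  exact ⟨algebraMap K _ c, AlgHom.commutes _ c⟩

end FiberProducts

/-! ### `Def_L` is a deformation functor -/

section DefFunctor

variable {K : Type u} [Field K] (L : DGLA.{u, v} K)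

theorem DGLA.def_map_mk {A B : ArtAlg.{u} K} (f : A ⟶ B) (x : L.MC A) :
    L.Def.map f (Quot.mk _ x) =
      (Quot.mk _ ⟨L.extMap f x.1, L.extMap_isMC f x.2⟩ : Quot (L.GaugeEquiv B)) := rfl

/-- Both the degree and the equation can be tested on the two projections, which are jointly
injective. -/
theorem DGLA.mc_fiber {P B C A : ArtAlg.{u} K} {p : P ⟶ B} {q : P ⟶ C} {f : B ⟶ A}
    {h : C ⟶ A} (hcomm : p ≫ f = q ≫ h)
    (hex : ∀ b c, ArtAlg.hom f b = ArtAlg.hom h c →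
      ∃! x, ArtAlg.hom p x = b ∧ ArtAlg.hom q x = c) {x : L.ext P}
    (h1 : L.IsMC B (L.extMap p x)) (h2 : L.IsMC C (L.extMap q x)) : L.IsMC P x := by
  refine ⟨L.mem_extGr_of_fiber hcomm hex h1.1 h2.1, ?_⟩
  refine (L.extMap_fiber hcomm hex 0 0 (by simp)).unique ⟨?_, ?_⟩ ⟨map_zero _, map_zero _⟩
  · rw [map_add, map_smul, L.extMap_d, L.extMap_br, h1.2]
  · rw [map_add, map_smul, L.extMap_d, L.extMap_br, h2.2]

theorem IsDeformationFunctor.of_iso {F G : ArtAlg.{u} K ⥤ Type w} (hF : IsDeformationFunctor F)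
    (e : F ≅ G) : IsDeformationFunctor G where
  point A hA := by
    obtain ⟨hu⟩ := hF.point A hA
    exact ⟨(e.app A).toEquiv.symm.unique⟩
  surjective {P B C A} p q f h hcomm hex hf y z hyz := by
    have hn : ∀ {X Y : ArtAlg.{u} K} (φ : X ⟶ Y) x,
        F.map φ (e.inv.app X x) = e.inv.app Y (G.map φ x) := fun φ x =>
      (NatTrans.naturality_apply e.inv φ x).symm
    obtain ⟨x, h1, h2⟩ := hF.surjective p q f h hcomm hex hf (e.inv.app B y) (e.inv.app C z)
      (by rw [hn, hn, hyz])
    refine ⟨e.hom.app P x, ?_, ?_⟩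
    · rw [← NatTrans.naturality_apply, h1]; simp
    · rw [← NatTrans.naturality_apply, h2]; simp
  bijective {P B C A} p q f h hcomm hex hA y z hyz := by
    have hn : ∀ {X Y : ArtAlg.{u} K} (φ : X ⟶ Y) x,
        F.map φ (e.inv.app X x) = e.inv.app Y (G.map φ x) := fun φ x =>
      (NatTrans.naturality_apply e.inv φ x).symm
    obtain ⟨x, ⟨h1, h2⟩, hu⟩ := hF.bijective p q f h hcomm hex hA (e.inv.app B y)
      (e.inv.app C z) (by rw [hn, hn, hyz])
    refine ⟨e.hom.app P x, ⟨?_, ?_⟩, ?_⟩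
    · rw [← NatTrans.naturality_apply, h1]; simp
    · rw [← NatTrans.naturality_apply, h2]; simp
    · rintro x' ⟨rfl, rfl⟩
      rw [← hu (e.inv.app P x') ⟨hn _ _, hn _ _⟩]
      simp

variable [CharZero K]

theorem DGLA.gaugeEquiv_equivalence (A : ArtAlg.{u} K) : Equivalence (L.GaugeEquiv A) where
  refl x := ⟨0, Submodule.zero_mem _, DGLA.gauge_zero _⟩
  symm := by
    rintro x y ⟨a, ha, h⟩
    exact ⟨-a, Submodule.neg_mem _ ha, by rw [← h, DGLA.gauge_neg_gauge ha x.2.1]⟩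
  trans := by
    rintro x y z ⟨a, ha, h⟩ ⟨b, hb, h'⟩
    exact ⟨L.bch A b a, DGLA.bch_mem hb ha, by rw [DGLA.gauge_bch hb ha x.2.1, h, h']⟩

theorem DGLA.def_eq_iff {A : ArtAlg.{u} K} {x y : L.MC A} :
    (Quot.mk (L.GaugeEquiv A) x = Quot.mk (L.GaugeEquiv A) y) ↔ L.GaugeEquiv A x y := by
  rw [Quot.eq, (L.gaugeEquiv_equivalence A).eqvGen_iff]

/-- The two classes agree over `A` only up to a gauge parameter. Lifting it to `B` and moving `y` by
the lift makes the representatives agree exactly, so that they glue. -/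
theorem DGLA.def_surjective {P B C A : ArtAlg.{u} K} (p : P ⟶ B) (q : P ⟶ C) (f : B ⟶ A)
    (h : C ⟶ A) (hcomm : p ≫ f = q ≫ h)
    (hex : ∀ b c, ArtAlg.hom f b = ArtAlg.hom h c →
      ∃! x, ArtAlg.hom p x = b ∧ ArtAlg.hom q x = c)
    (hf : Function.Surjective (ArtAlg.hom f)) (y : L.Def.obj B) (z : L.Def.obj C)
    (hyz : L.Def.map f y = L.Def.map h z) : ∃ x, L.Def.map p x = y ∧ L.Def.map q x = z := by
  induction y using Quot.ind with | mk y => ?_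
  induction z using Quot.ind with | mk z => ?_
  rw [DGLA.def_map_mk, DGLA.def_map_mk] at hyz
  obtain ⟨a, ha, hgauge⟩ := L.def_eq_iff.mp hyz
  obtain ⟨b, hb, rfl⟩ := L.exists_extMap_eq hf ha
  rw [← L.extMap_gauge] at hgauge
  obtain ⟨x, ⟨h1, h2⟩, -⟩ := L.extMap_fiber hcomm hex _ _ hgauge
  have hx : L.IsMC P x := L.mc_fiber hcomm hex (h1 ▸ DGLA.gauge_isMC hb y.2) (h2 ▸ z.2)
  refine ⟨Quot.mk _ ⟨x, hx⟩, ?_, ?_⟩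
  · exact (L.def_eq_iff (y := ⟨L.extMap p x, L.extMap_isMC p hx⟩).mpr ⟨b, hb, h1.symm⟩).symm
  · exact congrArg (Quot.mk _) (Subtype.ext h2)

/-- The functor `Def_L` is a deformation functor. -/
theorem DGLA.isDeformationFunctor_def : IsDeformationFunctor L.Def where
  point A hA := by
    have := L.ext_subsingleton hA
    have h0 : L.IsMC A 0 := ⟨Submodule.zero_mem _, by simp⟩
    refine ⟨⟨⟨Quot.mk _ ⟨0, h0⟩⟩, fun x => ?_⟩⟩
    induction x using Quot.ind with | mk x => ?_
    exact congrArg (Quot.mk _) (Subtype.ext (Subsingleton.elim _ _))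
  surjective := L.def_surjective
  bijective {P B C A} p q f h hcomm hex hA y z hyz := by
    obtain ⟨x, hx⟩ := L.def_surjective p q f h hcomm hex (hom_surjective hA) y z hyz
    refine ⟨x, hx, ?_⟩
    obtain ⟨rfl, rfl⟩ := hx
    rintro x' ⟨h1, h2⟩
    induction x using Quot.ind with | mk x => ?_
    induction x' using Quot.ind with | mk x' => ?_
    rw [DGLA.def_map_mk, DGLA.def_map_mk] at h1 h2
    obtain ⟨a, ha, hga⟩ := L.def_eq_iff.mp h1
    obtain ⟨b, hb, hgb⟩ := L.def_eq_iff.mp h2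
    have := L.ext_subsingleton hA
    -- For `A = K` the ideal `𝔪_A` is zero, so gauge parameters over `B` and `C` agree over `A`
    -- automatically and glue to one over `P`.
    obtain ⟨c, ⟨rfl, rfl⟩, -⟩ := L.extMap_fiber hcomm hex a b (Subsingleton.elim _ _)
    refine L.def_eq_iff.mpr ⟨c, L.mem_extGr_of_fiber hcomm hex ha hb, ?_⟩
    refine (L.extMap_fiber hcomm hex (L.extMap p x.1) (L.extMap q x.1)
      (Subsingleton.elim _ _)).unique ⟨?_, ?_⟩ ⟨rfl, rfl⟩
    · rw [L.extMap_gauge]; exact hga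
    · rw [L.extMap_gauge]; exact hgb

end DefFunctor

/-! ### Forms with coefficients in `L ⊗ 𝔪_A` -/

section FormMul

variable {K : Type u} [Field K] (Ω : CDGA.{u, u} K) (L : DGLA.{u, v} K) (A : ArtAlg.{u} K)

/-- The map `(ω, x) ↦ ω ⊗ x`, as a bilinear map. -/
noncomputable def formMulLin : Ω.carrier →ₗ[K] L.ext A →ₗ[K] (tensor Ω L).ext A :=
  LinearMap.rTensorHom A.max ∘ₗ TensorProduct.mk K Ω.carrier L.carrier

theorem formMul_tmul (ω : Ω.carrier) (x : L.carrier) (a : A.max) :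
    formMul Ω L A ω (x ⊗ₜ a) = (ω ⊗ₜ[K] x : Ω.carrier ⊗[K] L.carrier) ⊗ₜ[K] a := rfl

variable {Ω L A}

theorem formMul_add_left (ω ω' : Ω.carrier) (n : L.ext A) :
    formMul Ω L A (ω + ω') n = formMul Ω L A ω n + formMul Ω L A ω' n :=
  LinearMap.congr_fun (map_add (formMulLin Ω L A) ω ω') n

theorem formMul_smul_left (c : K) (ω : Ω.carrier) (n : L.ext A) :
    formMul Ω L A (c • ω) n = c • formMul Ω L A ω n :=
  LinearMap.congr_fun (map_smul (formMulLin Ω L A) c ω) n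

theorem formMul_zero_left (n : L.ext A) : formMul Ω L A 0 n = 0 :=
  LinearMap.congr_fun (map_zero (formMulLin Ω L A)) n

theorem formMul_ind {P : (tensor Ω L).ext A → Prop} (h0 : P 0)
    (hadd : ∀ x y, P x → P y → P (x + y)) (h : ∀ ω n, P (formMul Ω L A ω n)) (z) : P z := by
  induction z using TensorProduct.induction_on with
  | zero => exact h0
  | add x y hx hy => exact hadd x y hx hy
  | tmul z a =>
    refine TensorProduct.induction_on (motive := fun z : Ω.carrier ⊗[K] L.carrier =>
      P ((z : (tensor Ω L).carrier) ⊗ₜ[K] a)) z ?_ (fun ω x => h ω (x ⊗ₜ a)) ?_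
    · exact (zero_tmul _ a : (0 : (tensor Ω L).carrier) ⊗ₜ[K] a = 0).symm ▸ h0
    · intro x y hx hy
      have : ((x + y : Ω.carrier ⊗[K] L.carrier) : (tensor Ω L).carrier) ⊗ₜ[K] a =
        (x : (tensor Ω L).carrier) ⊗ₜ[K] a + (y : (tensor Ω L).carrier) ⊗ₜ[K] a :=
        add_tmul (M := (tensor Ω L).carrier) x y a
      exact (congrArg P this).mpr (hadd _ _ hx hy)

theorem formMul_mem {i j : ℤ} {ω : Ω.carrier} {n : L.ext A} (hω : ω ∈ Ω.gr i)
    (hn : n ∈ L.extGr A j) : formMul Ω L A ω n ∈ (tensor Ω L).extGr A (i + j) := by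
  refine DGLA.extGr_ind (P := fun n => formMul Ω L A ω n ∈ (tensor Ω L).extGr A (i + j)) ?_
    (fun x y hx hy => by rw [map_add]; exact Submodule.add_mem _ hx hy) (fun x hx a => ?_) hn
  · rw [map_zero]; exact Submodule.zero_mem _
  · exact DGLA.tmul_mem_extGr (L := tensor Ω L) (tmul_mem hω hx) a

theorem extGr_formMul_ind {k : ℤ} {P : (tensor Ω L).ext A → Prop} (h0 : P 0)
    (hadd : ∀ x y, P x → P y → P (x + y))
    (h : ∀ i j, i + j = k → ∀ ω ∈ Ω.gr i, ∀ n ∈ L.extGr A j, P (formMul Ω L A ω n)) {z}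
    (hz : z ∈ (tensor Ω L).extGr A k) : P z := by
  refine DGLA.extGr_ind h0 hadd (fun y hy a => ?_) hz
  refine tensorGr_ind (Ω := Ω) (L := L) (k := k)
    (P := fun y => P ((y : (tensor Ω L).carrier) ⊗ₜ[K] a)) ?_ ?_ ?_ hy
  · exact (zero_tmul _ a : (0 : (tensor Ω L).carrier) ⊗ₜ[K] a = 0).symm ▸ h0
  · intro x y hx hy
    have : ((x + y : Ω.carrier ⊗[K] L.carrier) : (tensor Ω L).carrier) ⊗ₜ[K] a =
      (x : (tensor Ω L).carrier) ⊗ₜ[K] a + (y : (tensor Ω L).carrier) ⊗ₜ[K] a :=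
      add_tmul (M := (tensor Ω L).carrier) x y a
    exact (congrArg P this).mpr (hadd _ _ hx hy)
  · intro i j hij ω hω x hx
    exact h i j hij ω hω (x ⊗ₜ a) (DGLA.tmul_mem_extGr hx a)

theorem extD_formMul {i : ℤ} {ω : Ω.carrier} (hω : ω ∈ Ω.gr i) (n : L.ext A) :
    (tensor Ω L).extD A (formMul Ω L A ω n) =
      formMul Ω L A (Ω.d ω) n + (-1 : K) ^ i • formMul Ω L A ω (L.extD A n) := by
  induction n using TensorProduct.induction_on with
  | zero => simp only [map_zero, smul_zero, add_zero]
  | add x y hx hy => simp only [map_add, hx, hy]; module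
  | tmul x a =>
    rw [formMul_tmul, formMul_tmul, DGLA.extD_tmul, formMul_tmul]
    change (tensorD Ω L (ω ⊗ₜ x) : (tensor Ω L).carrier) ⊗ₜ[K] a = _
    rw [tensorD_tmul hω]
    exact add_tmul (M := (tensor Ω L).carrier) _ _ a

theorem extBr_formMul {i j : ℤ} {ω ω' : Ω.carrier} (hω' : ω' ∈ Ω.gr i) {n n' : L.ext A}
    (hn : n ∈ L.extGr A j) :
    (tensor Ω L).extBr A (formMul Ω L A ω n) (formMul Ω L A ω' n') =
      (-1 : K) ^ (j * i) • formMul Ω L A (ω * ω') (L.extBr A n n') := by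
  refine DGLA.extGr_ind (P := fun n => (tensor Ω L).extBr A (formMul Ω L A ω n)
      (formMul Ω L A ω' n') = (-1 : K) ^ (j * i) • formMul Ω L A (ω * ω') (L.extBr A n n'))
    (by simp only [map_zero, LinearMap.zero_apply, smul_zero])
    (fun x y hx hy => by simp only [map_add, LinearMap.add_apply, hx, hy, smul_add])
    (fun x hx a => ?_) hn
  induction n' using TensorProduct.induction_on with
  | zero => simp only [map_zero, smul_zero]
  | add x y hx hy => simp only [map_add, hx, hy, smul_add]
  | tmul y b =>
    change (tensorBracket Ω L (ω ⊗ₜ x) (ω' ⊗ₜ y) : (tensor Ω L).carrier) ⊗ₜ[K] A.maxMul a b =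
      (-1 : K) ^ (j * i) • formMul Ω L A (ω * ω') (L.bracket x y ⊗ₜ A.maxMul a b)
    rw [tensorBracket_tmul hω' hx]
    rfl

theorem tensorMap_ext_formMul {Ω' : CDGA.{u, u} K} {M : DGLA.{u, v} K} (f : Ω.Hom Ω')
    (φ : L.Hom M) (ω : Ω.carrier) (n : L.ext A) :
    (tensorMap f φ).ext A (formMul Ω L A ω n) = formMul Ω' M A (f.toAlg ω) (φ.ext A n) := by
  induction n using TensorProduct.induction_on with
  | zero => simp only [map_zero]
  | add x y hx hy => simp only [map_add, hx, hy]
  | tmul x a => rfl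

open Polynomial

/-- The substitution of a linear map `K[X] → Ω` into polynomials with coefficients in
`L ⊗ 𝔪_A`. -/
noncomputable def polyIn (θ : K[X] →ₗ[K] Ω.carrier) :
    PolyMod K (L.ext A) →ₗ[K] (tensor Ω L).ext A :=
  TensorProduct.lift (formMulLin Ω L A ∘ₗ θ)

/-- The extension of a linear map `Ω → K[X]` to forms with coefficients in `L ⊗ 𝔪_A`. -/
noncomputable def polyOut (π : Ω.carrier →ₗ[K] K[X]) :
    (tensor Ω L).ext A →ₗ[K] PolyMod K (L.ext A) :=
  π.rTensor (L.ext A) ∘ₗ (TensorProduct.assoc K Ω.carrier L.carrier A.max).toLinearMap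

theorem polyOut_formMul (π : Ω.carrier →ₗ[K] K[X]) (ω : Ω.carrier) (n : L.ext A) :
    polyOut π (formMul Ω L A ω n) = π ω ⊗ₜ n := by
  induction n using TensorProduct.induction_on with
  | zero => simp only [map_zero, tmul_zero]
  | add x y hx hy => simp only [map_add, hx, hy, tmul_add]
  | tmul x a => rfl

end FormMul

/-! ### Polynomial forms on the interval -/

section IntervalForms

open Polynomial

variable (K : Type u) [Field K]

/-- The polynomial functions on the `1`-simplex, in the coordinate `t = t_0`. -/
noncomputable def pf : K[X] →ₐ[K] Form K 1 := aeval (tVar 0)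

/-- The forms `f(t) dt`. -/
noncomputable def pfdt : K[X] →ₗ[K] Form K 1 :=
  LinearMap.mulRight K (dtVar 0 : Form K 1) ∘ₗ (pf K).toLinearMap

/-- The forms on the `1`-simplex as dual numbers: `f + g dt ↦ f + ε g`. -/
noncomputable def formDual : Form K 1 →ₐ[K] DualNumber K[X] :=
  Form.lift ![TrivSqZeroExt.inl X, TrivSqZeroExt.inl (1 - X)]
    ![TrivSqZeroExt.inr 1, TrivSqZeroExt.inr (-1)]
    (fun i j => mul_comm _ _) (fun i j => mul_comm _ _)
    (fun i j => by fin_cases i <;> fin_cases j <;> simp)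
    (by simp [Fin.sum_univ_two])
    (by simp [Fin.sum_univ_two])

/-- The part `f` of the form `f + g dt`. -/
noncomputable def pi0 : Form K 1 →ₗ[K] K[X] :=
  ((TrivSqZeroExt.fstHom K K[X] K[X]).comp (formDual K)).toLinearMap

/-- The part `g` of the form `f + g dt`. -/
noncomputable def pi1 : Form K 1 →ₗ[K] K[X] :=
  (TrivSqZeroExt.sndHom K[X] K[X]).restrictScalars K ∘ₗ (formDual K).toLinearMap

variable {K}

theorem pi0_apply (ω : Form K 1) : pi0 K ω = (formDual K ω).fst := rfl

theorem pi1_apply (ω : Form K 1) : pi1 K ω = (formDual K ω).snd := rfl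

theorem formDual_pf (f : K[X]) : formDual K (pf K f) = TrivSqZeroExt.inl f := by
  have : (formDual K).comp (pf K) = TrivSqZeroExt.inlAlgHom K K[X] K[X] := by
    ext
    · simp [pf, formDual, Form.lift_t]
    · simp [pf, formDual, Form.lift_t]
  exact AlgHom.congr_fun this f

theorem formDual_dt : formDual K (dtVar 0) = TrivSqZeroExt.inr 1 := by
  simp [formDual, Form.lift_dt]

theorem pi0_pf (f : K[X]) : pi0 K (pf K f) = f := by simp [pi0_apply, formDual_pf]

theorem pi1_pf (f : K[X]) : pi1 K (pf K f) = 0 := by simp [pi1_apply, formDual_pf]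

theorem pfdt_apply (f : K[X]) : pfdt K f = pf K f * dtVar 0 := rfl

theorem pi0_pfdt (f : K[X]) : pi0 K (pfdt K f) = 0 := by
  simp [pi0_apply, pfdt_apply, formDual_pf, formDual_dt]

theorem pi1_pfdt (f : K[X]) : pi1 K (pfdt K f) = f := by
  simp [pi1_apply, pfdt_apply, formDual_pf, formDual_dt]

theorem tVar_one_eq : (tVar 1 : Form K 1) = pf K (1 - X) := by
  have := sum_tVar (K := K) (n := 1)
  rw [Fin.sum_univ_two] at this
  rw [map_sub, map_one, pf, aeval_X, ← this, add_sub_cancel_left]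

theorem dtVar_one_eq : (dtVar 1 : Form K 1) = -dtVar 0 := by
  have := sum_dtVar (K := K) (n := 1)
  rw [Fin.sum_univ_two, add_comm] at this
  exact eq_neg_of_add_eq_zero_left this

/-- The relations only give `dt dt = -dt dt`; division by 2 does the rest. -/
theorem dt_mul_dt [CharZero K] : (dtVar 0 * dtVar 0 : Form K 1) = 0 := by
  have h := dtVar_mul_dtVar (K := K) (n := 1) 0 0
  have h2 : (2 : K) • (dtVar 0 * dtVar 0 : Form K 1) = 0 := by
    rw [two_smul]
    nth_rewrite 1 [h]
    exact neg_add_cancel _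
  exact (smul_eq_zero_iff_right two_ne_zero).mp h2

theorem dt_mul_pf (f : K[X]) : (dtVar 0 : Form K 1) * pf K f = pf K f * dtVar 0 := by
  induction f using Polynomial.induction_on' with
  | add f g hf hg => rw [map_add, mul_add, add_mul, hf, hg]
  | monomial n a =>
    have : Commute (dtVar 0 : Form K 1) (tVar 0) := (tVar_mul_dtVar 0 0).symm
    rw [pf, aeval_monomial]
    have ha : Commute (dtVar 0 : Form K 1) (algebraMap K _ a) := (Algebra.commutes a _).symm
    exact ha.mul_right (this.pow_right n)

/-- Every form on the `1`-simplex is `f + g dt`. -/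
theorem form_one_eq [CharZero K] (ω : Form K 1) : ω = pf K (pi0 K ω) + pfdt K (pi1 K ω) := by
  have key : ∃ f g, ω = pf K f + pfdt K g := by
    refine form_ind (P := fun ω => ∃ f g, ω = pf K f + pfdt K g) ⟨0, 0, by simp⟩ ?_ ?_ ?_ ω
    · rintro _ _ ⟨f, g, rfl⟩ ⟨f', g', rfl⟩
      exact ⟨f + f', g + g', by rw [map_add, map_add]; abel⟩
    · rintro c _ ⟨f, g, rfl⟩
      exact ⟨c • f, c • g, by rw [map_smul, map_smul, smul_add]⟩
    · intro i a ha
      induction ha with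
      | one => exact ⟨1, 0, by simp⟩
      | t_mul k _ ih =>
        obtain ⟨f, g, rfl⟩ := ih
        have ht : ∃ T, (tVar k : Form K 1) = pf K T := by
          fin_cases k
          · exact ⟨X, by simp [pf]⟩
          · exact ⟨1 - X, tVar_one_eq⟩
        obtain ⟨T, hT⟩ := ht
        exact ⟨T * f, T * g, by
          rw [hT, mul_add, map_mul, pfdt_apply, pfdt_apply, map_mul, mul_assoc]⟩
      | dt_mul k _ ih =>
        obtain ⟨f, g, rfl⟩ := ih
        have hd : ∃ c : K, (dtVar k : Form K 1) = c • dtVar 0 := by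
          fin_cases k
          · exact ⟨1, by simp⟩
          · exact ⟨-1, by simpa using dtVar_one_eq⟩
        obtain ⟨c, hc⟩ := hd
        refine ⟨0, c • f, ?_⟩
        rw [hc, smul_mul_assoc, mul_add, pfdt_apply, ← mul_assoc, dt_mul_pf, dt_mul_pf, mul_assoc,
          dt_mul_dt, mul_zero, add_zero, map_zero, zero_add, map_smul, pfdt_apply]
  obtain ⟨f, g, rfl⟩ := key
  simp only [map_add, pi0_pf, pi0_pfdt, pi1_pf, pi1_pfdt, add_zero, zero_add]

theorem pi_of_mem {i : ℤ} {a : Form K 1} (ha : a ∈ formGr K 1 i) :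
    (i ≠ 0 → pi0 K a = 0) ∧ (i ≠ 1 → pi1 K a = 0) := by
  refine formGr_ind (P := fun a => (i ≠ 0 → pi0 K a = 0) ∧ (i ≠ 1 → pi1 K a = 0))
    (by simp) (fun x y hx hy => ⟨fun h => by rw [map_add, hx.1 h, hy.1 h, add_zero],
      fun h => by rw [map_add, hx.2 h, hy.2 h, add_zero]⟩)
    (fun c x hx => ⟨fun h => by rw [map_smul, hx.1 h, smul_zero],
      fun h => by rw [map_smul, hx.2 h, smul_zero]⟩) ?_ ha
  clear ha
  intro a ha
  induction ha with
  | one => exact ⟨fun h => absurd rfl h, fun _ => by simp [pi1_apply]⟩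
  | @t_mul k i a _ ih =>
    have ht : ∃ T, formDual K (tVar k) = TrivSqZeroExt.inl T := by
      fin_cases k
      · exact ⟨X, by simp [formDual, Form.lift_t]⟩
      · exact ⟨1 - X, by rw [← formDual_pf]; exact congrArg _ tVar_one_eq⟩
    obtain ⟨T, hT⟩ := ht
    simp only [pi0_apply, pi1_apply, map_mul, hT] at ih ⊢
    refine ⟨fun h => by simp [ih.1 h], fun h => by simp [ih.2 h]⟩
  | @dt_mul k i a _ ih =>
    have hd : ∃ c, formDual K (dtVar k) = TrivSqZeroExt.inr c := by
      fin_cases k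
      · exact ⟨1, formDual_dt⟩
      · exact ⟨-1, by simp [formDual, Form.lift_dt]⟩
    obtain ⟨c, hc⟩ := hd
    simp only [pi0_apply, pi1_apply, map_mul, hc] at ih ⊢
    refine ⟨fun _ => by simp, fun h => ?_⟩
    have h0 : i ≠ 0 := fun h0 => h (by rw [h0, zero_add])
    simp [ih.1 h0]

theorem pf_mem (f : K[X]) : pf K f ∈ formGr K 1 0 := by
  induction f using Polynomial.induction_on' with
  | add f g hf hg => rw [map_add]; exact Submodule.add_mem _ hf hg
  | monomial n a =>
    rw [pf, aeval_monomial, ← Algebra.smul_def]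
    refine Submodule.smul_mem _ _ ?_
    induction n with
    | zero => rw [pow_zero]; exact Submodule.subset_span IsMonomial.one
    | succ n ih => rw [pow_succ']; exact tVar_mul_mem 0 ih

theorem pfdt_mem (f : K[X]) : pfdt K f ∈ formGr K 1 1 := by
  have := dtVar_mul_mem 0 (pf_mem f)
  rwa [dt_mul_pf, zero_add] at this

theorem formD_pf (f : K[X]) : formD K 1 (pf K f) = pfdt K (derivative f) := by
  induction f using Polynomial.induction_on' with
  | add f g hf hg => simp only [map_add, hf, hg]
  | monomial n a =>
    rw [← C_mul_X_pow_eq_monomial, ← smul_eq_C_mul, map_smul, map_smul, derivative_smul, map_smul]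
    congr 1
    induction n with
    | zero => simp [formD_one]
    | succ n ih =>
      have hX : pf K X = tVar 0 := by simp [pf]
      rw [pow_succ', map_mul, hX, formD_tVar_mul, ih, dt_mul_pf, derivative_mul, derivative_X,
        one_mul, map_add, pfdt_apply, pfdt_apply, pfdt_apply, map_mul, hX, mul_assoc]

theorem formD_pfdt [CharZero K] (f : K[X]) : formD K 1 (pfdt K f) = 0 := by
  rw [pfdt_apply, ← dt_mul_pf, formD_dtVar_mul, formD_pf, pfdt_apply, ← dt_mul_pf, ← mul_assoc,
    dt_mul_dt, zero_mul, neg_zero]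

end IntervalForms

/-! ### The calculus of `p(t) + q(t) dt` -/

section Interval

open Polynomial

variable {K : Type u} [Field K] (L : DGLA.{u, v} K) (A : ArtAlg.{u} K)

/-- The forms on the `1`-simplex of degree `0`, with coefficients in `L ⊗ 𝔪_A`, from
polynomials in `t`. -/
noncomputable def polyFun : PolyMod K (L.ext A) →ₗ[K] (tensor (forms K 1) L).ext A :=
  polyIn (Ω := forms K 1) (pf K).toLinearMap

/-- The forms `q(t) dt` on the `1`-simplex, with coefficients in `L ⊗ 𝔪_A`. -/
noncomputable def polyDt : PolyMod K (L.ext A) →ₗ[K] (tensor (forms K 1) L).ext A :=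
  polyIn (Ω := forms K 1) (pfdt K)

/-- The part `p(t)` of the form `p(t) + q(t) dt`. -/
noncomputable def funPart : (tensor (forms K 1) L).ext A →ₗ[K] PolyMod K (L.ext A) :=
  polyOut (Ω := forms K 1) (pi0 K)

/-- The part `q(t)` of the form `p(t) + q(t) dt`. -/
noncomputable def dtPart : (tensor (forms K 1) L).ext A →ₗ[K] PolyMod K (L.ext A) :=
  polyOut (Ω := forms K 1) (pi1 K)

variable {L A}

theorem polyFun_tmul (f : K[X]) (n : L.ext A) :
    polyFun L A (f ⊗ₜ n) = formMul (forms K 1) L A (pf K f) n := rfl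

theorem polyDt_tmul (f : K[X]) (n : L.ext A) :
    polyDt L A (f ⊗ₜ n) = formMul (forms K 1) L A (pfdt K f) n := rfl

theorem funPart_formMul (ω : Form K 1) (n : L.ext A) :
    funPart L A (formMul (forms K 1) L A ω n) = pi0 K ω ⊗ₜ n :=
  polyOut_formMul (Ω := forms K 1) (pi0 K) ω n

theorem dtPart_formMul (ω : Form K 1) (n : L.ext A) :
    dtPart L A (formMul (forms K 1) L A ω n) = pi1 K ω ⊗ₜ n :=
  polyOut_formMul (Ω := forms K 1) (pi1 K) ω n

theorem funPart_polyFun (p : PolyMod K (L.ext A)) : funPart L A (polyFun L A p) = p := by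
  induction p using TensorProduct.induction_on with
  | zero => simp only [map_zero]
  | add p q hp hq => simp only [map_add, hp, hq]
  | tmul f n => rw [polyFun_tmul, funPart_formMul, pi0_pf]

theorem dtPart_polyFun (p : PolyMod K (L.ext A)) : dtPart L A (polyFun L A p) = 0 := by
  induction p using TensorProduct.induction_on with
  | zero => simp only [map_zero]
  | add p q hp hq => simp only [map_add, hp, hq, add_zero]
  | tmul f n => rw [polyFun_tmul, dtPart_formMul, pi1_pf, zero_tmul]

theorem funPart_polyDt (p : PolyMod K (L.ext A)) : funPart L A (polyDt L A p) = 0 := by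
  induction p using TensorProduct.induction_on with
  | zero => simp only [map_zero]
  | add p q hp hq => simp only [map_add, hp, hq, add_zero]
  | tmul f n => rw [polyDt_tmul, funPart_formMul, pi0_pfdt, zero_tmul]

theorem dtPart_polyDt (p : PolyMod K (L.ext A)) : dtPart L A (polyDt L A p) = p := by
  induction p using TensorProduct.induction_on with
  | zero => simp only [map_zero]
  | add p q hp hq => simp only [map_add, hp, hq]
  | tmul f n => rw [polyDt_tmul, dtPart_formMul, pi1_pfdt]

theorem polyFun_add_polyDt [CharZero K] (z : (tensor (forms K 1) L).ext A) :
    polyFun L A (funPart L A z) + polyDt L A (dtPart L A z) = z := by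
  refine formMul_ind (P := fun z => polyFun L A (funPart L A z) +
    polyDt L A (dtPart L A z) = z) ?_ (fun x y hx hy => ?_) (fun (ω : Form K 1) n => ?_) z
  · simp only [map_zero, add_zero]
  · simp only [map_add]
    rw [add_add_add_comm, hx, hy]
  · rw [funPart_formMul, dtPart_formMul, polyFun_tmul, polyDt_tmul]
    refine (formMul_add_left (Ω := forms K 1) _ _ n).symm.trans ?_
    exact congrArg (fun ω => formMul (forms K 1) L A ω n) (form_one_eq ω).symm

theorem interval_ext [CharZero K] {z w : (tensor (forms K 1) L).ext A}
    (h0 : funPart L A z = funPart L A w) (h1 : dtPart L A z = dtPart L A w) : z = w := by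
  rw [← polyFun_add_polyDt z, h0, h1, polyFun_add_polyDt]

theorem polyFun_mem {k : ℤ} {p : PolyMod K (L.ext A)} (hp : p ∈ polySub (L.extGr A k)) :
    polyFun L A p ∈ (tensor (forms K 1) L).extGr A k := by
  refine polySub_ind (P := fun p => polyFun L A p ∈ (tensor (forms K 1) L).extGr A k) ?_
    (fun x y hx hy => by rw [map_add]; exact Submodule.add_mem _ hx hy) (fun f n hn => ?_) hp
  · rw [map_zero]; exact Submodule.zero_mem _
  · have := formMul_mem (Ω := forms K 1) (pf_mem f) hn
    rwa [zero_add] at this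

theorem polyDt_mem {k : ℤ} {p : PolyMod K (L.ext A)} (hp : p ∈ polySub (L.extGr A k)) :
    polyDt L A p ∈ (tensor (forms K 1) L).extGr A (k + 1) := by
  refine polySub_ind (P := fun p => polyDt L A p ∈ (tensor (forms K 1) L).extGr A (k + 1)) ?_
    (fun x y hx hy => by rw [map_add]; exact Submodule.add_mem _ hx hy) (fun f n hn => ?_) hp
  · rw [map_zero]; exact Submodule.zero_mem _
  · have := formMul_mem (Ω := forms K 1) (pfdt_mem f) hn
    rwa [add_comm] at this

theorem funPart_mem {k : ℤ} {z : (tensor (forms K 1) L).ext A}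
    (hz : z ∈ (tensor (forms K 1) L).extGr A k) : funPart L A z ∈ polySub (L.extGr A k) := by
  refine extGr_formMul_ind (P := fun z => funPart L A z ∈ polySub (L.extGr A k)) ?_
    (fun x y hx hy => by rw [map_add]; exact Submodule.add_mem _ hx hy)
    (fun i j hij (ω : Form K 1) hω n hn => ?_) hz
  · rw [map_zero]; exact Submodule.zero_mem _
  · rw [funPart_formMul]
    by_cases hi : i = 0
    · rw [hi, zero_add] at hij
      exact tmul_mem_polySub _ (hij ▸ hn)
    · rw [(pi_of_mem hω).1 hi, zero_tmul]; exact Submodule.zero_mem _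

theorem dtPart_mem {k : ℤ} {z : (tensor (forms K 1) L).ext A}
    (hz : z ∈ (tensor (forms K 1) L).extGr A (k + 1)) :
    dtPart L A z ∈ polySub (L.extGr A k) := by
  refine extGr_formMul_ind (P := fun z => dtPart L A z ∈ polySub (L.extGr A k)) ?_
    (fun x y hx hy => by rw [map_add]; exact Submodule.add_mem _ hx hy)
    (fun i j hij (ω : Form K 1) hω n hn => ?_) hz
  · rw [map_zero]; exact Submodule.zero_mem _
  · rw [dtPart_formMul]
    by_cases hi : i = 1
    · have : j = k := by omega
      exact tmul_mem_polySub _ (this ▸ hn)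
    · rw [(pi_of_mem hω).2 hi, zero_tmul]; exact Submodule.zero_mem _

theorem extD_polyFun (p : PolyMod K (L.ext A)) :
    (tensor (forms K 1) L).extD A (polyFun L A p) =
      polyFun L A (polyMap (L.extD A) p) + polyDt L A (polyD K _ p) := by
  induction p using TensorProduct.induction_on with
  | zero => simp only [map_zero, add_zero]
  | add p q hp hq => simp only [map_add, hp, hq]; abel
  | tmul f n =>
    rw [polyFun_tmul]
    refine (extD_formMul (Ω := forms K 1) (pf_mem f) n).trans ?_
    rw [zpow_zero, one_smul, add_comm]
    exact congrArg₂ (· + ·) rfl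
      (congrArg (fun ω => formMul (forms K 1) L A ω n) (formD_pf f))

theorem extD_polyDt [CharZero K] (p : PolyMod K (L.ext A)) :
    (tensor (forms K 1) L).extD A (polyDt L A p) = -polyDt L A (polyMap (L.extD A) p) := by
  induction p using TensorProduct.induction_on with
  | zero => simp only [map_zero, neg_zero]
  | add p q hp hq => simp only [map_add, hp, hq, neg_add]
  | tmul f n =>
    rw [polyDt_tmul]
    refine (extD_formMul (Ω := forms K 1) (pfdt_mem f) n).trans ?_
    have h : formMul (forms K 1) L A ((forms K 1).d (pfdt K f)) n = 0 :=
      (congrArg (fun ω => formMul (forms K 1) L A ω n) (formD_pfdt f)).trans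
        (formMul_zero_left n)
    rw [h, zpow_one, neg_smul, one_smul, zero_add]
    rfl

theorem extBr_polyFun_polyFun {j : ℤ} {p : PolyMod K (L.ext A)}
    (hp : p ∈ polySub (L.extGr A j)) (q : PolyMod K (L.ext A)) :
    (tensor (forms K 1) L).extBr A (polyFun L A p) (polyFun L A q) =
      polyFun L A (polyBr (L.extBr A) p q) := by
  refine polySub_ind (P := fun p => (tensor (forms K 1) L).extBr A (polyFun L A p)
    (polyFun L A q) = polyFun L A (polyBr (L.extBr A) p q))
    (by simp only [map_zero, LinearMap.zero_apply])
    (fun x y hx hy => by simp only [map_add, LinearMap.add_apply, hx, hy]) (fun f n hn => ?_) hp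
  induction q using TensorProduct.induction_on with
  | zero => simp only [map_zero]
  | add p q hp hq => simp only [map_add, hp, hq]
  | tmul g m =>
    refine (extBr_formMul (Ω := forms K 1) (pf_mem g) hn).trans ?_
    rw [mul_zero, zpow_zero, one_smul, polyBr_tmul, polyFun_tmul]
    exact congrArg (fun ω => formMul (forms K 1) L A ω _) (map_mul (pf K) f g).symm

/-- Moving `dt` past a coefficient of degree `j` costs the sign `(-1)^j`. -/
theorem extBr_polyFun_polyDt {j : ℤ} {p : PolyMod K (L.ext A)}
    (hp : p ∈ polySub (L.extGr A j)) (q : PolyMod K (L.ext A)) :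
    (tensor (forms K 1) L).extBr A (polyFun L A p) (polyDt L A q) =
      (-1 : K) ^ j • polyDt L A (polyBr (L.extBr A) p q) := by
  refine polySub_ind (P := fun p => (tensor (forms K 1) L).extBr A (polyFun L A p)
    (polyDt L A q) = (-1 : K) ^ j • polyDt L A (polyBr (L.extBr A) p q))
    (by simp only [map_zero, LinearMap.zero_apply, smul_zero])
    (fun x y hx hy => by simp only [map_add, LinearMap.add_apply, hx, hy, smul_add])
    (fun f n hn => ?_) hp
  induction q using TensorProduct.induction_on with
  | zero => simp only [map_zero, smul_zero]
  | add p q hp hq => simp only [map_add, hp, hq, smul_add]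
  | tmul g m =>
    refine (extBr_formMul (Ω := forms K 1) (pfdt_mem g) hn).trans ?_
    rw [mul_one, polyBr_tmul, polyDt_tmul]
    refine congrArg (fun ω => (-1 : K) ^ j • formMul (forms K 1) L A ω _) ?_
    change pf K f * (pf K g * dtVar 0) = pf K (f * g) * dtVar 0
    rw [map_mul, mul_assoc]

theorem extBr_polyDt_polyFun {j : ℤ} {p : PolyMod K (L.ext A)}
    (hp : p ∈ polySub (L.extGr A j)) (q : PolyMod K (L.ext A)) :
    (tensor (forms K 1) L).extBr A (polyDt L A p) (polyFun L A q) =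
      polyDt L A (polyBr (L.extBr A) p q) := by
  refine polySub_ind (P := fun p => (tensor (forms K 1) L).extBr A (polyDt L A p)
    (polyFun L A q) = polyDt L A (polyBr (L.extBr A) p q))
    (by simp only [map_zero, LinearMap.zero_apply])
    (fun x y hx hy => by simp only [map_add, LinearMap.add_apply, hx, hy]) (fun f n hn => ?_) hp
  induction q using TensorProduct.induction_on with
  | zero => simp only [map_zero]
  | add p q hp hq => simp only [map_add, hp, hq]
  | tmul g m =>
    refine (extBr_formMul (Ω := forms K 1) (pf_mem g) hn).trans ?_
    rw [mul_zero, zpow_zero, one_smul, polyBr_tmul, polyDt_tmul]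
    refine congrArg (fun ω => formMul (forms K 1) L A ω _) ?_
    change pf K f * dtVar 0 * pf K g = pf K (f * g) * dtVar 0
    rw [mul_assoc, dt_mul_pf, map_mul, mul_assoc]

theorem extBr_polyDt_polyDt [CharZero K] {j : ℤ} {p : PolyMod K (L.ext A)}
    (hp : p ∈ polySub (L.extGr A j)) (q : PolyMod K (L.ext A)) :
    (tensor (forms K 1) L).extBr A (polyDt L A p) (polyDt L A q) = 0 := by
  refine polySub_ind (P := fun p => (tensor (forms K 1) L).extBr A (polyDt L A p)
    (polyDt L A q) = 0)
    (by simp only [map_zero, LinearMap.zero_apply])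
    (fun x y hx hy => by simp only [map_add, LinearMap.add_apply, hx, hy, add_zero])
    (fun f n hn => ?_) hp
  induction q using TensorProduct.induction_on with
  | zero => simp only [map_zero]
  | add p q hp hq => simp only [map_add, hp, hq, add_zero]
  | tmul g m =>
    refine (extBr_formMul (Ω := forms K 1) (pfdt_mem g) hn).trans ?_
    have h : pfdt K f * pfdt K g = 0 := by
      rw [pfdt_apply, pfdt_apply, mul_assoc, ← mul_assoc _ _ (dtVar 0), dt_mul_pf, mul_assoc,
        dt_mul_dt, mul_zero, mul_zero]
    have h' : formMul (forms K 1) L A (pfdt K f * pfdt K g : Form K 1) (L.extBr A n m) = 0 :=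
      (congrArg (fun ω => formMul (forms K 1) L A ω _) h).trans (formMul_zero_left _)
    exact (congrArg _ h').trans (smul_zero _)

/-- The gauge action of functions on functions. -/
theorem gauge_polyFun {p : PolyMod K (L.ext A)} (hp : p ∈ polySub (L.extGr A 0))
    (z : PolyMod K (L.ext A)) :
    (tensor (forms K 1) L).gauge A (polyFun L A p) (polyFun L A z) =
      polyFun L A (gauge (polyMap (L.extD A)) (polyBr (L.extBr A)) p z) -
        polyDt L A (expm (polyBr (L.extBr A)) p (polyD K _ p)) := by
  have hN := (L.nilFiltration A).poly
  have hT := (tensor (forms K 1) L).nilFiltration A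
  have h0 : ∀ x, polyFun L A (polyBr (L.extBr A) p x) =
      (tensor (forms K 1) L).extBr A (polyFun L A p) (polyFun L A x) :=
    fun x => (extBr_polyFun_polyFun hp x).symm
  have h1 : ∀ x, polyDt L A (polyBr (L.extBr A) p x) =
      (tensor (forms K 1) L).extBr A (polyFun L A p) (polyDt L A x) :=
    fun x => by rw [extBr_polyFun_polyDt hp, zpow_zero, one_smul]
  -- The only source of `dt` is `-d p`, which contributes `-p' dt`. Bracketing with `p` keeps
  -- function parts and `dt`-parts separate, so the series splits and the `dt`-part does not involve
  -- `z`.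
  rw [DGLA.gauge_eq, gauge_eq_expm, map_add, hN.map_expm hT _ h0, hN.map_expm hT _ h1, map_sub,
    h0, extD_polyFun, add_sub_assoc, sub_add_eq_sub_sub, sub_eq_add_neg _ (polyDt L A _),
    hT.expm_add, hT.expm_neg, ← sub_eq_add_neg]

end Interval

/-! ### Restriction to the endpoints and forms on a point -/

section Faces

open Polynomial

variable {K : Type u} [Field K]

theorem tVar_zero_eq : (tVar 0 : Form K 0) = 1 := by
  simpa using sum_tVar (K := K) (n := 0)

theorem dtVar_zero_eq : (dtVar 0 : Form K 0) = 0 := by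
  simpa using sum_dtVar (K := K) (n := 0)

/-- Both sides are algebra maps out of `K[X]`, so comparison at `X` suffices: `t_0` is 0 on the face
of index 0 and, being the only surviving coordinate, 1 on the face of index 1. -/
theorem faceAlg_pf (k : Fin 2) (f : K[X]) :
    faceAlg K 0 k (pf K f) = algebraMap K (Form K 0) (f.eval (k : ℕ)) := by
  have h : (faceAlg K 0 k).comp (pf K) = (Algebra.ofId K (Form K 0)).comp (aeval ((k : ℕ) : K)) := by
    ext
    fin_cases k
    · simp [pf, faceAlg, Form.lift_t]
    · simp [pf, faceAlg, Form.lift_t]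
      exact (Fin.insertNth_apply_succAbove (α := fun _ => Form K 0) 1 0 tVar 0).trans
        tVar_zero_eq
  simpa [aeval_def] using AlgHom.congr_fun h f

theorem faceAlg_pfdt (k : Fin 2) (f : K[X]) : faceAlg K 0 k (pfdt K f) = 0 := by
  have : faceAlg K 0 k (dtVar 0) = 0 := by
    fin_cases k
    · simp [faceAlg, Form.lift_dt]
    · simp [faceAlg, Form.lift_dt]
      exact (Fin.insertNth_apply_succAbove (α := fun _ => Form K 0) 1 0 dtVar 0).trans
        dtVar_zero_eq
  rw [pfdt_apply, map_mul, this, mul_zero]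

variable {L : DGLA.{u, v} K} {A : ArtAlg.{u} K}

theorem face_ext [CharZero K] (k : Fin 2) (z : (tensor (forms K 1) L).ext A) :
    (tensorMap (face K 0 k) (DGLA.Hom.id L)).ext A z =
      formMul (forms K 0) L A 1 (polyEval ((k : ℕ) : K) (funPart L A z)) := by
  refine formMul_ind (P := fun z => (tensorMap (face K 0 k) (DGLA.Hom.id L)).ext A z =
      formMul (forms K 0) L A 1 (polyEval ((k : ℕ) : K) (funPart L A z))) ?_
    (fun x y hx hy => by simp only [map_add, hx, hy]) (fun (ω : Form K 1) n => ?_) z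
  · simp only [map_zero]
  · have hid : (DGLA.Hom.id L).ext A n = n := LinearMap.rTensor_id_apply _ _ n
    have hω : faceAlg K 0 k ω = (pi0 K ω).eval ((k : ℕ) : K) • (1 : Form K 0) := by
      conv_lhs => rw [form_one_eq ω]
      rw [map_add, faceAlg_pf, faceAlg_pfdt, add_zero, Algebra.algebraMap_eq_smul_one]
    have hr : polyEval ((k : ℕ) : K) (funPart L A (formMul (forms K 1) L A ω n)) =
        (pi0 K ω).eval ((k : ℕ) : K) • n := by rw [funPart_formMul, polyEval_tmul]
    refine (tensorMap_ext_formMul (Ω := forms K (0 + 1)) (face K 0 k) _ ω n).trans ?_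
    rw [hid]
    refine (congrArg (fun ω => formMul (forms K 0) L A ω n) hω).trans
      ((formMul_smul_left _ _ n).trans ?_)
    exact ((congrArg (formMul (forms K 0) L A 1) hr).trans (map_smul _ _ n)).symm

/-- Forms on the point are scalars. -/
noncomputable def pointForm (K : Type u) [Field K] : Form K 0 →ₐ[K] K :=
  Form.lift (fun _ => 1) (fun _ => 0) (fun _ _ => rfl) (fun _ _ => by simp) (fun _ _ => by simp)
    (by simp) (by simp)

theorem form_zero_eq (ω : Form K 0) : ω = pointForm K ω • 1 := by
  refine form_ind (P := fun ω => ω = pointForm K ω • 1) (by simp)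
    (fun x y hx hy => by rw [map_add, add_smul, ← hx, ← hy])
    (fun c x hx => by rw [map_smul, smul_assoc, ← hx]) (fun i a ha => ?_) ω
  induction ha with
  | one => simp
  | t_mul k _ ih =>
    rw [Fin.fin_one_eq_zero k, tVar_zero_eq, one_mul]
    exact ih
  | dt_mul k _ ih => rw [Fin.fin_one_eq_zero k, dtVar_zero_eq, zero_mul, map_zero, zero_smul]

theorem pointForm_of_mem {i : ℤ} {ω : Form K 0} (hω : ω ∈ formGr K 0 i) (hi : i ≠ 0) :
    pointForm K ω = 0 := by
  refine formGr_ind (P := fun ω => pointForm K ω = 0) (map_zero _)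
    (fun x y hx hy => by rw [map_add, hx, hy, add_zero])
    (fun c x hx => by rw [map_smul, hx, smul_zero]) (fun a ha => ?_) hω
  clear hω
  induction ha with
  | one => exact absurd rfl hi
  | t_mul k _ ih => rw [map_mul, ih hi, mul_zero]
  | dt_mul k _ ih => rw [Fin.fin_one_eq_zero k, dtVar_zero_eq, zero_mul, map_zero]

/-- Forms on the point with coefficients in `L ⊗ 𝔪_A` are elements of `L ⊗ 𝔪_A`. -/
theorem exists_formMul_one {k : ℤ} {z : (tensor (forms K 0) L).ext A}
    (hz : z ∈ (tensor (forms K 0) L).extGr A k) :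
    ∃ n ∈ L.extGr A k, z = formMul (forms K 0) L A 1 n := by
  refine extGr_formMul_ind (P := fun z => ∃ n ∈ L.extGr A k, z = formMul (forms K 0) L A 1 n)
    ⟨0, Submodule.zero_mem _, (map_zero _).symm⟩ ?_ (fun i j hij ω hω n hn => ?_) hz
  · rintro _ _ ⟨n, hn, rfl⟩ ⟨m, hm, rfl⟩
    exact ⟨n + m, Submodule.add_mem _ hn hm, (map_add _ _ _).symm⟩
  · have h : formMul (forms K 0) L A ω n = pointForm K ω • formMul (forms K 0) L A 1 n :=
      (congrArg (fun ω => formMul (forms K 0) L A ω n) (form_zero_eq ω)).trans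
        (formMul_smul_left _ _ n)
    refine ⟨pointForm K ω • n, ?_, by rw [h, map_smul]⟩
    by_cases hi : i = 0
    · have : j = k := by omega
      exact Submodule.smul_mem _ _ (this ▸ hn)
    · rw [pointForm_of_mem hω hi, zero_smul]; exact Submodule.zero_mem _

/-- The scalar value of a form on the point gives a retraction, and flatness carries injectivity
over to coefficients in `𝔪_A`. -/
theorem formMul_one_injective : Function.Injective (formMul (forms K 0) L A 1) := by
  have h : Function.Injective (TensorProduct.mk K (Form K 0) L.carrier 1) := by
    intro x y hxy
    have := congrArg (TensorProduct.lid K L.carrier ∘ (pointForm K).toLinearMap.rTensor _) hxy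
    simpa using this
  exact Module.Flat.rTensor_preserves_injective_linearMap (M := A.max) _ h

end Faces

/-! ### Constant forms and Maurer-Cartan elements -/

section FormMulOne

variable {K : Type u} [Field K] {Ω : CDGA.{u, u} K} {L : DGLA.{u, v} K} {A : ArtAlg.{u} K}

theorem cdga_d_one : Ω.d 1 = 0 := by
  have := Ω.leibniz 0 1 Ω.one_mem 1
  simpa using this

theorem extD_formMul_one (n : L.ext A) :
    (tensor Ω L).extD A (formMul Ω L A 1 n) = formMul Ω L A 1 (L.extD A n) := by
  rw [extD_formMul Ω.one_mem, cdga_d_one, formMul_zero_left, zero_add, zpow_zero, one_smul]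

theorem formMul_one_isMC {n : L.ext A} (hn : L.IsMC A n) :
    (tensor Ω L).IsMC A (formMul Ω L A 1 n) := by
  refine ⟨?_, ?_⟩
  · have := formMul_mem Ω.one_mem hn.1
    rwa [zero_add] at this
  · rw [extD_formMul_one, extBr_formMul Ω.one_mem hn.1, mul_zero, zpow_zero, one_smul, mul_one,
      ← map_smul, ← map_add, hn.2, map_zero]

theorem isMC_of_formMul_one {n : L.ext A} (hinj : Function.Injective (formMul Ω L A 1))
    (hn : n ∈ L.extGr A 1) (h : (tensor Ω L).IsMC A (formMul Ω L A 1 n)) : L.IsMC A n := by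
  refine ⟨hn, hinj ?_⟩
  have := h.2
  rwa [extD_formMul_one, extBr_formMul Ω.one_mem hn, mul_zero, zpow_zero, one_smul, mul_one,
    ← map_smul, ← map_add, ← map_zero (formMul Ω L A 1)] at this

end FormMulOne

/-! ### Polynomials as finitely supported sequences of coefficients -/

section PolyFinsupp

open Polynomial

variable {K : Type u} [Field K] (V : Type w) [AddCommGroup V] [Module K V]

variable (K) in
/-- The polynomial with given coefficients. -/
noncomputable def polyOfCoeff : (ℕ →₀ V) →ₗ[K] PolyMod K V :=
  Finsupp.lsum K fun k => TensorProduct.mk K K[X] V (X ^ k)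

variable {V}

theorem polyOfCoeff_single (k : ℕ) (x : V) :
    polyOfCoeff K V (Finsupp.single k x) = (X ^ k : K[X]) ⊗ₜ x := by
  simp [polyOfCoeff]

variable (K V) in
/-- The coefficients of a polynomial. -/
noncomputable def polyCoeff : PolyMod K V →ₗ[K] (ℕ →₀ V) :=
  TensorProduct.lift ((Finsupp.lsum K (M := K) fun k =>
    (LinearMap.toSpanSingleton K (V →ₗ[K] (ℕ →₀ V)) (Finsupp.lsingle k))) ∘ₗ
      (Polynomial.basisMonomials K).repr.toLinearMap)

theorem polyCoeff_tmul (k : ℕ) (x : V) :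
    polyCoeff K V ((X ^ k : K[X]) ⊗ₜ x) = Finsupp.single k x := by
  have : (Polynomial.basisMonomials K).repr (X ^ k) = Finsupp.single k 1 := by
    rw [← Polynomial.monomial_one_right_eq_X_pow]
    exact Module.Basis.repr_self (Polynomial.basisMonomials K) k
  simp [polyCoeff, this]

theorem polyMod_ind {P : PolyMod K V → Prop} (hadd : ∀ p q, P p → P q → P (p + q))
    (h : ∀ (k : ℕ) x, P ((X ^ k : K[X]) ⊗ₜ x)) (p) : P p := by
  induction p using TensorProduct.induction_on with
  | zero => simpa using h 0 0
  | add p q hp hq => exact hadd p q hp hq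
  | tmul f x =>
    induction f using Polynomial.induction_on' with
    | add f g hf hg => rw [add_tmul]; exact hadd _ _ hf hg
    | monomial n a =>
      rw [← C_mul_X_pow_eq_monomial, ← smul_eq_C_mul, smul_tmul]
      exact h n _

theorem polyOfCoeff_polyCoeff (p : PolyMod K V) : polyOfCoeff K V (polyCoeff K V p) = p :=
  polyMod_ind (P := fun p => polyOfCoeff K V (polyCoeff K V p) = p)
    (fun p q hp hq => by rw [map_add, map_add, hp, hq])
    (fun k x => by rw [polyCoeff_tmul, polyOfCoeff_single]) p

theorem polyCoeff_polyOfCoeff (p : ℕ →₀ V) : polyCoeff K V (polyOfCoeff K V p) = p := by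
  induction p using Finsupp.induction_linear with
  | zero => simp
  | add p q hp hq => rw [map_add, map_add, hp, hq]
  | single k x => rw [polyOfCoeff_single, polyCoeff_tmul]

theorem polyEval_zero_polyOfCoeff (p : ℕ →₀ V) : polyEval 0 (polyOfCoeff K V p) = p 0 := by
  induction p using Finsupp.induction_linear with
  | zero => simp
  | add p q hp hq => rw [map_add, map_add, hp, hq, Finsupp.add_apply]
  | single k x =>
    rw [polyOfCoeff_single, polyEval_tmul]
    cases k <;> simp

theorem polyEval_one_polyOfCoeff (p : ℕ →₀ V) :
    polyEval 1 (polyOfCoeff K V p) = p.sum fun _ c => c := by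
  induction p using Finsupp.induction_linear with
  | zero => simp
  | add p q hp hq =>
    rw [map_add, map_add, hp, hq, Finsupp.sum_add_index' (fun _ => rfl) fun _ _ _ => rfl]
  | single k x => rw [polyOfCoeff_single, polyEval_tmul]; simp

theorem polyOfCoeff_mem {S : Submodule K V} {p : ℕ →₀ V} (hp : ∀ k, p k ∈ S) :
    polyOfCoeff K V p ∈ polySub S :=
  Submodule.sum_mem _ fun k _ => tmul_mem_polySub (X ^ k : K[X]) (hp k)

theorem polyCoeff_mem {S : Submodule K V} {p : PolyMod K V} (hp : p ∈ polySub S) (k : ℕ) :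
    polyCoeff K V p k ∈ S := by
  obtain ⟨q, rfl⟩ := hp
  refine polyMod_ind (P := fun q => polyCoeff K V (polyMap S.subtype q) k ∈ S)
    (fun p q hp hq => by rw [map_add, map_add]; exact Submodule.add_mem _ hp hq)
    (fun l x => ?_) q
  have : polyMap S.subtype ((X ^ l : K[X]) ⊗ₜ x) = (X ^ l : K[X]) ⊗ₜ (x : V) := rfl
  rw [this, polyCoeff_tmul, Finsupp.single_apply]
  split_ifs
  · exact x.2
  · exact Submodule.zero_mem _

theorem polyForm_eq (L : DGLA.{u, v} K) (A : ArtAlg.{u} K) (p : ℕ →₀ L.ext A) :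
    polyForm L A p = polyFun L A (polyOfCoeff K _ p) := by
  rw [polyForm, polyOfCoeff, Finsupp.lsum_apply, map_finsuppSum]
  refine Finsupp.sum_congr fun k _ => ?_
  refine congrArg (fun ω => formMul (forms K 1) L A ω (p k)) ?_
  change (tVar 0 : Form K 1) ^ k = pf K (X ^ k)
  rw [map_pow, pf, aeval_X]

theorem polyEvalOne_eq (L : DGLA.{u, v} K) (A : ArtAlg.{u} K) (p : ℕ →₀ L.ext A) :
    polyEvalOne L A p = polyEval 1 (polyOfCoeff K _ p) := (polyEval_one_polyOfCoeff p).symm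

end PolyFinsupp

/-! ### Components of a gauge transform on the interval -/

section IntervalGauge

open Polynomial

variable {K : Type u} [Field K] {L : DGLA.{u, v} K} {A : ArtAlg.{u} K}

theorem funPart_gauge_polyFun {p : PolyMod K (L.ext A)} (hp : p ∈ polySub (L.extGr A 0))
    (z : PolyMod K (L.ext A)) :
    funPart L A ((tensor (forms K 1) L).gauge A (polyFun L A p) (polyFun L A z)) =
      gauge (polyMap (L.extD A)) (polyBr (L.extBr A)) p z := by
  rw [gauge_polyFun hp, map_sub, funPart_polyFun, funPart_polyDt, sub_zero]

theorem dtPart_gauge_polyFun {p : PolyMod K (L.ext A)} (hp : p ∈ polySub (L.extGr A 0))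
    (z : PolyMod K (L.ext A)) :
    dtPart L A ((tensor (forms K 1) L).gauge A (polyFun L A p) (polyFun L A z)) =
      -expm (polyBr (L.extBr A)) p (polyD K _ p) := by
  rw [gauge_polyFun hp, map_sub, dtPart_polyFun, dtPart_polyDt, zero_sub]

theorem polyEval_gauge (c : K) (p z : PolyMod K (L.ext A)) :
    polyEval c (gauge (polyMap (L.extD A)) (polyBr (L.extBr A)) p z) =
      L.gauge A (polyEval c p) (polyEval c z) :=
  (L.nilFiltration A).poly.map_gauge _ (polyEval_polyBr _ c) (polyMap_polyEval _ c) p z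

theorem formMul_one_eq_polyFun (u : L.ext A) :
    formMul (forms K 1) L A 1 u = polyFun L A (1 ⊗ₜ u) :=
  congrArg (fun ω => formMul (forms K 1) L A ω u) (map_one (pf K)).symm

end IntervalGauge

/-! ### Maurer-Cartan elements on the interval -/

section IntervalMC

open Polynomial

variable {K : Type u} [Field K] [CharZero K] {L : DGLA.{u, v} K} {A : ArtAlg.{u} K}

/-- The solution of the differential equation of the gauge action stays in degree `0`. -/
theorem existsUnique_ode_zero {w : PolyMod K (L.ext A)} (hw : w ∈ polySub (L.extGr A 0)) :
    ∃! p : PolyMod K (L.ext A), p ∈ polySub (L.extGr A 0) ∧ polyEval 0 p = 0 ∧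
      expm (polyBr (L.extBr A)) p (polyD K _ p) = w := by
  obtain ⟨w, rfl⟩ := hw
  have hN := (L.nilLie_zeroBr A)
  have hinj := polyMap_injective (L.extGr A 0).injective_subtype
  have hexp : ∀ p : PolyMod K (L.extGr A 0),
      polyMap (L.extGr A 0).subtype (expm (polyBr (L.zeroBr A)) p (polyD K _ p)) =
        expm (polyBr (L.extBr A)) (polyMap (L.extGr A 0).subtype p)
          (polyD K _ (polyMap (L.extGr A 0).subtype p)) := fun p => by
    rw [← polyMap_polyD]
    exact hN.toNilFiltration.poly.map_expm (L.nilFiltration A).poly _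
      (fun x => polyMap_polyBr _ (fun _ _ => rfl) p x) _
  -- Solving the equation inside `L^0 ⊗ 𝔪_A` keeps the solution in degree 0; uniqueness comes back
  -- along the injective inclusion.
  obtain ⟨p, ⟨h0, h1⟩, hu⟩ := hN.toNilFiltration.existsUnique_ode hN.antitone 0 w
  refine ⟨polyMap (L.extGr A 0).subtype p, ⟨⟨p, rfl⟩, ?_, ?_⟩, ?_⟩
  · rw [polyMap_polyEval, h0, map_zero]
  · rw [← hexp, h1]
  · rintro _ ⟨⟨q, rfl⟩, hq0, hq1⟩
    refine congrArg _ (hu q ⟨?_, ?_⟩)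
    · rw [polyMap_polyEval] at hq0
      exact Subtype.ext hq0
    · rw [← hexp] at hq1
      exact hinj hq1

/-- The differential equation satisfied by the components of a Maurer-Cartan element. -/
theorem isMC_polyD_funPart {y : (tensor (forms K 1) L).ext A}
    (hy : (tensor (forms K 1) L).IsMC A y) :
    polyD K _ (funPart L A y) = polyMap (L.extD A) (dtPart L A y) +
      (1 / 2 : K) • (polyBr (L.extBr A) (funPart L A y) (dtPart L A y) -
        polyBr (L.extBr A) (dtPart L A y) (funPart L A y)) := by
  have h0 := funPart_mem hy.1
  have h1 := dtPart_mem (k := 0) hy.1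
  have h := hy.2
  rw [← polyFun_add_polyDt y] at h
  generalize funPart L A y = p at *
  generalize dtPart L A y = q at *
  -- Only the `dt`-component of the Maurer-Cartan equation is needed; with `dt dt = 0` it is linear
  -- in the function part.
  have h := congrArg (dtPart L A) h
  simp only [map_add, LinearMap.add_apply, map_smul, map_neg, map_zero, smul_add,
    extD_polyFun, extD_polyDt, extBr_polyFun_polyFun h0, extBr_polyFun_polyDt h0,
    extBr_polyDt_polyFun h1, extBr_polyDt_polyDt h1, dtPart_polyFun, dtPart_polyDt, zpow_one,
    smul_zero, zero_add, add_zero] at h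
  rw [← sub_eq_zero, ← h]
  module

/-- The equation is homogeneous and linear in `w`, and integrating it shows that `w` lies one step
deeper in the filtration than assumed. Applied to the difference of two Maurer-Cartan elements with
the same `dt`-part. -/
theorem eq_zero_of_polyD {w q : PolyMod K (L.ext A)} (h0 : polyEval 0 w = 0)
    (h : polyD K _ w =
      (1 / 2 : K) • (polyBr (L.extBr A) w q - polyBr (L.extBr A) q w)) : w = 0 := by
  have hN := (L.nilFiltration A).poly
  refine hN.eq_zero_of_forall_mem fun i hi => ?_
  have hw : w = polyInt K _ (polyD K _ w) := by
    rw [polyInt_polyD, h0, tmul_zero, sub_zero]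
  rw [hw, h]
  refine polyInt_mem (Submodule.smul_mem _ _ (Submodule.sub_mem _ ?_ ?_))
  · exact hN.bracket i 1 _ hi _ (hN.one q)
  · have := hN.bracket 1 i _ (hN.one q) _ hi
    rwa [add_comm] at this

/-- A Maurer-Cartan element on the interval is determined by its `dt`-part and its value at
`0`. -/
theorem isMC_ext {y z : (tensor (forms K 1) L).ext A} (hy : (tensor (forms K 1) L).IsMC A y)
    (hz : (tensor (forms K 1) L).IsMC A z)
    (h0 : polyEval 0 (funPart L A y) = polyEval 0 (funPart L A z))
    (h1 : dtPart L A y = dtPart L A z) : y = z := by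
  refine interval_ext (sub_eq_zero.mp (eq_zero_of_polyD (q := dtPart L A z) ?_ ?_)) h1
  · rw [map_sub, h0, sub_self]
  · rw [map_sub, isMC_polyD_funPart hy, isMC_polyD_funPart hz, h1, map_sub, map_sub,
      LinearMap.sub_apply]
    module

/-- Every Maurer-Cartan element on the interval with value `u` at `0` is `e^p * u` for a unique
polynomial `p` with value `0` at `0`. -/
theorem existsUnique_gauge {y : (tensor (forms K 1) L).ext A}
    (hy : (tensor (forms K 1) L).IsMC A y) {u : L.ext A} (hu : L.IsMC A u)
    (h0 : polyEval 0 (funPart L A y) = u) :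
    ∃! p : PolyMod K (L.ext A), p ∈ polySub (L.extGr A 0) ∧ polyEval 0 p = 0 ∧
      y = (tensor (forms K 1) L).gauge A (polyFun L A p) (formMul (forms K 1) L A 1 u) := by
  -- Comparing `dt`-parts forces `p` to solve the nilpotent equation with right-hand side minus the
  -- `dt`-part of `y`. For that `p`, the function parts agree because both sides are Maurer-Cartan
  -- with the same value at 0.
  obtain ⟨p, ⟨hp, hp0, hp1⟩, huniq⟩ :=
    existsUnique_ode_zero (Submodule.neg_mem _ (dtPart_mem (k := 0) hy.1))
  refine ⟨p, ⟨hp, hp0, ?_⟩, ?_⟩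
  · refine isMC_ext hy (DGLA.gauge_isMC (polyFun_mem hp) (formMul_one_isMC hu)) ?_ ?_
    · rw [formMul_one_eq_polyFun, funPart_gauge_polyFun hp, polyEval_gauge, hp0,
        DGLA.gauge_zero, polyEval_tmul, eval_one, one_smul, h0]
    · rw [formMul_one_eq_polyFun, dtPart_gauge_polyFun hp, hp1, neg_neg]
  · rintro q ⟨hq, hq0, hq1⟩
    refine huniq q ⟨hq, hq0, ?_⟩
    rw [hq1, formMul_one_eq_polyFun, dtPart_gauge_polyFun hq, neg_neg]

end IntervalMC

/-! ### Naturality under morphisms of differential graded Lie algebras -/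

section HomExt

variable {K : Type u} [Field K] {L : DGLA.{u, v} K} {M : DGLA.{u, w} K} (φ : L.Hom M)
  {A : ArtAlg.{u} K}

theorem DGLA.Hom.ext_tmul (x : L.carrier) (a : A.max) :
    φ.ext A (x ⊗ₜ a) = φ.toLin x ⊗ₜ a := rfl

theorem DGLA.Hom.ext_d (x : L.ext A) : φ.ext A (L.extD A x) = M.extD A (φ.ext A x) := by
  induction x using TensorProduct.induction_on with
  | zero => simp only [map_zero]
  | add x y hx hy => simp only [map_add, hx, hy]
  | tmul x a => rw [DGLA.extD_tmul, DGLA.Hom.ext_tmul, DGLA.Hom.ext_tmul, DGLA.extD_tmul, φ.map_d]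

theorem DGLA.Hom.ext_br (x y : L.ext A) :
    φ.ext A (L.extBr A x y) = M.extBr A (φ.ext A x) (φ.ext A y) := by
  induction x using TensorProduct.induction_on with
  | zero => simp only [map_zero, LinearMap.zero_apply]
  | add x y hx hy => simp only [map_add, LinearMap.add_apply, hx, hy]
  | tmul x a =>
    induction y using TensorProduct.induction_on with
    | zero => simp only [map_zero]
    | add x y hx hy => simp only [map_add, hx, hy]
    | tmul y b => simp only [DGLA.extBr_tmul, DGLA.Hom.ext_tmul, φ.map_bracket]

theorem DGLA.Hom.ext_mem {i : ℤ} {x : L.ext A} (hx : x ∈ L.extGr A i) :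
    φ.ext A x ∈ M.extGr A i :=
  DGLA.extGr_ind (P := fun x => φ.ext A x ∈ M.extGr A i)
    (by rw [map_zero]; exact Submodule.zero_mem _)
    (fun x y hx hy => by rw [map_add]; exact Submodule.add_mem _ hx hy)
    (fun y hy a => DGLA.tmul_mem_extGr (φ.map_mem i y hy) a) hx

theorem DGLA.Hom.ext_gauge (a x : L.ext A) :
    φ.ext A (L.gauge A a x) = M.gauge A (φ.ext A a) (φ.ext A x) :=
  (L.nilFiltration A).map_gauge _ φ.ext_br φ.ext_d a x

theorem DGLA.Hom.ext_bch (a b : L.ext A) :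
    φ.ext A (L.bch A a b) = M.bch A (φ.ext A a) (φ.ext A b) :=
  (L.nilFiltration A).map_bch _ φ.ext_br a b

theorem DGLA.Hom.ext_isMC {x : L.ext A} (hx : L.IsMC A x) : M.IsMC A (φ.ext A x) :=
  ⟨φ.ext_mem hx.1, by rw [← φ.ext_d, ← φ.ext_br, ← map_smul, ← map_add, hx.2, map_zero]⟩

end HomExt

/-! ### Constant forms as a morphism -/

section FormMulHom

variable {K : Type u} [Field K] {Ω : CDGA.{u, u} K} {L : DGLA.{u, v} K} {A : ArtAlg.{u} K}

theorem extBr_formMul_one (n m : L.ext A) :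
    formMul Ω L A 1 (L.extBr A n m) =
      (tensor Ω L).extBr A (formMul Ω L A 1 n) (formMul Ω L A 1 m) := by
  induction n using TensorProduct.induction_on with
  | zero => simp only [map_zero, LinearMap.zero_apply]
  | add x y hx hy => simp only [map_add, LinearMap.add_apply, hx, hy]
  | tmul x a =>
    refine exists_sum_gr L.isInternal (P := fun x => formMul Ω L A 1 (L.extBr A (x ⊗ₜ a) m) =
      (tensor Ω L).extBr A (formMul Ω L A 1 (x ⊗ₜ a)) (formMul Ω L A 1 m)) ?_
      (fun x y hx hy => ?_) (fun i x hx => ?_) x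
    · simp only [zero_tmul, map_zero, LinearMap.zero_apply]
    · simp only [add_tmul, map_add, LinearMap.add_apply, hx, hy]
    · rw [extBr_formMul Ω.one_mem (DGLA.tmul_mem_extGr hx a), mul_zero, zpow_zero, one_smul,
        mul_one]

theorem gauge_formMul_one (a x : L.ext A) :
    formMul Ω L A 1 (L.gauge A a x) =
      (tensor Ω L).gauge A (formMul Ω L A 1 a) (formMul Ω L A 1 x) :=
  (L.nilFiltration A).map_gauge _ extBr_formMul_one (fun x => (extD_formMul_one x).symm) a x

theorem bch_formMul_one (a b : L.ext A) :
    formMul Ω L A 1 (L.bch A a b) =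
      (tensor Ω L).bch A (formMul Ω L A 1 a) (formMul Ω L A 1 b) :=
  (L.nilFiltration A).map_bch _ extBr_formMul_one a b

theorem formMul_one_mem {k : ℤ} {n : L.ext A} (hn : n ∈ L.extGr A k) :
    formMul Ω L A 1 n ∈ (tensor Ω L).extGr A k := by
  have := formMul_mem Ω.one_mem hn
  rwa [zero_add] at this

theorem extMap_formMul {B : ArtAlg.{u} K} (f : A ⟶ B) (ω : Ω.carrier) (n : L.ext A) :
    (tensor Ω L).extMap f (formMul Ω L A ω n) = formMul Ω L B ω (L.extMap f n) := by
  induction n using TensorProduct.induction_on with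
  | zero => simp only [map_zero]
  | add x y hx hy => simp only [map_add, hx, hy]
  | tmul x a => rfl

end FormMulHom

/-! ### Values at the endpoints -/

section Vertex

open Polynomial

variable {K : Type u} [Field K] {L : DGLA.{u, v} K} {A : ArtAlg.{u} K}

variable (L A) in
/-- The restriction of forms on the interval to the vertex `t = k`, the face of index `k`. -/
noncomputable def vertexVal (k : Fin 2) : (tensor (forms K 1) L).ext A →ₗ[K] L.ext A :=
  polyEval ((k : ℕ) : K) ∘ₗ funPart L A

theorem vertexVal_apply (k : Fin 2) (z : (tensor (forms K 1) L).ext A) :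
    vertexVal L A k z = polyEval ((k : ℕ) : K) (funPart L A z) := rfl

theorem vertexVal_polyFun (k : Fin 2) (p : PolyMod K (L.ext A)) :
    vertexVal L A k (polyFun L A p) = polyEval ((k : ℕ) : K) p := by
  rw [vertexVal_apply, funPart_polyFun]

theorem vertexVal_polyDt (k : Fin 2) (p : PolyMod K (L.ext A)) :
    vertexVal L A k (polyDt L A p) = 0 := by
  rw [vertexVal_apply, funPart_polyDt, map_zero]

theorem vertexVal_formMul_one (k : Fin 2) (n : L.ext A) :
    vertexVal L A k (formMul (forms K 1) L A 1 n) = n := by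
  rw [formMul_one_eq_polyFun, vertexVal_polyFun, polyEval_tmul, eval_one, one_smul]

theorem face_ext_eq [CharZero K] (k : Fin 2) (z : (tensor (forms K 1) L).ext A) :
    (tensorMap (face K 0 k) (DGLA.Hom.id L)).ext A z =
      formMul (forms K 0) L A 1 (vertexVal L A k z) := face_ext k z

/-- Restriction to a face is a morphism of differential graded Lie algebras, and constants on the
point embed compatibly with the gauge action. This avoids a computation with `dt`-parts. -/
theorem vertexVal_gauge [CharZero K] (k : Fin 2) (a x : (tensor (forms K 1) L).ext A) :
    vertexVal L A k ((tensor (forms K 1) L).gauge A a x) =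
      L.gauge A (vertexVal L A k a) (vertexVal L A k x) := by
  refine formMul_one_injective ?_
  rw [gauge_formMul_one, ← face_ext_eq, ← face_ext_eq, ← face_ext_eq]
  exact DGLA.Hom.ext_gauge _ a x

theorem vertexVal_bch [CharZero K] (k : Fin 2) (a b : (tensor (forms K 1) L).ext A) :
    vertexVal L A k ((tensor (forms K 1) L).bch A a b) =
      L.bch A (vertexVal L A k a) (vertexVal L A k b) := by
  refine formMul_one_injective ?_
  rw [bch_formMul_one, ← face_ext_eq, ← face_ext_eq, ← face_ext_eq]
  exact DGLA.Hom.ext_bch _ a b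

end Vertex

/-! ### The gauge group -/

section GaugeGroup

variable {K : Type u} [Field K] [CharZero K] (L : DGLA.{u, v} K) (A : ArtAlg.{u} K)

/-- The group `exp(L^0 ⊗ 𝔪_A)`. -/
def GaugeGroup : Type (max u v) := L.extGr A 0

/-- Packaging the laws of `•` as a group lets word identities be solved mechanically. -/
noncomputable instance : Group (GaugeGroup L A) where
  mul a b := ThomWhitney.bch (V := L.extGr A 0) (L.zeroBr A) a b
  one := (0 : L.extGr A 0)
  inv a := Neg.neg (α := L.extGr A 0) a
  mul_assoc a b c := (L.nilLie_zeroBr A).bch_assoc a b c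
  one_mul a := (L.nilLie_zeroBr A).zero_bch a
  mul_one a := (L.nilLie_zeroBr A).bch_zero a
  inv_mul_cancel a := (L.nilLie_zeroBr A).neg_bch a

variable {L A}

theorem GaugeGroup.val_mul (a b : GaugeGroup L A) : (a * b).1 = L.bch A a.1 b.1 :=
  (L.bch_coe a b).symm

theorem GaugeGroup.val_inv (a : GaugeGroup L A) : (a⁻¹).1 = -a.1 := rfl

/-- An identity in the free group. It checks the endpoint `t = 1` of the gauge transformation
constructed in `gaugeEquiv_of_Z1Rel`, with `m = p(1)`, `m' = p'(1)`, `e = ∂_1 a` and `f = ∂_0 a`. -/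
theorem bch_solve {m e m' f : L.ext A} (hm : m ∈ L.extGr A 0) (he : e ∈ L.extGr A 0)
    (hm' : m' ∈ L.extGr A 0) (hf : f ∈ L.extGr A 0) :
    L.bch A (L.bch A (L.bch A m' f)
      (-L.bch A (L.bch A (L.bch A (-m) (-e)) m') f)) (-m) = e := by
  let M : GaugeGroup L A := ⟨m, hm⟩
  let E : GaugeGroup L A := ⟨e, he⟩
  let M' : GaugeGroup L A := ⟨m', hm'⟩
  let F : GaugeGroup L A := ⟨f, hf⟩
  have h : M' * F * (M⁻¹ * E⁻¹ * M' * F)⁻¹ * M⁻¹ = E := by group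
  have := congrArg Subtype.val h
  simpa only [GaugeGroup.val_mul, GaugeGroup.val_inv] using this

end GaugeGroup

/-! ### Tensor products with a product -/

section TensorProd

variable {K : Type u} [Field K] {B C M : Type*} [AddCommGroup B] [Module K B] [AddCommGroup C]
  [Module K C] [AddCommGroup M] [Module K M]

theorem lTensor_prod_ext {x y : M ⊗[K] (B × C)}
    (h1 : (LinearMap.fst K B C).lTensor M x = (LinearMap.fst K B C).lTensor M y)
    (h2 : (LinearMap.snd K B C).lTensor M x = (LinearMap.snd K B C).lTensor M y) : x = y := by
  have key : ∀ x : M ⊗[K] (B × C), x =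
      (LinearMap.inl K B C).lTensor M ((LinearMap.fst K B C).lTensor M x) +
        (LinearMap.inr K B C).lTensor M ((LinearMap.snd K B C).lTensor M x) := by
    intro x
    have h : LinearMap.inl K B C ∘ₗ LinearMap.fst K B C + LinearMap.inr K B C ∘ₗ
        LinearMap.snd K B C = LinearMap.id := by ext <;> simp
    rw [← LinearMap.lTensor_comp_apply, ← LinearMap.lTensor_comp_apply, ← LinearMap.add_apply,
      ← LinearMap.lTensor_add, h, LinearMap.lTensor_id, LinearMap.id_apply]
  rw [key x, key y, h1, h2]

theorem rTensor_eq_iff_lTensor (f : B →ₗ[K] C) (x : B ⊗[K] M) (y : C ⊗[K] M) :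
    f.rTensor M x = y ↔
      f.lTensor M (TensorProduct.comm K B M x) = TensorProduct.comm K C M y := by
  rw [← (TensorProduct.comm K C M).injective.eq_iff]
  have : TensorProduct.comm K C M (f.rTensor M x) = f.lTensor M (TensorProduct.comm K B M x) := by
    induction x using TensorProduct.induction_on with
    | zero => simp
    | add x y hx hy => simp only [map_add, hx, hy]
    | tmul b m => simp
  rw [this]

end TensorProd

/-! ### Elements of the truncated Thom-Whitney algebra -/

section Tot

variable {K : Type u} [Field K] (g : SemicosimplicialDGLA.{u, v} K)

theorem tensor_zero_subsingleton (Ω : CDGA.{u, u} K) :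
    Subsingleton (tensor Ω (DGLA.zero.{u, v} K)).carrier := by
  refine ⟨fun a b => ?_⟩
  have h : ∀ a : Ω.carrier ⊗[K] PUnit.{v + 1}, a = 0 := fun a => by
    induction a using TensorProduct.induction_on with
    | zero => rfl
    | add x y hx hy => rw [hx, hy, add_zero]
    | tmul x y => rw [Subsingleton.elim y 0, tmul_zero]
  exact (h a).trans (h b).symm

theorem trunc_subsingleton (Ω : CDGA.{u, u} K) (n : ℕ) :
    Subsingleton (tensor Ω (g.trunc.obj (n + 2))).carrier := tensor_zero_subsingleton Ω

theorem trunc_ext_subsingleton (A : ArtAlg.{u} K) : Subsingleton ((g.trunc.obj 2).ext A) := by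
  refine ⟨fun a b => ?_⟩
  have h : ∀ a : PUnit.{v + 1} ⊗[K] A.max, a = 0 := fun a => by
    induction a using TensorProduct.induction_on with
    | zero => rfl
    | add x y hx hy => rw [hx, hy, add_zero]
    | tmul x y => rw [Subsingleton.elim x 0, zero_tmul]
  exact (h a).trans (h b).symm

theorem totProj_injective {x y : (totTW g.trunc).carrier}
    (h0 : (totProj g.trunc 0).toLin x = (totProj g.trunc 0).toLin y)
    (h1 : (totProj g.trunc 1).toLin x = (totProj g.trunc 1).toLin y) : x = y := by
  refine Subtype.ext (funext fun n => ?_)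
  match n with
  | 0 => exact h0
  | 1 => exact h1
  | n + 2 => exact (trunc_subsingleton g _ n).elim _ _

/-- The compatibility conditions beyond the first level hold in zero spaces, so only the two face
conditions on the interval remain. -/
theorem exists_tot {k : ℤ} {b : (tensor (forms K 0) (g.trunc.obj 0)).carrier}
    {c : (tensor (forms K 1) (g.trunc.obj 1)).carrier}
    (hb : b ∈ (tensor (forms K 0) (g.trunc.obj 0)).gr k)
    (hc : c ∈ (tensor (forms K 1) (g.trunc.obj 1)).gr k)
    (h : ∀ l : Fin 2, (faceMap g.trunc 0 l).toLin c = (cofaceMap g.trunc 0 l).toLin b) :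
    ∃ x ∈ (totTW g.trunc).gr k, (totProj g.trunc 0).toLin x = b ∧
      (totProj g.trunc 1).toLin x = c := by
  let x : TotAmbient g.trunc := fun n => match n with
    | 0 => b
    | 1 => c
    | _ + 2 => 0
  have hx : x ∈ totGr g.trunc k := by
    refine ⟨fun n => ?_, fun n l => ?_⟩
    · match n with
      | 0 => exact hb
      | 1 => exact hc
      | n + 2 => exact Submodule.zero_mem _
    · match n with
      | 0 => exact h l
      | n + 1 => exact (trunc_subsingleton g _ n).elim _ _
  exact ⟨⟨x, Submodule.mem_iSup_of_mem k hx⟩, hx, rfl, rfl⟩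

theorem tot_compat (x : (totTW g).carrier) (n : ℕ) (l : Fin (n + 2)) :
    (faceMap g n l).toLin ((totProj g (n + 1)).toLin x) =
      (cofaceMap g n l).toLin ((totProj g n).toLin x) := by
  refine exists_sum_gr (totTW g).isInternal (P := fun x =>
    (faceMap g n l).toLin ((totProj g (n + 1)).toLin x) =
      (cofaceMap g n l).toLin ((totProj g n).toLin x)) ?_ (fun x y hx hy => ?_)
      (fun i x hx => hx.2 n l) x
  · simp only [map_zero]
  · simp only [map_add, hx, hy]

variable {g} {A : ArtAlg.{u} K}

theorem tot_compat_ext (x : (totTW g).ext A) (n : ℕ) (l : Fin (n + 2)) :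
    (faceMap g n l).ext A ((totProj g (n + 1)).ext A x) =
      (cofaceMap g n l).ext A ((totProj g n).ext A x) := by
  induction x using TensorProduct.induction_on with
  | zero => simp only [map_zero]
  | add x y hx hy => simp only [map_add, hx, hy]
  | tmul x a => simp only [DGLA.Hom.ext_tmul, tot_compat]

/-- The first two projections are jointly injective, and this persists after tensoring with `𝔪_A`.
-/
theorem tot_ext {x y : (totTW g.trunc).ext A}
    (h0 : (totProj g.trunc 0).ext A x = (totProj g.trunc 0).ext A y)
    (h1 : (totProj g.trunc 1).ext A x = (totProj g.trunc 1).ext A y) : x = y := by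
  have hinj : Function.Injective
      ((totProj g.trunc 0).toLin.prod (totProj g.trunc 1).toLin) := fun x y hxy =>
    totProj_injective g (congrArg Prod.fst hxy) (congrArg Prod.snd hxy)
  have hinj' := Module.Flat.lTensor_preserves_injective_linearMap (M := A.max) _ hinj
  refine (TensorProduct.comm K _ _).injective (hinj' (lTensor_prod_ext ?_ ?_))
  · rw [← LinearMap.lTensor_comp_apply, ← LinearMap.lTensor_comp_apply, LinearMap.fst_prod]
    exact ((rTensor_eq_iff_lTensor _ _ _).mp h0).trans
      ((rTensor_eq_iff_lTensor _ _ _).mp rfl).symm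
  · rw [← LinearMap.lTensor_comp_apply, ← LinearMap.lTensor_comp_apply, LinearMap.snd_prod]
    exact ((rTensor_eq_iff_lTensor _ _ _).mp h1).trans
      ((rTensor_eq_iff_lTensor _ _ _).mp rfl).symm

/-- Each degree of the truncated algebra is the fiber product of its two levels over the pair of
face conditions, so `lTensor_fiber` applies with coefficients in `𝔪_A`. -/
theorem exists_tot_ext {k : ℤ} {b : (tensor (forms K 0) (g.trunc.obj 0)).ext A}
    {c : (tensor (forms K 1) (g.trunc.obj 1)).ext A}
    (hb : b ∈ (tensor (forms K 0) (g.trunc.obj 0)).extGr A k)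
    (hc : c ∈ (tensor (forms K 1) (g.trunc.obj 1)).extGr A k)
    (h : ∀ l : Fin 2, (faceMap g.trunc 0 l).ext A c = (cofaceMap g.trunc 0 l).ext A b) :
    ∃ x ∈ (totTW g.trunc).extGr A k, (totProj g.trunc 0).ext A x = b ∧
      (totProj g.trunc 1).ext A x = c := by
  obtain ⟨b, rfl⟩ := hb
  obtain ⟨c, rfl⟩ := hc
  let T := (totTW g.trunc).gr k
  let T0 := (tensor (forms K 0) (g.trunc.obj 0)).gr k
  let T1 := (tensor (forms K 1) (g.trunc.obj 1)).gr k
  let p0 : T →ₗ[K] T0 := (totProj g.trunc 0).toLin.restrict ((totProj g.trunc 0).map_mem k)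
  let p1 : T →ₗ[K] T1 := (totProj g.trunc 1).toLin.restrict ((totProj g.trunc 1).map_mem k)
  let f := ((cofaceMap g.trunc 0 0).toLin.prod (cofaceMap g.trunc 0 1).toLin) ∘ₗ T0.subtype
  let h' := ((faceMap g.trunc 0 0).toLin.prod (faceMap g.trunc 0 1).toLin) ∘ₗ T1.subtype
  have hfib : ∃! x, p0.lTensor A.max x = TensorProduct.comm K _ _ b ∧
      p1.lTensor A.max x = TensorProduct.comm K _ _ c := by
    refine lTensor_fiber A.max p0 p1 f h' ?_ ?_ _ _ ?_
    · intro x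
      exact Prod.ext (tot_compat g.trunc x.1 0 0).symm (tot_compat g.trunc x.1 0 1).symm
    · intro b c hbc
      obtain ⟨x, hx, hx0, hx1⟩ := exists_tot g b.2 c.2 (fun l => by
        fin_cases l
        · exact (congrArg Prod.fst hbc).symm
        · exact (congrArg Prod.snd hbc).symm)
      refine ⟨⟨x, hx⟩, ⟨Subtype.ext hx0, Subtype.ext hx1⟩, ?_⟩
      rintro y ⟨hy0, hy1⟩
      exact Subtype.ext (totProj_injective g ((congrArg Subtype.val hy0).trans hx0.symm)
        ((congrArg Subtype.val hy1).trans hx1.symm))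
    · have key : ∀ l : Fin 2,
          ((cofaceMap g.trunc 0 l).toLin ∘ₗ T0.subtype).lTensor A.max
            (TensorProduct.comm K _ _ b) =
          ((faceMap g.trunc 0 l).toLin ∘ₗ T1.subtype).lTensor A.max
            (TensorProduct.comm K _ _ c) := by
        intro l
        refine ((rTensor_eq_iff_lTensor _ _ _).mp ?_).trans
          ((rTensor_eq_iff_lTensor _ _ _).mp rfl).symm
        rw [LinearMap.rTensor_comp_apply, LinearMap.rTensor_comp_apply]
        exact (h l).symm
      refine lTensor_prod_ext ?_ ?_
      · rw [← LinearMap.lTensor_comp_apply, ← LinearMap.lTensor_comp_apply]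
        exact key 0
      · rw [← LinearMap.lTensor_comp_apply, ← LinearMap.lTensor_comp_apply]
        exact key 1
  obtain ⟨x, ⟨hx0, hx1⟩, -⟩ := hfib
  refine ⟨T.subtype.rTensor A.max ((TensorProduct.comm K _ _).symm x), ⟨_, rfl⟩, ?_, ?_⟩
  · have h1 : p0.rTensor A.max ((TensorProduct.comm K _ _).symm x) = b :=
      (rTensor_eq_iff_lTensor _ _ _).mpr (by rw [LinearEquiv.apply_symm_apply, hx0])
    rw [← h1, DGLA.Hom.ext, ← LinearMap.rTensor_comp_apply, ← LinearMap.rTensor_comp_apply]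
    rfl
  · have h1 : p1.rTensor A.max ((TensorProduct.comm K _ _).symm x) = c :=
      (rTensor_eq_iff_lTensor _ _ _).mpr (by rw [LinearEquiv.apply_symm_apply, hx1])
    rw [← h1, DGLA.Hom.ext, ← LinearMap.rTensor_comp_apply, ← LinearMap.rTensor_comp_apply]
    rfl

/-- The face conditions, read through the identification of forms on a point with constants. -/
theorem tot_vertexVal [CharZero K] {x : (g.obj 0).ext A} {ζ : (totTW g).ext A}
    (h : (totProj g 0).ext A ζ = formMul (forms K 0) (g.obj 0) A 1 x) (l : Fin 2) :
    vertexVal (g.obj 1) A l ((totProj g 1).ext A ζ) = (g.coface 0 l).ext A x := by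
  refine formMul_one_injective ?_
  refine (face_ext_eq l _).symm.trans ((tot_compat_ext ζ 0 l).trans ?_)
  rw [h]
  exact tensorMap_ext_formMul _ _ _ x

theorem exists_tot_of_vertexVal [CharZero K] {k : ℤ} {x : (g.trunc.obj 0).ext A}
    {z : (tensor (forms K 1) (g.trunc.obj 1)).ext A} (hx : x ∈ (g.trunc.obj 0).extGr A k)
    (hz : z ∈ (tensor (forms K 1) (g.trunc.obj 1)).extGr A k)
    (h : ∀ l : Fin 2, vertexVal (g.trunc.obj 1) A l z = (g.trunc.coface 0 l).ext A x) :
    ∃ ζ ∈ (totTW g.trunc).extGr A k,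
      (totProj g.trunc 0).ext A ζ = formMul (forms K 0) (g.trunc.obj 0) A 1 x ∧
      (totProj g.trunc 1).ext A ζ = z := by
  refine exists_tot_ext (formMul_one_mem hx) hz fun l => ?_
  refine (face_ext_eq l z).trans ?_
  rw [h l]
  exact (tensorMap_ext_formMul (CDGA.Hom.id (forms K 0)) (g.trunc.coface 0 l) 1 x).symm

end Tot

/-! ### Stabilizers of a constant Maurer-Cartan element -/

section Stabilizer

open Polynomial

variable {K : Type u} [Field K] {L : DGLA.{u, v} K} {A : ArtAlg.{u} K}

theorem ext_skew_neg_one {b u : L.ext A} (hb : b ∈ L.extGr A (-1)) (hu : u ∈ L.extGr A 1) :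
    L.extBr A b u = L.extBr A u b := by
  rw [DGLA.ext_skew hb hu]
  simp

/-- The endpoints of an element of the stabilizer of a constant Maurer-Cartan element differ by
an exact element of the twisted complex. -/
theorem exists_of_stabilizes [CharZero K] {u : L.ext A} (hu : u ∈ L.extGr A 1)
    {q : (tensor (forms K 1) L).ext A} (hq : q ∈ (tensor (forms K 1) L).extGr A 0)
    (h : (tensor (forms K 1) L).gauge A q (formMul (forms K 1) L A 1 u) =
      formMul (forms K 1) L A 1 u) :
    ∃ b ∈ L.extGr A (-1), vertexVal L A 1 q - vertexVal L A 0 q =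
      L.extD A b + L.extBr A u b := by
  have h := DGLA.gauge_eq_self_iff.mp h
  have h0 := funPart_mem hq
  have h1 : dtPart L A q ∈ polySub (L.extGr A (-1)) := dtPart_mem (k := -1) hq
  rw [vertexVal_apply, vertexVal_apply]
  rw [← polyFun_add_polyDt q, formMul_one_eq_polyFun] at h
  generalize funPart L A q = p at *
  generalize dtPart L A q = r at *
  -- For `q = p + r dt` the `dt`-component of `[q, u] = d q` is `p' = d r + [r, u]`.
  have h := congrArg (dtPart L A) h
  simp only [map_add, LinearMap.add_apply, map_neg, extD_polyFun, extD_polyDt,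
    extBr_polyFun_polyFun h0, extBr_polyDt_polyFun h1, dtPart_polyFun, dtPart_polyDt,
    zero_add] at h
  have hint : ∀ f : L.ext A →ₗ[K] L.ext A, polyEval 1 (polyInt K _ (polyMap f r)) =
      f (polyEval 1 (polyInt K _ r)) := fun f => by rw [← polyMap_polyInt, polyMap_polyEval]
  have hbr : polyBr (L.extBr A) r (1 ⊗ₜ u) = polyMap ((L.extBr A).flip u) r := by
    generalize r = r
    induction r using TensorProduct.induction_on with
    | zero => simp
    | add x y hx hy => simp only [map_add, LinearMap.add_apply, hx, hy]
    | tmul f n => rw [polyBr_tmul, mul_one]; rfl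
  have hb : polyEval 1 (polyInt K _ r) ∈ L.extGr A (-1) := polyEval_mem 1 (polyInt_mem h1)
  -- The witness is the integral of `r` from 0 to 1, which commutes with `d` and with the bracket
  -- with the constant `u`.
  refine ⟨polyEval 1 (polyInt K _ r), hb, ?_⟩
  have hp : polyD K _ p = polyMap (L.extD A) r + polyMap ((L.extBr A).flip u) r := by
    rw [← hbr, h]; abel
  have e0 : (((0 : Fin 2) : ℕ) : K) = 0 := by simp
  have e1 : (((1 : Fin 2) : ℕ) : K) = 1 := by simp
  rw [e0, e1, ← polyEval_one_polyInt_polyD, hp, map_add, map_add, hint, hint,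
    LinearMap.flip_apply, ext_skew_neg_one hb hu]

/-- A path of stabilizers of a constant Maurer-Cartan element from `0` to an exact element of
the twisted complex. -/
theorem stabilizes_of_exact [CharZero K] {u s b : L.ext A} (hu : u ∈ L.extGr A 1) (hs : s ∈ L.extGr A 0)
    (hb : b ∈ L.extGr A (-1)) (hsu : L.gauge A s u = u)
    (h : s = L.extD A b + L.extBr A u b) :
    ∃ q ∈ (tensor (forms K 1) L).extGr A 0, vertexVal L A 0 q = 0 ∧ vertexVal L A 1 q = s ∧
      (tensor (forms K 1) L).gauge A q (formMul (forms K 1) L A 1 u) =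
        formMul (forms K 1) L A 1 u := by
  have h0 : (X : K[X]) ⊗ₜ[K] s ∈ polySub (L.extGr A 0) := tmul_mem_polySub _ hs
  have h1 : (1 : K[X]) ⊗ₜ[K] b ∈ polySub (L.extGr A (-1)) := tmul_mem_polySub _ hb
  have hdt := polyDt_mem h1
  rw [neg_add_cancel] at hdt
  -- The path `t s + b dt`. Its function part stabilizes `u` because `s` does; its `dt`-part does
  -- because `s - d b = [u, b]`.
  refine ⟨polyFun L A (X ⊗ₜ s) + polyDt L A (1 ⊗ₜ b),
    Submodule.add_mem _ (polyFun_mem h0) hdt, ?_, ?_, ?_⟩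
  · rw [map_add, vertexVal_polyFun, vertexVal_polyDt, polyEval_tmul]; simp
  · rw [map_add, vertexVal_polyFun, vertexVal_polyDt, polyEval_tmul]; simp
  · rw [DGLA.gauge_eq_self_iff, formMul_one_eq_polyFun, map_add, map_add, LinearMap.add_apply,
      extBr_polyFun_polyFun h0, extBr_polyDt_polyFun h1, extD_polyFun, extD_polyDt, polyBr_tmul,
      polyBr_tmul, DGLA.gauge_eq_self_iff.mp hsu, ext_skew_neg_one hb hu, polyD_tmul, mul_one,
      mul_one, derivative_X, add_assoc, ← sub_eq_add_neg, ← map_sub]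
    have hX : polyMap (L.extD A) ((X : K[X]) ⊗ₜ s) = X ⊗ₜ L.extD A s := rfl
    have h1 : polyMap (L.extD A) ((1 : K[X]) ⊗ₜ b) = 1 ⊗ₜ L.extD A b := rfl
    rw [hX, h1, ← tmul_sub]
    rw [sub_eq_of_eq_add' h]

end Stabilizer

/-! ### The normal form `(x, e^{p(t)} * ∂_{0,1} x)` and cocycles -/

section Forms

open Polynomial

variable {K : Type u} [Field K] {g : SemicosimplicialDGLA.{u, v} K} {A : ArtAlg.{u} K}

/-- The level 0 component is a constant `x`, which prescribes the value `∂_0 x` at `t = 0` of the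
level 1 component; the interval result then yields `p`. -/
theorem hasForm_existsUnique [CharZero K] (η : (totTW g).MC A) :
    ∃! q : (g.obj 0).ext A × (ℕ →₀ (g.obj 1).ext A), HasForm g A η q.1 q.2 := by
  obtain ⟨x, hx, hx0⟩ := exists_formMul_one ((totProj g 0).ext_mem η.2.1)
  have hMC : (g.obj 0).IsMC A x :=
    isMC_of_formMul_one formMul_one_injective hx (hx0 ▸ (totProj g 0).ext_isMC η.2)
  obtain ⟨p, ⟨hp, hp0, hp1⟩, hu⟩ := existsUnique_gauge ((totProj g 1).ext_isMC η.2)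
    ((g.coface 0 0).ext_isMC hMC) (by simpa [vertexVal_apply] using tot_vertexVal hx0 0)
  refine ⟨(x, polyCoeff K _ p), ⟨hMC, ?_, polyCoeff_mem hp, hx0, ?_⟩, ?_⟩
  · rw [← polyEval_zero_polyOfCoeff (K := K), polyOfCoeff_polyCoeff, hp0]
  · rw [polyForm_eq, polyOfCoeff_polyCoeff]
    exact hp1
  · rintro ⟨x', p'⟩ h
    have hxx : x' = x := formMul_one_injective (h.level_zero.symm.trans hx0)
    subst hxx
    have := hu (polyOfCoeff K _ p') ⟨polyOfCoeff_mem h.mem, by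
      rw [polyEval_zero_polyOfCoeff, h.zero], by rw [h.level_one, polyForm_eq]⟩
    rw [← this, polyCoeff_polyOfCoeff]

namespace HasForm

variable {η : (totTW g).MC A} {x : (g.obj 0).ext A} {p : ℕ →₀ (g.obj 1).ext A}

theorem polyForm_mem (h : HasForm g A η x p) :
    polyForm (g.obj 1) A p ∈ (tensor (forms K 1) (g.obj 1)).extGr A 0 := by
  rw [polyForm_eq]
  exact polyFun_mem (polyOfCoeff_mem h.mem)

theorem vertexVal_zero (h : HasForm g A η x p) :
    vertexVal (g.obj 1) A 0 (polyForm (g.obj 1) A p) = 0 := by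
  rw [polyForm_eq, vertexVal_polyFun]
  simpa [polyEval_zero_polyOfCoeff] using h.zero

theorem vertexVal_one : vertexVal (g.obj 1) A 1 (polyForm (g.obj 1) A p) =
    polyEvalOne (g.obj 1) A p := by
  rw [polyForm_eq, vertexVal_polyFun, polyEvalOne_eq]
  simp

theorem polyEvalOne_mem (h : HasForm g A η x p) :
    polyEvalOne (g.obj 1) A p ∈ (g.obj 1).extGr A 0 := by
  rw [polyEvalOne_eq]
  exact polyEval_mem 1 (polyOfCoeff_mem h.mem)

/-- The face condition at `t = 1`, evaluated on the normal form. -/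
theorem coface_one [CharZero K] (h : HasForm g A η x p) : (g.coface 0 1).ext A x =
    (g.obj 1).gauge A (polyEvalOne (g.obj 1) A p) ((g.coface 0 0).ext A x) := by
  rw [← tot_vertexVal h.level_zero 1, h.level_one, vertexVal_gauge, vertexVal_one,
    vertexVal_formMul_one]

theorem map {B : ArtAlg.{u} K} (f : A ⟶ B) (h : HasForm g A η x p) :
    HasForm g B ⟨(totTW g).extMap f η.1, (totTW g).extMap_isMC f η.2⟩
      ((g.obj 0).extMap f x) (p.mapRange ((g.obj 1).extMap f) (map_zero _)) where
  isMC := (g.obj 0).extMap_isMC f h.isMC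
  zero := by rw [Finsupp.mapRange_apply, h.zero, map_zero]
  mem k := by rw [Finsupp.mapRange_apply]; exact (g.obj 1).extMap_mem f (h.mem k)
  level_zero := by rw [← DGLA.Hom.extMap_ext, h.level_zero, extMap_formMul]
  level_one := by
    have hp : polyForm (g.obj 1) B (p.mapRange ((g.obj 1).extMap f) (map_zero _)) =
        (tensor (forms K 1) (g.obj 1)).extMap f (polyForm (g.obj 1) A p) := by
      rw [polyForm, polyForm, map_finsuppSum, Finsupp.sum_mapRange_index]
      · exact Finsupp.sum_congr fun k _ => (extMap_formMul f _ _).symm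
      · exact fun k => map_zero _
    rw [← DGLA.Hom.extMap_ext, h.level_one, hp, DGLA.extMap_gauge, extMap_formMul,
      DGLA.Hom.extMap_ext]

theorem polyEvalOne_map {B : ArtAlg.{u} K} (f : A ⟶ B) :
    polyEvalOne (g.obj 1) B (p.mapRange ((g.obj 1).extMap f) (map_zero _)) =
      (g.obj 1).extMap f (polyEvalOne (g.obj 1) A p) := by
  rw [polyEvalOne, polyEvalOne, map_finsuppSum, Finsupp.sum_mapRange_index]
  exact fun k => rfl

end HasForm

/-- The condition at level 2 is an equation in the zero space, so `n = 0` serves. -/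
theorem HasForm.mem_Z1 [CharZero K] {η : (totTW g.trunc).MC A} {x : (g.trunc.obj 0).ext A}
    {p : ℕ →₀ (g.trunc.obj 1).ext A} (h : HasForm g.trunc A η x p) :
    (x, polyEvalOne (g.trunc.obj 1) A p) ∈ Z1 g.trunc A :=
  ⟨h.isMC, h.polyEvalOne_mem, h.coface_one, 0, Submodule.zero_mem _,
    (trunc_ext_subsingleton g A).elim _ _⟩

/-- Every cocycle comes from a Maurer-Cartan element with `p(t) = t m`. -/
theorem exists_hasForm [CharZero K] {q : (g.trunc.obj 0).ext A × (g.trunc.obj 1).ext A}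
    (hq : q ∈ Z1 g.trunc A) :
    ∃ η, HasForm g.trunc A η q.1 (Finsupp.single 1 q.2) := by
  obtain ⟨h1, h2, h3, -⟩ := hq
  set p : ℕ →₀ (g.trunc.obj 1).ext A := Finsupp.single 1 q.2 with hp
  have hmem : ∀ k, p k ∈ (g.trunc.obj 1).extGr A 0 := fun k => by
    rw [hp, Finsupp.single_apply]
    split_ifs
    · exact h2
    · exact Submodule.zero_mem _
  have hpf : polyForm (g.trunc.obj 1) A p = polyFun (g.trunc.obj 1) A (X ⊗ₜ q.2) := by
    rw [polyForm_eq, hp, polyOfCoeff_single, pow_one]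
  have hpm : polyForm (g.trunc.obj 1) A p ∈
      (tensor (forms K 1) (g.trunc.obj 1)).extGr A 0 := by
    rw [hpf]
    exact polyFun_mem (tmul_mem_polySub _ h2)
  have hy := DGLA.gauge_isMC hpm
    (formMul_one_isMC (Ω := forms K 1) ((g.trunc.coface 0 0).ext_isMC h1))
  -- At `t = 0` the gauge parameter `t m` vanishes; at `t = 1` it is `m`, and the face condition is
  -- exactly the cocycle condition.
  obtain ⟨ζ, hζ, hζ0, hζ1⟩ := exists_tot_of_vertexVal h1.1 hy.1 fun l => by
    rw [vertexVal_gauge, vertexVal_formMul_one, hpf, vertexVal_polyFun, polyEval_tmul]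
    fin_cases l
    · simp [DGLA.gauge_zero]
    · simpa using h3.symm
  refine ⟨⟨ζ, hζ, tot_ext ?_ ?_⟩, h1, by simp [hp], hmem, hζ0, hζ1⟩
  · rw [map_add, map_smul, DGLA.Hom.ext_d, DGLA.Hom.ext_br, hζ0, (formMul_one_isMC h1).2,
      map_zero]
  · rw [map_add, map_smul, DGLA.Hom.ext_d, DGLA.Hom.ext_br, hζ1, hy.2, map_zero]

end Forms

/-! ### Gauge equivalence and the relation on cocycles -/

section Relation

variable {K : Type u} [Field K] [CharZero K] {g : SemicosimplicialDGLA.{u, v} K}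
  {A : ArtAlg.{u} K} {η η' : (totTW g.trunc).MC A} {x x' : (g.trunc.obj 0).ext A}
  {p p' : ℕ →₀ (g.trunc.obj 1).ext A}

/-- A gauge transformation `(a, H)` yields the loop `(-P) • (-H) • P' • ∂_0 a` based at the constant
`∂_0 x`, a stabilizer whose endpoints are compared by `exists_of_stabilizes`. -/
theorem Z1Rel_of_gaugeEquiv (h : HasForm g.trunc A η x p) (h' : HasForm g.trunc A η' x' p')
    (hη : (totTW g.trunc).GaugeEquiv A η η') :
    Z1Rel g.trunc A ⟨_, h.mem_Z1⟩ ⟨_, h'.mem_Z1⟩ := by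
  obtain ⟨ζ, hζ, hgauge⟩ := hη
  obtain ⟨a, ha, ha0⟩ := exists_formMul_one ((totProj g.trunc 0).ext_mem hζ)
  have hax : (g.trunc.obj 0).gauge A a x = x' := by
    refine formMul_one_injective (L := g.trunc.obj 0) ?_
    rw [gauge_formMul_one, ← ha0, ← h.level_zero, ← h'.level_zero, ← DGLA.Hom.ext_gauge, hgauge]
  have hH := (totProj g.trunc 1).ext_mem hζ
  have hH1 : (tensor (forms K 1) (g.trunc.obj 1)).gauge A ((totProj g.trunc 1).ext A ζ)
      ((totProj g.trunc 1).ext A η.1) = (totProj g.trunc 1).ext A η'.1 := by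
    rw [← DGLA.Hom.ext_gauge, hgauge]
  have hv := tot_vertexVal ha0
  rw [h.level_one, h'.level_one, ← hax, DGLA.Hom.ext_gauge, gauge_formMul_one] at hH1
  generalize (totProj g.trunc 1).ext A ζ = H at *
  have hu : (g.trunc.coface 0 0).ext A x ∈ (g.trunc.obj 1).extGr A 1 :=
    (g.trunc.coface 0 0).ext_mem h.isMC.1
  have hz := formMul_one_mem (Ω := forms K 1) hu
  have hα : (g.trunc.coface 0 0).ext A a ∈ (g.trunc.obj 1).extGr A 0 :=
    (g.trunc.coface 0 0).ext_mem ha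
  have hα' := formMul_one_mem (Ω := forms K 1) hα
  have hP := h.polyForm_mem
  have hP' := h'.polyForm_mem
  have m1 := DGLA.bch_mem (Submodule.neg_mem _ hP) (Submodule.neg_mem _ hH)
  have m2 := DGLA.bch_mem m1 hP'
  have m3 := DGLA.bch_mem m2 hα'
  obtain ⟨b, hb, hbe⟩ := exists_of_stabilizes hu m3 (by
    rw [DGLA.gauge_bch m2 hα' hz, DGLA.gauge_bch m1 hP' (DGLA.gauge_mem hα' hz),
      DGLA.gauge_bch (Submodule.neg_mem _ hP) (Submodule.neg_mem _ hH)
        (DGLA.gauge_mem hP' (DGLA.gauge_mem hα' hz)), ← hH1,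
      DGLA.gauge_neg_gauge hH (DGLA.gauge_mem hP hz), DGLA.gauge_neg_gauge hP hz])
  refine ⟨a, ha, b, hb, hax, ?_⟩
  rw [← hbe]
  -- Since `P` and `P'` vanish at `t = 0` and `H` is `∂_0 a` there, the product is `0` at that end.
  -- At `t = 1` it is the product in the relation.
  simp only [vertexVal_bch, map_neg, vertexVal_formMul_one, HasForm.vertexVal_one,
    h.vertexVal_zero, h'.vertexVal_zero, hv]
  rw [neg_zero, DGLA.zero_bch (Submodule.neg_mem _ hα), DGLA.bch_zero (Submodule.neg_mem _ hα),
    DGLA.neg_bch hα, sub_zero]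

/-- The element `b` gives a path `q` of stabilizers of `∂_0 x` from `0` to the product in the
relation. Solving for the gauge transformation gives `H = P' • ∂_0 a • (-q) • (-P)`. -/
theorem gaugeEquiv_of_Z1Rel (h : HasForm g.trunc A η x p) (h' : HasForm g.trunc A η' x' p')
    (hR : Z1Rel g.trunc A ⟨_, h.mem_Z1⟩ ⟨_, h'.mem_Z1⟩) :
    (totTW g.trunc).GaugeEquiv A η η' := by
  obtain ⟨a, ha, b, hb, hax, hs⟩ := hR
  replace hax : (g.trunc.obj 0).gauge A a x = x' := hax
  have hu : (g.trunc.coface 0 0).ext A x ∈ (g.trunc.obj 1).extGr A 1 :=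
    (g.trunc.coface 0 0).ext_mem h.isMC.1
  have hz := formMul_one_mem (Ω := forms K 1) hu
  have hα : (g.trunc.coface 0 0).ext A a ∈ (g.trunc.obj 1).extGr A 0 :=
    (g.trunc.coface 0 0).ext_mem ha
  have hε : (g.trunc.coface 0 1).ext A a ∈ (g.trunc.obj 1).extGr A 0 :=
    (g.trunc.coface 0 1).ext_mem ha
  have hα' := formMul_one_mem (Ω := forms K 1) hα
  have hP := h.polyForm_mem
  have hP' := h'.polyForm_mem
  have hm := h.polyEvalOne_mem
  have hm' := h'.polyEvalOne_mem
  have hx1 := (g.trunc.coface 0 1).ext_mem h.isMC.1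
  have n1 := DGLA.bch_mem (Submodule.neg_mem _ hm) (Submodule.neg_mem _ hε)
  have n2 := DGLA.bch_mem n1 hm'
  have n3 := DGLA.bch_mem n2 hα
  -- The product stabilizes `∂_0 x` because the factors, from the right, move it to `∂_0 x'`, then
  -- `∂_1 x'`, then `∂_1 x` and back; this uses both cocycle conditions.
  obtain ⟨q, hq, hq0, hq1, hqz⟩ := stabilizes_of_exact hu n3 hb (by
    rw [DGLA.gauge_bch n2 hα hu, DGLA.gauge_bch n1 hm' (DGLA.gauge_mem hα hu),
      DGLA.gauge_bch (Submodule.neg_mem _ hm) (Submodule.neg_mem _ hε)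
        (DGLA.gauge_mem hm' (DGLA.gauge_mem hα hu)), ← DGLA.Hom.ext_gauge, hax,
      ← h'.coface_one, ← hax, DGLA.Hom.ext_gauge, DGLA.gauge_neg_gauge hε hx1, h.coface_one,
      DGLA.gauge_neg_gauge hm hu]) hs
  have hqz' : (tensor (forms K 1) (g.trunc.obj 1)).gauge A (-q)
      (formMul (forms K 1) (g.trunc.obj 1) A 1 ((g.trunc.coface 0 0).ext A x)) =
      formMul (forms K 1) (g.trunc.obj 1) A 1 ((g.trunc.coface 0 0).ext A x) := by
    conv_lhs => rw [← hqz]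
    exact DGLA.gauge_neg_gauge hq hz
  have m1 := DGLA.bch_mem hP' hα'
  have m2 := DGLA.bch_mem m1 (Submodule.neg_mem _ hq)
  have m3 := DGLA.bch_mem m2 (Submodule.neg_mem _ hP)
  -- The endpoints of `H` must be `∂_0 a` and `∂_1 a`. At `t = 0` all other factors vanish; at `t =
  -- 1` it is a group identity.
  obtain ⟨ζ, hζ, hζ0, hζ1⟩ := exists_tot_of_vertexVal ha m3 fun l => by
    simp only [vertexVal_bch, map_neg, vertexVal_formMul_one]
    fin_cases l
    · simp only [Fin.zero_eta, h.vertexVal_zero, h'.vertexVal_zero, hq0, neg_zero]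
      rw [DGLA.zero_bch hα, DGLA.bch_zero hα, DGLA.bch_zero hα]
    · simp only [Fin.mk_one, HasForm.vertexVal_one, hq1]
      exact bch_solve hm hε hm' hα
  refine ⟨ζ, hζ, tot_ext ?_ ?_⟩
  · rw [DGLA.Hom.ext_gauge, hζ0, h.level_zero, h'.level_zero, ← gauge_formMul_one, hax]
  · rw [DGLA.Hom.ext_gauge, hζ1, h.level_one, h'.level_one,
      DGLA.gauge_bch m2 (Submodule.neg_mem _ hP) (DGLA.gauge_mem hP hz),
      DGLA.gauge_neg_gauge hP hz, DGLA.gauge_bch m1 (Submodule.neg_mem _ hq) hz, hqz',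
      DGLA.gauge_bch hP' hα' hz, ← gauge_formMul_one, ← DGLA.Hom.ext_gauge, hax]

end Relation

end ThomWhitney

namespace ThomWhitney

/-! ### The isomorphism of functors -/

section Comparison

variable {K : Type u} [Field K] [CharZero K] (g : SemicosimplicialDGLA.{u, v} K)

/-- The cocycle `(x, p(1))` of the Maurer-Cartan element `(x, e^p * ∂_{0,1} x)`. -/
noncomputable def cocycle (A : ArtAlg.{u} K) (η : (totTW g.trunc).MC A) : Z1 g.trunc A :=
  ⟨_, (hasForm_existsUnique η).choose_spec.1.mem_Z1⟩

variable {g} {A : ArtAlg.{u} K}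

/-- Uniqueness of the normal form makes the chosen cocycle computable from any presentation. -/
theorem cocycle_eq {η : (totTW g.trunc).MC A} {x : (g.trunc.obj 0).ext A}
    {p : ℕ →₀ (g.trunc.obj 1).ext A} (h : HasForm g.trunc A η x p) :
    cocycle g A η = ⟨_, h.mem_Z1⟩ := by
  have := (hasForm_existsUnique η).choose_spec.2 (x, p) h
  refine Subtype.ext ?_
  change ((hasForm_existsUnique η).choose.1,
    polyEvalOne (g.trunc.obj 1) A (hasForm_existsUnique η).choose.2) = _
  rw [← this]

theorem cocycle_rel_iff (η η' : (totTW g.trunc).MC A) :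
    Z1Rel g.trunc A (cocycle g A η) (cocycle g A η') ↔ (totTW g.trunc).GaugeEquiv A η η' := by
  obtain ⟨⟨x, p⟩, h, -⟩ := hasForm_existsUnique η
  obtain ⟨⟨x', p'⟩, h', -⟩ := hasForm_existsUnique η'
  rw [cocycle_eq h, cocycle_eq h']
  exact ⟨gaugeEquiv_of_Z1Rel h h', Z1Rel_of_gaugeEquiv h h'⟩

theorem cocycle_surjective (q : Z1 g.trunc A) : ∃ η, cocycle g A η = q := by
  obtain ⟨η, h⟩ := exists_hasForm q.2
  refine ⟨η, ?_⟩
  rw [cocycle_eq h]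
  refine Subtype.ext (Prod.ext rfl ?_)
  change polyEvalOne (g.trunc.obj 1) A (Finsupp.single 1 q.1.2) = q.1.2
  rw [polyEvalOne, Finsupp.sum_single_index rfl]

variable (g A) in
/-- The bijection `Def_{Tot_TW(g)}(A) → H^1_sc(exp g)(A)`, for `g` concentrated in levels `0`
and `1`. -/
noncomputable def defEquiv : (totTW g.trunc).Def.obj A ≃ (H1sc g.trunc).obj A where
  toFun := Quot.map (cocycle g A) fun η η' h => (cocycle_rel_iff η η').mpr h
  invFun := Quot.map (fun q => (cocycle_surjective q).choose) fun q q' h =>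
    (cocycle_rel_iff _ _).mp (by
      rwa [(cocycle_surjective q).choose_spec, (cocycle_surjective q').choose_spec])
  left_inv η := by
    induction η using Quot.ind with | mk η => ?_
    refine Quot.sound ((cocycle_rel_iff _ _).mp ?_)
    rw [(cocycle_surjective (cocycle g A η)).choose_spec, cocycle_rel_iff]
    exact ((totTW g.trunc).gaugeEquiv_equivalence A).refl η
  right_inv q := by
    induction q using Quot.ind with | mk q => ?_
    exact congrArg (Quot.mk _) (cocycle_surjective q).choose_spec

variable (g) in
/-- The isomorphism of functors `Def_{Tot_TW(g)} ≅ H^1_sc(exp g)`, for `g` concentrated in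
levels `0` and `1`. -/
noncomputable def defIso : (totTW g.trunc).Def ≅ H1sc g.trunc :=
  NatIso.ofComponents (fun A => (defEquiv g A).toIso) fun {A B} f => by
    ext η
    induction η using Quot.ind with | mk η => ?_
    refine congrArg (Quot.mk (Z1Rel g.trunc B)) ?_
    obtain ⟨⟨x, p⟩, h, -⟩ := hasForm_existsUnique η
    -- Base change carries normal forms to normal forms, so naturality reduces to that of evaluation
    -- at 1.
    refine (cocycle_eq (h.map f)).trans (Subtype.ext ?_)
    rw [cocycle_eq h]
    exact Prod.ext rfl (HasForm.polyEvalOne_map f)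

theorem defIso_app_mk (η : (totTW g.trunc).MC A) :
    (defIso g).hom.app A (Quot.mk _ η) = Quot.mk _ (cocycle g A η) := rfl

end Comparison

end ThomWhitney

/-! ### The main theorem -/

open ThomWhitney CategoryTheory
theorem mainTheorem5 {K : Type u} [Field K] [IsAlgClosed K] [CharZero K]
    (g : SemicosimplicialDGLA.{u, v} K) :
    (∀ (A : ArtAlg.{u} K) (η : (totTW g.trunc).MC A),
      ∃! q : (g.trunc.obj 0).ext A × (ℕ →₀ (g.trunc.obj 1).ext A),
        HasForm g.trunc A η q.1 q.2) ∧
    (∃ Φ : (totTW g.trunc).Def ≅ H1sc g.trunc,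
      ∀ (A : ArtAlg.{u} K) (η : (totTW g.trunc).MC A) (x : (g.trunc.obj 0).ext A)
        (p : ℕ →₀ (g.trunc.obj 1).ext A), HasForm g.trunc A η x p →
        ∃ hz : (x, polyEvalOne (g.trunc.obj 1) A p) ∈ Z1 g.trunc A,
          Φ.hom.app A (Quot.mk _ η) = Quot.mk _ ⟨_, hz⟩) ∧
    IsDeformationFunctor (H1sc g.trunc) := by
  refine ⟨fun A η => hasForm_existsUnique η, ⟨defIso g, fun A η x p h => ⟨h.mem_Z1, ?_⟩⟩,
    (totTW g.trunc).isDeformationFunctor_def.of_iso (defIso g)⟩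
  rw [defIso_app_mk, cocycle_eq h]
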